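/- Let $d\in\{2,3\}$, $t_0<T$, and let $\phi\in C^\infty(\mathbb R^d\times[t_0,T])$ be real-valued. Set $\Omega(t)=\{x:\phi(x,t)<0\}$, $\Gamma(t)=\{x:\phi(x,t)=0\}$ and assume that all $\Omega(t)$, $t\in[t_0,T]$, are contained in one fixed ball. Let $\nabla$, $\nabla^2$ denote derivatives in $x$ and $\phi_t$ the time derivative. Assume that there are $t_c\in[t_0,T]$ and $x_c\in\Gamma(t_c)$ with $\nabla\phi(x_c,t_c)=0$, $\det\nabla^2\phi(x_c,t_c)\ne0$, $\phi_t(x_c,t_c)\neq0$, and that $\nabla\phi(x,t)\neq0$ for all $t\in[t_0,T]$, $x\in\Gamma(t)$ with $(x,t)\ne(x_c,t_c)$. Put $$\mathcal Q=\bigcup_{t\in(t_0,T)}\Omega(t)\times\{t\},\qquad \Gamma_{\mathcal Q}=\bigcup_{t\in(t_0,T)}\Gamma(t)\times\{t\}.$$ Let $H=\{u\in L^2(\mathcal Q):\ \partial_iu\in L^2(\mathcal Q),\ 1\le i\le d\}$ (weak derivatives in the space variables only), with inner product $(u,v)_{H}=(u,v)_{L^2(\mathcal Q)}+(\nabla u,\nabla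 v)_{L^2(\mathcal Q)}$. Let $V_\Gamma=-\phi_t/|\nabla\phi|$ be the normal velocity of $\Gamma(t)$ and define, on $\Gamma_{\mathcal Q}$, the weight $\omega=|t-t_c|^{1/2}(1+V_\Gamma^2)^{-1/2}$ if $\nabla^2\phi(x_c,t_c)$ is positive definite (creation or vanishing of an island), and $\omega=(1+V_\Gamma^2)^{-1/2}$ otherwise. Let $L^2_\omega(\Gamma_{\mathcal Q})$ be the $L^2$ space of the measure $\omega\,dq$, where $dq$ is the $d$-dimensional surface measure on $\Gamma_{\mathcal Q}\subset\mathbb R^{d+1}$. Then there is exactly one bounded linear operator $\tau:H\to L^2_\omega(\Gamma_{\mathcal Q})$ (the trace) such that $\tau v=v|_{\Gamma_{\mathcal Q}}$ for every $v\in C^\infty(\overline{\mathcal Q})$, i.e. for every restriction of a $C^\infty$ function on $\mathbb R^{d+1}$. Moreover, $C_c^\infty(\mathcal Q)$ is dense in $H_0=\{u\in H:\tau u=0\}$: it is contained in $H_0$, and its closure in $H$ is $H_0$. -/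

import Mathlib

open MeasureTheory Set
open scoped ContDiff ENNReal

noncomputable section

namespace EvolvingDomain

/-- The Euclidean space `ℝ^d`. -/
abbrev Space (d : ℕ) : Type := EuclideanSpace ℝ (Fin d)

/-- Space-time points `(x, t)`. Differentiability and Lebesgue measure on `ℝ^(d+1)` are those of
the product; the Euclidean distance is only needed for the surface measure below. -/
abbrev SpaceTime (d : ℕ) : Type := Space d × ℝ

variable {d : ℕ}

/-! ### Derivatives of the level set function -/

/-- The spatial gradient `∇φ(x,t)`. -/
def spatialGradient (φ : SpaceTime d → ℝ) (z : SpaceTime d) : Space d :=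
  gradient (fun x : Space d => φ (x, z.2)) z.1

/-- The time derivative `∂φ/∂t (x,t)` of a function on `ℝ^d × [t₀,T]`, one-sided at `t₀`, `T`. -/
def timeDerivative (t₀ T : ℝ) (φ : SpaceTime d → ℝ) (z : SpaceTime d) : ℝ :=
  derivWithin (fun s : ℝ => φ (z.1, s)) (Icc t₀ T) z.2

/-- The spatial Hessian matrix `∇²φ(x,t)`, with entries `∂ᵢ∂ⱼφ(x,t)`. -/
def spatialHessian (φ : SpaceTime d → ℝ) (z : SpaceTime d) : Matrix (Fin d) (Fin d) ℝ :=
  Matrix.of fun i j =>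
    fderiv ℝ (fun y : Space d =>
      fderiv ℝ (fun x : Space d => φ (x, z.2)) y (EuclideanSpace.single j 1)) z.1
      (EuclideanSpace.single i 1)

/-! ### The space-time domain and its spatial boundary -/

/-- `𝒬 = ⋃_{t ∈ (t₀,T)} Ω(t) × {t}` with `Ω(t) = {x | φ(x,t) < 0}`. -/
def domain (t₀ T : ℝ) (φ : SpaceTime d → ℝ) : Set (SpaceTime d) :=
  {z | z.2 ∈ Ioo t₀ T ∧ φ z < 0}

/-- `Γ_𝒬 = ⋃_{t ∈ (t₀,T)} Γ(t) × {t}` with `Γ(t) = {x | φ(x,t) = 0}`. -/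
def lateralBoundary (t₀ T : ℝ) (φ : SpaceTime d → ℝ) : Set (SpaceTime d) :=
  {z | z.2 ∈ Ioo t₀ T ∧ φ z = 0}

/-- The assumptions on the evolving domain: `φ` is smooth on `ℝ^d × [t₀,T]`, the domains `Ω(t)`
are bounded, and `(xc,tc)` is the only critical point on the zero level; it is nondegenerate, and
`∂φ/∂t` does not vanish there. -/
structure IsAdmissible (t₀ T : ℝ) (φ : SpaceTime d → ℝ) (xc : Space d) (tc : ℝ) : Prop where
  time_lt : t₀ < T
  smooth : ContDiffOn ℝ ∞ φ (univ ×ˢ Icc t₀ T)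
  bounded : ∃ R : ℝ, ∀ t ∈ Icc t₀ T, ∀ x : Space d, φ (x, t) < 0 → ‖x‖ ≤ R
  time_mem : tc ∈ Icc t₀ T
  zero_level : φ (xc, tc) = 0
  critical : spatialGradient φ (xc, tc) = 0
  isolated : ∀ t ∈ Icc t₀ T, ∀ x : Space d, φ (x, t) = 0 → (x, t) ≠ (xc, tc) →
    spatialGradient φ (x, t) ≠ 0
  nondegenerate : (spatialHessian φ (xc, tc)).det ≠ 0
  time_derivative_ne : timeDerivative t₀ T φ (xc, tc) ≠ 0

/-! ### The anisotropic space `H` -/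

/-- `ψ ∈ C_c^∞(U)`, as a function on the whole space which vanishes outside `U`. -/
def IsTestFunction (U : Set (SpaceTime d)) (ψ : SpaceTime d → ℝ) : Prop :=
  ContDiff ℝ ∞ ψ ∧ HasCompactSupport ψ ∧ tsupport ψ ⊆ U

/-- The classical partial derivative `∂ᵢψ` with respect to the space variable `xᵢ`. -/
def spatialPartial (i : Fin d) (ψ : SpaceTime d → ℝ) (z : SpaceTime d) : ℝ :=
  fderiv ℝ ψ z (EuclideanSpace.single i 1, 0)

/-- `p` is the weak spatial gradient of `u` in `U`. -/
def IsWeakSpatialGradient (U : Set (SpaceTime d)) (u : SpaceTime d → ℝ)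
    (p : SpaceTime d → Space d) : Prop :=
  ∀ ψ : SpaceTime d → ℝ, IsTestFunction U ψ → ∀ i : Fin d,
    ∫ z in U, u z * spatialPartial i ψ z = - ∫ z in U, p z i * ψ z

theorem IsTestFunction.memLp {U : Set (SpaceTime d)} {ψ : SpaceTime d → ℝ}
    (hψ : IsTestFunction U ψ) : MemLp ψ 2 (volume.restrict U) :=
  (hψ.1.continuous.memLp_of_hasCompactSupport hψ.2.1 (μ := volume)).restrict U

theorem IsTestFunction.memLp_partial {U : Set (SpaceTime d)} {ψ : SpaceTime d → ℝ}
    (hψ : IsTestFunction U ψ) (i : Fin d) :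
    MemLp (spatialPartial i ψ) 2 (volume.restrict U) := by
  have hc : Continuous (spatialPartial i ψ) :=
    (hψ.1.continuous_fderiv (by simp)).clm_apply continuous_const
  exact (hc.memLp_of_hasCompactSupport (hψ.2.1.fderiv_apply (𝕜 := ℝ) _)
    (μ := volume)).restrict U

theorem memLp_coord {U : Set (SpaceTime d)} (p : Lp (Space d) 2 (volume.restrict U)) (i : Fin d) :
    MemLp (fun z => p z i) 2 (volume.restrict U) :=
  (EuclideanSpace.proj (𝕜 := ℝ) i).comp_memLp' (Lp.memLp p)

/-- The space `H = {u ∈ L²(U) | ∂ᵢu ∈ L²(U), 1 ≤ i ≤ d}`. An element `u` is represented by the pair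
`(u, ∇u)` of `u` with its (unique) weak spatial gradient, so that the inner product inherited from
`L²(U) × L²(U)^d` is `(u,v) + (∇u,∇v)`. -/
def anisotropicSpace (U : Set (SpaceTime d)) :
    Submodule ℝ (WithLp 2 (Lp ℝ 2 (volume.restrict U) × Lp (Space d) 2 (volume.restrict U))) where
  carrier := {u | IsWeakSpatialGradient U u.fst u.snd}
  zero_mem' := by
    intro ψ _ i
    have h1 : (fun z => (0 : Lp ℝ 2 (volume.restrict U)) z * spatialPartial i ψ z)
        =ᵐ[volume.restrict U] fun _ => 0 := by
      filter_upwards [Lp.coeFn_zero ℝ 2 (volume.restrict U)] with z hz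
      rw [hz, Pi.zero_apply, zero_mul]
    have h2 : (fun z => (0 : Lp (Space d) 2 (volume.restrict U)) z i * ψ z)
        =ᵐ[volume.restrict U] fun _ => 0 := by
      filter_upwards [Lp.coeFn_zero (Space d) 2 (volume.restrict U)] with z hz
      rw [hz, Pi.zero_apply, PiLp.zero_apply, zero_mul]
    simp only [WithLp.zero_fst, WithLp.zero_snd]
    rw [integral_congr_ae h1, integral_congr_ae h2]
    simp
  add_mem' := by
    intro u v hu hv ψ hψ i
    have hu' := hu ψ hψ i
    have hv' := hv ψ hψ i
    have h1 : (fun z => (u.fst + v.fst) z * spatialPartial i ψ z)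
        =ᵐ[volume.restrict U]
          fun z => u.fst z * spatialPartial i ψ z + v.fst z * spatialPartial i ψ z := by
      filter_upwards [Lp.coeFn_add u.fst v.fst] with z hz
      rw [hz, Pi.add_apply, add_mul]
    have h2 : (fun z => (u.snd + v.snd) z i * ψ z)
        =ᵐ[volume.restrict U] fun z => u.snd z i * ψ z + v.snd z i * ψ z := by
      filter_upwards [Lp.coeFn_add u.snd v.snd] with z hz
      rw [hz, Pi.add_apply, PiLp.add_apply, add_mul]
    simp only [WithLp.add_fst, WithLp.add_snd]
    have e1 := integral_add ((Lp.memLp u.fst).integrable_mul (hψ.memLp_partial i))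
      ((Lp.memLp v.fst).integrable_mul (hψ.memLp_partial i))
    have e2 := integral_add ((memLp_coord u.snd i).integrable_mul hψ.memLp)
      ((memLp_coord v.snd i).integrable_mul hψ.memLp)
    simp only [Pi.mul_apply] at e1 e2
    rw [integral_congr_ae h1, integral_congr_ae h2, e1, e2, hu', hv']
    ring
  smul_mem' := by
    intro c u hu ψ hψ i
    have hu' := hu ψ hψ i
    have h1 : (fun z => (c • u.fst) z * spatialPartial i ψ z)
        =ᵐ[volume.restrict U] fun z => c * (u.fst z * spatialPartial i ψ z) := by
      filter_upwards [Lp.coeFn_smul c u.fst] with z hz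
      simp [hz, mul_assoc]
    have h2 : (fun z => (c • u.snd) z i * ψ z)
        =ᵐ[volume.restrict U] fun z => c * (u.snd z i * ψ z) := by
      filter_upwards [Lp.coeFn_smul c u.snd] with z hz
      simp [hz, mul_assoc]
    simp only [WithLp.smul_fst, WithLp.smul_snd]
    rw [integral_congr_ae h1, integral_congr_ae h2, integral_const_mul, integral_const_mul, hu']
    ring

/-- The element `u` of `H` is (the class of) the function `f`. -/
def Represents {U : Set (SpaceTime d)} (u : anisotropicSpace U) (f : SpaceTime d → ℝ) : Prop :=
  (u : WithLp 2 (Lp ℝ 2 (volume.restrict U) × Lp (Space d) 2 (volume.restrict U))).fst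
    =ᵐ[volume.restrict U] f

/-- The set `C_c^∞(U)`, regarded as a subset of `H`. -/
def testFunctions (U : Set (SpaceTime d)) : Set (anisotropicSpace U) :=
  {u | ∃ ψ : SpaceTime d → ℝ, IsTestFunction U ψ ∧ Represents u ψ}

/-! ### The trace on the spatial boundary -/

/-- The `d`-dimensional surface measure on `ℝ^(d+1)`, i.e. the `d`-dimensional Hausdorff measure of
the Euclidean distance, normalized so that it agrees with Lebesgue measure on `d`-planes. -/
def surfaceMeasure (d : ℕ) : Measure (SpaceTime d) :=
  (Measure.euclideanHausdorffMeasure d : Measure (WithLp 2 (SpaceTime d))).map WithLp.ofLp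

/-- The normal velocity `V_Γ = -φ_t / |∇φ|` of `Γ(t)`. -/
def normalVelocity (t₀ T : ℝ) (φ : SpaceTime d → ℝ) (z : SpaceTime d) : ℝ :=
  - timeDerivative t₀ T φ z / ‖spatialGradient φ z‖

open Classical in
/-- The weight `ω`: it is `|t - tc|^(1/2) (1 + V_Γ²)^(-1/2)` if an island is created or vanishes at
`(xc,tc)`, that is, if all eigenvalues of `∇²φ(xc,tc)` are positive, and `(1 + V_Γ²)^(-1/2)`
otherwise. -/
def weight (t₀ T : ℝ) (φ : SpaceTime d → ℝ) (xc : Space d) (tc : ℝ) (z : SpaceTime d) : ℝ :=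
  (if (spatialHessian φ (xc, tc)).PosDef then √|z.2 - tc| else 1)
    / √(1 + normalVelocity t₀ T φ z ^ 2)

/-- The measure `ω dq` on `Γ_𝒬`, so that `Lp ℝ 2` of it is `L²_ω(Γ_𝒬)`. -/
def weightedSurfaceMeasure (t₀ T : ℝ) (φ : SpaceTime d → ℝ) (xc : Space d) (tc : ℝ) :
    Measure (SpaceTime d) :=
  ((surfaceMeasure d).restrict (lateralBoundary t₀ T φ)).withDensity
    fun z => ENNReal.ofReal (weight t₀ T φ xc tc z)

/-- `τ` is a trace operator: a bounded linear operator from `H` to `L²_ω(Γ_𝒬)` which maps every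
`v ∈ C^∞(closure 𝒬)` (the restriction of a smooth function on `ℝ^(d+1)`) to its restriction to
`Γ_𝒬`. -/
def IsTraceOperator (t₀ T : ℝ) (φ : SpaceTime d → ℝ) (xc : Space d) (tc : ℝ)
    (τ : anisotropicSpace (domain t₀ T φ) →L[ℝ]
      Lp ℝ 2 (weightedSurfaceMeasure t₀ T φ xc tc)) : Prop :=
  ∀ v : SpaceTime d → ℝ, ContDiff ℝ ∞ v →
    ∀ u : anisotropicSpace (domain t₀ T φ), Represents u v →
      τ u =ᵐ[weightedSurfaceMeasure t₀ T φ xc tc] v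

end EvolvingDomain

end

/-! Everything rests on the divergence theorem in `𝒬` for fields `(X, 0)` with no time component.
Their flux density through `Γ_𝒬` is `X·∇φ / |Dφ|`, where `D` is the space-time gradient, and the
weight `ω` is exactly `|∇φ| / |Dφ|`, times `|t - tc|^(1/2)` in the definite case. The area element
itself is never computed: in suitable local coordinates `Γ_𝒬` is a Lipschitz graph, and two
Lipschitz maps compare the graph measure with Hausdorff measure up to the factor `2 ^ d`.
Inequalities are all that is needed.

Trace inequality. Suppose that `X` is bounded on `𝒬`, that `div X` is bounded above, and that `X·∇φ`
dominates `|∇φ|` (times the power of `|t - tc|`) on `Γ_𝒬`. Integrating `div (v² X) = v² div X + 2 v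
X·∇v` then bounds `∫ v² ω dq` by `‖v‖_H²`. A one-sided bound on `div X` suffices because `v² ≥ 0`.
Where `∇φ` stays away from zero, `X = ∇φ` will do. Near the critical point put `ξ = x - xc`, `s = t
- tc`, `τ = |s|`, so that `φ ≈ ⟨Aξ, ξ⟩ / 2 + κ s` with `A` the Hessian and `κ = φ_t` at the critical
point. Let `P` project onto the negative eigenspace of `A`, of dimension `k`, and let `ρ² = |Pξ|² +
τ`. The field `localField` is bounded for `φ ≤ 0` and satisfies `X·∇φ ≥ c |∇φ|` for `φ = 0`
(`localField_estimate`). For `k ≥ 1` its divergence is nonpositive; for `k = 0` it equals `d / √τ`,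
and multiplying the field by `√τ` repairs this. Hence the weight distinguishes the definite case
from all others. The two fields are glued in `exists_transversal_field`, and `exists_trace_bound` is
the resulting inequality.

Density. Functions of `t` alone have no spatial gradient, so time cutoffs cost nothing in `H`. They
remove the end times and the critical time, and the critical point with them
(`mem_topologicalClosure_of_local`). Near the remaining boundary points `Dφ ≠ 0`, so there is a
direction along which small translations move the closed domain into its interior. Mollifying with a
kernel whose centre is shifted outwards gives approximation by smooth functions; the trace then
extends by continuity and is unique. A kernel shifted inwards gives test functions, provided that
the extension of `u` by zero still has a spatial weak gradient in `L²` across `Γ_𝒬`. This holds if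
the trace of `u` vanishes: the defect in the integration by parts formula is bounded by the trace
for smooth functions, hence for all of `H` (`exists_boundaryPairing_le`). -/

noncomputable section
set_option linter.unusedSectionVars false
namespace EvolvingDomain

/-! ### Mollification in `L²` with kernels that need not be centred at the origin. -/

section Mollification

open Filter Topology Metric

variable {G F : Type*} [NormedAddCommGroup G] [NormedSpace ℝ G] [FiniteDimensional ℝ G]
  [MeasurableSpace G] [BorelSpace G] {μ : Measure G} [μ.IsAddHaarMeasure]
  [NormedAddCommGroup F] [NormedSpace ℝ F] [CompleteSpace F]

/-- Translations are continuous in `L²`. -/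
theorem exists_eLpNorm_translate_sub_le {f : G → F} (hf : MemLp f 2 μ) {ε : ℝ≥0∞} (hε : 0 < ε) :
    ∃ r > 0, ∀ u : G, ‖u‖ < r → eLpNorm (fun z => f (z - u) - f z) 2 μ ≤ ε := by
  have hmp : ∀ u : G, MeasurePreserving (fun z : G => z - u) μ μ := fun u =>
    measurePreserving_sub_right μ u
  let g : G → C(G, G) := fun u => ⟨fun z => z - u, by fun_prop⟩
  have hg : Continuous g := by
    let h : C(G × G, G) := ⟨fun p => p.2 - p.1, by fun_prop⟩
    exact h.curry.continuous
  have hcont := (continuous_const (y := hf.toLp f)).compMeasurePreservingLp hg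
    (fun u => hmp u) (by simp : (2 : ℝ≥0∞) ≠ ⊤)
  have h0 := (hcont.tendsto 0)
  rw [Metric.tendsto_nhds_nhds] at h0
  by_cases hεt : ε = ⊤
  · exact ⟨1, one_pos, fun u _ => by simp [hεt]⟩
  obtain ⟨r, hr, H⟩ := h0 ε.toReal (ENNReal.toReal_pos hε.ne' hεt)
  refine ⟨r, hr, fun u hu => ?_⟩
  have h1 := H (x := u) (by simpa using hu)
  have e1 : ∀ u : G, Lp.compMeasurePreserving (g u) (hmp u) (hf.toLp f)
      = (hf.comp_measurePreserving (hmp u)).toLp _ := fun u => rfl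
  simp only [e1] at h1
  rw [dist_comm, Lp.dist_eq_norm, neg_add_eq_sub, ← MemLp.toLp_sub, Lp.norm_toLp] at h1
  have hfin : MemLp (f ∘ (fun z => z - u) - f ∘ (fun z => z - 0)) 2 μ :=
    (hf.comp_measurePreserving (hmp u)).sub (hf.comp_measurePreserving (hmp 0))
  have h2 : eLpNorm (f ∘ (fun z => z - u) - f ∘ (fun z => z - 0)) 2 μ ≤ ε := by
    rw [← ENNReal.ofReal_toReal hfin.2.ne, ← ENNReal.ofReal_toReal hεt]
    exact ENNReal.ofReal_le_ofReal h1.le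
  convert h2 using 2
  ext z
  simp

/-- Approximation of the identity in `L²`, with kernels which need not be symmetric. -/
theorem exists_eLpNorm_mollify_sub_le {f : G → F} (hf : MemLp f 2 μ) (hfm : StronglyMeasurable f)
    {ε : ℝ≥0∞} (hε : 0 < ε) :
    ∃ r > 0, ∀ k : G → ℝ, Continuous k → (∀ u, 0 ≤ k u) → ∫ u, k u ∂μ = 1 →
      (∀ u, r ≤ ‖u‖ → k u = 0) →
      eLpNorm (fun z => (∫ u, k u • f (z - u) ∂μ) - f z) 2 μ ≤ ε := by
  obtain ⟨r, hr, H⟩ := exists_eLpNorm_translate_sub_le hf hε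
  refine ⟨r, hr, fun k hk hk0 hk1 hkr => ?_⟩
  have hkc : HasCompactSupport k := by
    refine HasCompactSupport.intro (isCompact_closedBall (0 : G) r) fun u hu => hkr u ?_
    simp only [mem_closedBall, dist_zero_right, not_le] at hu
    exact hu.le
  have hki : Integrable k μ := hk.integrable_of_hasCompactSupport hkc
  have hk1' : ∫⁻ u, ENNReal.ofReal (k u) ∂μ = 1 := by
    rw [← ofReal_integral_eq_lintegral_ofReal hki (ae_of_all _ hk0), hk1, ENNReal.ofReal_one]
  have hkm : Measurable fun u => ENNReal.ofReal (k u) := by fun_prop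
  have hloc : LocallyIntegrable f μ := hf.locallyIntegrable (by norm_num)
  have hpt : ∀ z, ‖(∫ u, k u • f (z - u) ∂μ) - f z‖ₑ ^ (2 : ℝ) ≤
      ∫⁻ u, ENNReal.ofReal (k u) * ‖f (z - u) - f z‖ₑ ^ (2 : ℝ) ∂μ := by
    intro z
    have hint : Integrable (fun u => k u • f (z - u)) μ := by
      have hl : LocallyIntegrable (fun u => f (z - u)) μ := by
        have := (hf.comp_measurePreserving (Measure.measurePreserving_sub_left μ z))
        exact this.locallyIntegrable (by norm_num)
      exact hl.integrable_smul_left_of_hasCompactSupport hk hkc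
    have e1 : (∫ u, k u • f (z - u) ∂μ) - f z = ∫ u, k u • (f (z - u) - f z) ∂μ := by
      simp only [smul_sub]
      rw [integral_sub hint (hki.smul_const _), integral_smul_const, hk1, one_smul]
    rw [e1]
    have h1 : ‖∫ u, k u • (f (z - u) - f z) ∂μ‖ₑ
        ≤ ∫⁻ u, ENNReal.ofReal (k u) * ‖f (z - u) - f z‖ₑ ∂μ := by
      refine (enorm_integral_le_lintegral_enorm _).trans (le_of_eq ?_)
      refine lintegral_congr fun u => ?_
      rw [enorm_smul, Real.enorm_eq_ofReal (hk0 u)]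
    have hmeas : Measurable fun u => ‖f (z - u) - f z‖ₑ :=
      ((hfm.comp_measurable (measurable_const.sub measurable_id)).sub
        stronglyMeasurable_const).enorm
    -- Cauchy–Schwarz against the constant `1` for the probability measure `k du`.
    have h2 : ∫⁻ u, ENNReal.ofReal (k u) * ‖f (z - u) - f z‖ₑ ∂μ
        ≤ (∫⁻ u, ENNReal.ofReal (k u) * ‖f (z - u) - f z‖ₑ ^ (2 : ℝ) ∂μ) ^ (1 / 2 : ℝ) := by
      have hh := ENNReal.lintegral_mul_le_Lp_mul_Lq (μ.withDensity fun u => ENNReal.ofReal (k u))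
        (p := 2) (q := 2) ⟨by norm_num, by norm_num, by norm_num⟩ hmeas.aemeasurable
        (measurable_const (a := (1 : ℝ≥0∞))).aemeasurable
      simp only [Pi.mul_apply, mul_one, ENNReal.one_rpow] at hh
      rw [lintegral_withDensity_eq_lintegral_mul _ hkm hmeas,
        lintegral_withDensity_eq_lintegral_mul _ hkm (hmeas.pow_const _),
        lintegral_withDensity_eq_lintegral_mul _ hkm measurable_const] at hh
      simpa [hk1'] using hh
    calc _ ≤ ((∫⁻ u, ENNReal.ofReal (k u) * ‖f (z - u) - f z‖ₑ ^ (2 : ℝ) ∂μ) ^ (1 / 2 : ℝ))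
          ^ (2 : ℝ) := ENNReal.rpow_le_rpow (h1.trans h2) (by norm_num)
      _ = _ := by rw [← ENNReal.rpow_mul]; norm_num
  have hm2 : Measurable fun p : G × G => ENNReal.ofReal (k p.2) * ‖f (p.1 - p.2) - f p.1‖ₑ ^ (2 : ℝ) := by
    refine Measurable.mul (by fun_prop) (Measurable.pow_const ?_ _)
    exact ((hfm.comp_measurable (measurable_fst.sub measurable_snd)).sub
      (hfm.comp_measurable measurable_fst)).enorm
  rw [eLpNorm_eq_lintegral_rpow_enorm_toReal (by norm_num) (by norm_num)]
  simp only [ENNReal.toReal_ofNat]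
  have key : ∫⁻ z, ‖(∫ u, k u • f (z - u) ∂μ) - f z‖ₑ ^ (2 : ℝ) ∂μ ≤ ε ^ (2 : ℝ) := by
   calc ∫⁻ z, ‖(∫ u, k u • f (z - u) ∂μ) - f z‖ₑ ^ (2 : ℝ) ∂μ
      ≤ ∫⁻ z, ∫⁻ u, ENNReal.ofReal (k u) * ‖f (z - u) - f z‖ₑ ^ (2 : ℝ) ∂μ ∂μ :=
        lintegral_mono hpt
    _ = ∫⁻ u, ∫⁻ z, ENNReal.ofReal (k u) * ‖f (z - u) - f z‖ₑ ^ (2 : ℝ) ∂μ ∂μ :=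
        lintegral_lintegral_swap hm2.aemeasurable
    _ ≤ ∫⁻ u, ENNReal.ofReal (k u) * ε ^ (2 : ℝ) ∂μ := by
        refine lintegral_mono fun u => ?_
        rw [lintegral_const_mul' _ _ ENNReal.ofReal_ne_top]
        by_cases hu : r ≤ ‖u‖
        · simp [hkr u hu]
        · gcongr
          have h3 := H u (not_le.1 hu)
          rw [eLpNorm_eq_lintegral_rpow_enorm_toReal (by norm_num) (by norm_num)] at h3
          simp only [ENNReal.toReal_ofNat] at h3
          calc _ = ((∫⁻ z, ‖f (z - u) - f z‖ₑ ^ (2 : ℝ) ∂μ) ^ (1 / 2 : ℝ)) ^ (2 : ℝ) := by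
                rw [← ENNReal.rpow_mul]; norm_num
            _ ≤ _ := ENNReal.rpow_le_rpow h3 (by norm_num)
    _ = ε ^ (2 : ℝ) := by
        rw [lintegral_mul_const _ hkm, hk1', one_mul]
  calc _ ≤ (ε ^ (2 : ℝ)) ^ (1 / 2 : ℝ) := ENNReal.rpow_le_rpow key (by norm_num)
    _ = ε := by rw [← ENNReal.rpow_mul]; norm_num

end Mollification

/-! ### Divergence theorem for fields tangential to the level sets. -/

section Divergence

open Filter Topology Metric

variable {G : Type*} [NormedAddCommGroup G] [NormedSpace ℝ G]

theorem contDiff_of_tsupport' {F : Type*} [NormedAddCommGroup F] [NormedSpace ℝ F]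
    {f : G → F} {n : ℕ∞ω} (h : ∀ x ∈ tsupport f, ContDiffAt ℝ n f x) : ContDiff ℝ n f := by
  rw [contDiff_iff_contDiffAt]
  intro x
  by_cases hx : x ∈ tsupport f
  · exact h x hx
  · have : f =ᶠ[𝓝 x] fun _ => 0 := notMem_tsupport_iff_eventuallyEq.1 hx
    exact contDiffAt_const.congr_of_eventuallyEq this

theorem fderiv_eq_zero_of_notMem_tsupport {f : G → ℝ} {x : G} (hx : x ∉ tsupport f) :
    fderiv ℝ f x = 0 := by
  have : f =ᶠ[𝓝 x] fun _ => 0 := notMem_tsupport_iff_eventuallyEq.1 hx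
  rw [this.fderiv_eq]; simp

variable [FiniteDimensional ℝ G]
  [MeasurableSpace G] [BorelSpace G] {μ : Measure G} [μ.IsAddHaarMeasure]

theorem integrable_fderiv_apply {f : G → ℝ} (hf : ContDiff ℝ 1 f) (hc : HasCompactSupport f)
    (w : G) : Integrable (fun z => fderiv ℝ f z w) μ :=
  ((hf.continuous_fderiv (by simp)).clm_apply continuous_const).integrable_of_hasCompactSupport
    (hc.fderiv_apply (𝕜 := ℝ) w)

theorem integral_fderiv_apply_eq_zero {f : G → ℝ} (hf : ContDiff ℝ 1 f)
    (hc : HasCompactSupport f) (w : G) : ∫ z, fderiv ℝ f z w ∂μ = 0 := by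
  have := integral_mul_fderiv_eq_neg_fderiv_mul_of_integrable (μ := μ) (f := fun _ : G => (1 : ℝ))
    (g := f) (v := w) (by simp) (by simpa using integrable_fderiv_apply hf hc w)
    (by simpa using hf.continuous.integrable_of_hasCompactSupport hc)
    (fun x _ => by fun_prop) (fun x _ => hf.differentiable (by simp) x)
  simpa using this

/-- Smooth approximations from below of the indicator function of the negative half line. -/
def negCutoff (n : ℕ) (s : ℝ) : ℝ := Real.smoothTransition (-(n * s))

theorem negCutoff_contDiff (n : ℕ) {k : ℕ∞} : ContDiff ℝ k (negCutoff n) :=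
  Real.smoothTransition.contDiff.comp (by fun_prop)

theorem negCutoff_tendsto (s : ℝ) :
    Tendsto (fun n => negCutoff n s) atTop (𝓝 (if s < 0 then 1 else 0)) := by
  split_ifs with h
  · obtain ⟨N, hN⟩ := exists_nat_gt (1 / (-s))
    refine tendsto_const_nhds.congr' ?_
    filter_upwards [eventually_ge_atTop N] with n hn
    refine (Real.smoothTransition.one_of_one_le ?_).symm
    have h1 : (1 / (-s)) < n := hN.trans_le (by exact_mod_cast hn)
    rw [div_lt_iff₀ (by linarith)] at h1
    linarith
  · refine tendsto_const_nhds.congr fun n => ?_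
    refine (Real.smoothTransition.zero_of_nonpos ?_).symm
    have : 0 ≤ (n : ℝ) * s := mul_nonneg (by positivity) (not_lt.1 h)
    linarith

theorem negCutoff_abs_le (n : ℕ) (s : ℝ) : |negCutoff n s| ≤ 1 := by
  rw [negCutoff, abs_of_nonneg (Real.smoothTransition.nonneg _)]
  exact Real.smoothTransition.le_one _

/-- The factor which makes `f w - h v` tangential to the level sets of `φ`. -/
def tangentialFactor (φ f : G → ℝ) (v w : G) (z : G) : ℝ :=
  f z * fderiv ℝ φ z w / fderiv ℝ φ z v

theorem tsupport_tangentialFactor_subset (φ f : G → ℝ) (v w : G) :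
    tsupport (tangentialFactor φ f v w) ⊆ tsupport f := by
  refine closure_mono fun z hz => ?_
  simp only [Function.mem_support, tangentialFactor] at hz ⊢
  contrapose! hz
  simp [hz]

theorem tangentialFactor_contDiff {φ f : G → ℝ} {U : Set G} (hU : IsOpen U)
    (hφ : ContDiffOn ℝ ∞ φ U) (hf : ContDiff ℝ 1 f) (hfU : tsupport f ⊆ U) {v : G}
    (hv : ∀ z ∈ U, fderiv ℝ φ z v ≠ 0) (w : G) : ContDiff ℝ 1 (tangentialFactor φ f v w) := by
  refine contDiff_of_tsupport' fun z hz => ?_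
  have hzU := hfU (tsupport_tangentialFactor_subset φ f v w hz)
  have h1 : ContDiffAt ℝ 1 (fderiv ℝ φ) z :=
    (hφ.contDiffAt (hU.mem_nhds hzU)).fderiv_right (m := 1) (by norm_cast)
  exact (hf.contDiffAt.mul (h1.clm_apply contDiffAt_const)).div (h1.clm_apply contDiffAt_const)
    (hv z hzU)

/-- The divergence of a tangential field integrates to zero over the sublevel set. -/
theorem setIntegral_fderiv_eq_setIntegral_fderiv_tangentialFactor {φ f : G → ℝ} {U D : Set G}
    (hU : IsOpen U) (hD : MeasurableSet D) (hDU : ∀ z ∈ U, z ∈ D ↔ φ z < 0)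
    (hφ : ContDiffOn ℝ ∞ φ U) (hf : ContDiff ℝ 1 f) (hc : HasCompactSupport f)
    (hfU : tsupport f ⊆ U) {v : G}
    (hv : ∀ z ∈ U, fderiv ℝ φ z v ≠ 0) (w : G) :
    ∫ z in D, fderiv ℝ f z w ∂μ = ∫ z in D, fderiv ℝ (tangentialFactor φ f v w) z v ∂μ := by
  set h := tangentialFactor φ f v w with hh
  have hhC : ContDiff ℝ 1 h := tangentialFactor_contDiff hU hφ hf hfU hv w
  have hht : tsupport h ⊆ tsupport f := tsupport_tangentialFactor_subset φ f v w
  have hhc : HasCompactSupport h := hc.of_isClosed_subset (isClosed_tsupport _) hht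
  have mulC : ∀ (n : ℕ) (k : G → ℝ), ContDiff ℝ 1 k → tsupport k ⊆ tsupport f →
      ContDiff ℝ 1 (fun z => negCutoff n (φ z) * k z) ∧
      HasCompactSupport (fun z => negCutoff n (φ z) * k z) ∧
      ∀ z ∈ U, ∀ e, fderiv ℝ (fun z => negCutoff n (φ z) * k z) z e =
        negCutoff n (φ z) * fderiv ℝ k z e + k z * (deriv (negCutoff n) (φ z) * fderiv ℝ φ z e) := by
    intro n k hk hkt
    refine ⟨contDiff_of_tsupport' fun z hz => ?_, ?_, fun z hz e => ?_⟩
    · have hz' : z ∈ U := hfU (hkt (tsupport_mul_subset_right hz))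
      refine ContDiffAt.mul ?_ hk.contDiffAt
      exact ((negCutoff_contDiff n (k := 1)).contDiffAt).comp z
        ((hφ.contDiffAt (hU.mem_nhds hz')).of_le (by simp))
    · have hkc : HasCompactSupport k := hc.of_isClosed_subset (isClosed_tsupport _) hkt
      exact hkc.mul_left
    · have h1 : DifferentiableAt ℝ φ z := (hφ.contDiffAt (hU.mem_nhds hz)).differentiableAt (by simp)
      have h2 : HasDerivAt (negCutoff n) (deriv (negCutoff n) (φ z)) (φ z) :=
        ((negCutoff_contDiff n (k := 1)).differentiable (by simp) _).hasDerivAt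
      have h3 := (h2.comp_hasFDerivAt z h1.hasFDerivAt).mul
        (hk.differentiable (by simp) z).hasFDerivAt
      have := h3.fderiv
      simp only [Function.comp_def] at this
      erw [this]
      simp
  -- The field `f w - h v` annihilates `φ`, so differentiating the cutoff `negCutoff n (φ z)`
  -- contributes nothing. The integrand is therefore the divergence of a compactly supported field.
  have key : ∀ n, ∫ z, negCutoff n (φ z) * (fderiv ℝ f z w - fderiv ℝ h z v) ∂μ = 0 := by
    intro n
    obtain ⟨a1, a2, a3⟩ := mulC n f hf subset_rfl
    obtain ⟨b1, b2, b3⟩ := mulC n h hhC hht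
    have e : ∫ z, (fderiv ℝ (fun z => negCutoff n (φ z) * f z) z w
        - fderiv ℝ (fun z => negCutoff n (φ z) * h z) z v) ∂μ = 0 := by
      rw [integral_sub (integrable_fderiv_apply a1 a2 w) (integrable_fderiv_apply b1 b2 v),
        integral_fderiv_apply_eq_zero a1 a2, integral_fderiv_apply_eq_zero b1 b2, sub_zero]
    rw [← e]
    refine integral_congr_ae (ae_of_all _ fun z => ?_)
    simp only
    by_cases hz : z ∈ tsupport f
    · have hzU := hfU hz
      rw [a3 z hzU, b3 z hzU]
      have : h z * fderiv ℝ φ z v = f z * fderiv ℝ φ z w := by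
        rw [hh, tangentialFactor, div_mul_cancel₀ _ (hv z hzU)]
      linear_combination (-deriv (negCutoff n) (φ z)) * (this.symm)
    · have hz' : z ∉ tsupport h := fun h' => hz (hht h')
      rw [fderiv_eq_zero_of_notMem_tsupport hz, fderiv_eq_zero_of_notMem_tsupport hz',
        fderiv_eq_zero_of_notMem_tsupport (f := fun z => negCutoff n (φ z) * f z)
          (fun h' => hz (tsupport_mul_subset_right h')),
        fderiv_eq_zero_of_notMem_tsupport (f := fun z => negCutoff n (φ z) * h z)
          (fun h' => hz' (tsupport_mul_subset_right h'))]
      simp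
  have hdiff : Integrable (fun z => fderiv ℝ f z w - fderiv ℝ h z v) μ :=
    (integrable_fderiv_apply hf hc w).sub (integrable_fderiv_apply hhC hhc v)
  have hzero : ∀ z ∉ tsupport f, fderiv ℝ f z w - fderiv ℝ h z v = 0 := by
    intro z hz
    rw [fderiv_eq_zero_of_notMem_tsupport hz,
      fderiv_eq_zero_of_notMem_tsupport (fun h' => hz (hht h'))]
    simp
  have hlim : Tendsto (fun n => ∫ z, negCutoff n (φ z) * (fderiv ℝ f z w - fderiv ℝ h z v) ∂μ) atTop
      (𝓝 (∫ z, D.indicator (fun z => fderiv ℝ f z w - fderiv ℝ h z v) z ∂μ)) := by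
    refine tendsto_integral_of_dominated_convergence
      (fun z => ‖fderiv ℝ f z w - fderiv ℝ h z v‖) ?_ hdiff.norm ?_ ?_
    · intro n
      have hcont : ContinuousOn (fun z => negCutoff n (φ z) * (fderiv ℝ f z w - fderiv ℝ h z v)) U := by
        refine ContinuousOn.mul ?_ (Continuous.continuousOn ?_)
        · exact (negCutoff_contDiff n (k := 0)).continuous.comp_continuousOn hφ.continuousOn
        · exact ((hf.continuous_fderiv (by simp)).clm_apply continuous_const).sub
            ((hhC.continuous_fderiv (by simp)).clm_apply continuous_const)
      have : (fun z => negCutoff n (φ z) * (fderiv ℝ f z w - fderiv ℝ h z v)) =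
          U.indicator (fun z => negCutoff n (φ z) * (fderiv ℝ f z w - fderiv ℝ h z v)) := by
        ext z
        by_cases hz : z ∈ U
        · rw [indicator_of_mem hz]
        · rw [indicator_of_notMem hz, hzero z (fun h' => hz (hfU h')), mul_zero]
      rw [this]
      exact (aestronglyMeasurable_indicator_iff hU.measurableSet).2
        (hcont.aestronglyMeasurable hU.measurableSet)
    · intro n
      refine ae_of_all _ fun z => ?_
      rw [norm_mul]
      exact mul_le_of_le_one_left (norm_nonneg _) (negCutoff_abs_le n _)
    · refine ae_of_all _ fun z => ?_
      by_cases hz : z ∈ tsupport f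
      · have := (negCutoff_tendsto (φ z)).mul_const (fderiv ℝ f z w - fderiv ℝ h z v)
        convert this using 2
        by_cases hzD : z ∈ D
        · rw [indicator_of_mem hzD, if_pos ((hDU z (hfU hz)).1 hzD), one_mul]
        · rw [indicator_of_notMem hzD, if_neg (fun h' => hzD ((hDU z (hfU hz)).2 h')), zero_mul]
      · simp [hzero z hz, indicator]
  simp only [key] at hlim
  have h0 := tendsto_nhds_unique hlim tendsto_const_nhds
  rw [integral_indicator hD, integral_sub (integrable_fderiv_apply hf hc w).integrableOn
    (integrable_fderiv_apply hhC hhc v).integrableOn] at h0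
  linarith

end Divergence

/-! ### The zero level as a Lipschitz graph, and its surface measure. -/

section Graph

open Filter Topology Metric

variable {d : ℕ}

/-- Near a point where the derivative is a positive multiple of the last coordinate, the zero level
is a Lipschitz graph. -/
theorem exists_lipschitz_graph {φ : SpaceTime d → ℝ} {U : Set (SpaceTime d)} (hU : IsOpen U)
    (hφ : ContDiffOn ℝ ∞ φ U) {w₀ : SpaceTime d} (hw : w₀ ∈ U) (h0 : φ w₀ = 0) {α : ℝ} (hα : 0 < α)
    (hd : ∀ x, fderiv ℝ φ w₀ x = α * x.2) :
    ∃ δ > 0, ball w₀ δ ⊆ U ∧ ∃ g : Space d → ℝ, LipschitzWith 1 g ∧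
      (∀ z ∈ ball w₀ δ, 0 < fderiv ℝ φ z (0, 1)) ∧
      (∀ y ∈ ball w₀.1 δ, (y, g y) ∈ ball w₀ δ) ∧
      ∀ z ∈ ball w₀ δ, (φ z < 0 ↔ z.2 < g z.1) ∧ (φ z = 0 ↔ z.2 = g z.1) := by
  have hcont : ContinuousAt (fderiv ℝ φ) w₀ :=
    ((hφ.contDiffAt (hU.mem_nhds hw)).fderiv_right (m := 0) (by norm_cast)).continuousAt
  -- With the tolerance `α / 4`, vertical slopes are at least `3α/4`. On the central slice `|φ| ≤
  -- αδ/4`, which is less than the gain `3αδ/8` over a vertical distance `δ/2`, so every vertical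
  -- line over the ball meets the zero level. Two zeros satisfy `α |Δr| ≤ (α/4) max(|Δy|, |Δr|)`,
  -- which forces `|Δr| ≤ |Δy|`.
  obtain ⟨δ₁, hδ₁, H₁⟩ := Metric.continuousAt_iff.1 hcont (α / 4) (by positivity)
  obtain ⟨δ₂, hδ₂, H₂⟩ := Metric.isOpen_iff.1 hU w₀ hw
  set δ := min δ₁ δ₂ with hδ
  have hδ0 : 0 < δ := lt_min hδ₁ hδ₂
  have hsub : ball w₀ δ ⊆ U := (ball_subset_ball (min_le_right _ _)).trans H₂
  have hbd : ∀ z ∈ ball w₀ δ, ‖fderiv ℝ φ z - fderiv ℝ φ w₀‖ ≤ α / 4 := fun z hz => by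
    rw [← dist_eq_norm']
    rw [dist_comm]
    exact (H₁ (lt_of_lt_of_le (mem_ball.1 hz) (min_le_left _ _))).le
  have star : ∀ z ∈ ball w₀ δ, ∀ z' ∈ ball w₀ δ,
      |φ z - φ z' - α * (z.2 - z'.2)| ≤ α / 4 * ‖z - z'‖ := by
    intro z hz z' hz'
    have := (convex_ball w₀ δ).norm_image_sub_le_of_norm_fderiv_le' (𝕜 := ℝ) (f := φ)
      (φ := fderiv ℝ φ w₀) (C := α / 4)
      (fun x hx => (hφ.contDiffAt (hU.mem_nhds (hsub hx))).differentiableAt (by simp)) hbd hz' hz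
    rw [hd] at this
    simpa using this
  have hball : ∀ z : SpaceTime d, z ∈ ball w₀ δ ↔ z.1 ∈ ball w₀.1 δ ∧ |z.2 - w₀.2| < δ := by
    intro z
    simp only [mem_ball, Prod.dist_eq, max_lt_iff, Real.dist_eq]
  have mono : ∀ y r r', (y, r) ∈ ball w₀ δ → (y, r') ∈ ball w₀ δ → r' < r →
      φ (y, r') + 3 * α / 4 * (r - r') ≤ φ (y, r) := by
    intro y r r' h h' hlt
    have := star _ h _ h'
    simp only [Prod.mk_sub_mk, sub_self, Prod.norm_mk, norm_zero] at this
    rw [max_eq_right (norm_nonneg _), Real.norm_eq_abs, abs_of_pos (sub_pos.2 hlt)] at this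
    have := (abs_le.1 this).1
    linarith
  have hex : ∀ y ∈ ball w₀.1 δ, ∃ r, |r - w₀.2| ≤ δ / 2 ∧ φ (y, r) = 0 := by
    intro y hy
    have hin : ∀ r, |r - w₀.2| ≤ δ / 2 → (y, r) ∈ ball w₀ δ := fun r hr =>
      (hball _).2 ⟨hy, by simp only; linarith⟩
    have hc : (y, w₀.2) ∈ ball w₀ δ := hin _ (by simp; positivity)
    have h1 : |φ (y, w₀.2)| ≤ α / 4 * δ := by
      have := star _ hc w₀ (mem_ball_self hδ0)
      rw [h0] at this
      simp only [sub_zero, sub_self, mul_zero] at this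
      refine this.trans ?_
      have : ‖(y, w₀.2) - w₀‖ ≤ δ := by rw [← dist_eq_norm]; exact (mem_ball.1 hc).le
      gcongr
    have hu := mono y (w₀.2 + δ / 2) w₀.2 (hin _ (by simp [abs_of_pos (half_pos hδ0)])) hc (by linarith)
    have hl := mono y w₀.2 (w₀.2 - δ / 2) hc (hin _ (by simp [abs_of_pos (half_pos hδ0)])) (by linarith)
    have hp : 0 ≤ φ (y, w₀.2 + δ / 2) := by nlinarith [abs_le.1 h1, mul_pos hα hδ0]
    have hm : φ (y, w₀.2 - δ / 2) ≤ 0 := by nlinarith [abs_le.1 h1, mul_pos hα hδ0]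
    have hcts : ContinuousOn (fun r => φ (y, r)) (Icc (w₀.2 - δ / 2) (w₀.2 + δ / 2)) := by
      refine hφ.continuousOn.comp (by fun_prop) fun r hr => hsub (hin r ?_)
      rw [abs_le]
      constructor <;> linarith [hr.1, hr.2]
    obtain ⟨r, hr, hr0⟩ := intermediate_value_Icc (by linarith) hcts ⟨hm, hp⟩
    refine ⟨r, ?_, hr0⟩
    rw [abs_le]
    constructor <;> linarith [hr.1, hr.2]
  choose! g₀ hg₀ hg₀0 using hex
  have hin : ∀ y ∈ ball w₀.1 δ, (y, g₀ y) ∈ ball w₀ δ := fun y hy =>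
    (hball _).2 ⟨hy, by have := hg₀ y hy; simp only; linarith⟩
  have hlip : LipschitzOnWith 1 g₀ (ball w₀.1 δ) := by
    refine LipschitzOnWith.of_dist_le_mul fun y hy y' hy' => ?_
    have := star _ (hin y hy) _ (hin y' hy')
    rw [hg₀0 y hy, hg₀0 y' hy'] at this
    simp only [sub_self, zero_sub, abs_neg, abs_mul, abs_of_pos hα, Prod.mk_sub_mk,
      Prod.norm_mk] at this
    rw [NNReal.coe_one, one_mul, Real.dist_eq, dist_eq_norm]
    by_contra hlt
    rw [not_le] at hlt
    rw [max_eq_right (by rw [Real.norm_eq_abs]; exact hlt.le), Real.norm_eq_abs] at this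
    have : 0 < |g₀ y - g₀ y'| := (norm_nonneg _).trans_lt hlt
    nlinarith
  -- The extension to all of `Space d` makes `graphMap g` globally Lipschitz, so that no
  -- measurability or domain issues arise later.
  obtain ⟨g, hg, hgg⟩ := hlip.extend_real
  refine ⟨δ, hδ0, hsub, g, hg, fun z hz => ?_, fun y hy => ?_, fun z hz => ?_⟩
  · have h1 : |(fderiv ℝ φ z - fderiv ℝ φ w₀) (0, 1)| ≤ α / 4 := by
      refine ((fderiv ℝ φ z - fderiv ℝ φ w₀).le_opNorm _).trans ?_
      simpa [Prod.norm_mk] using hbd z hz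
    rw [sub_apply, hd] at h1
    simp only [mul_one] at h1
    linarith [(abs_le.1 h1).1]
  · rw [← hgg hy]; exact hin y hy
  · obtain ⟨y, r⟩ := z
    have hy := ((hball _).1 hz).1
    have hz' := hin y hy
    simp only at hy
    rw [← hgg hy]
    have e0 := hg₀0 y hy
    rcases lt_trichotomy r (g₀ y) with h | h | h
    · have := mono _ _ _ hz' hz h
      rw [e0] at this
      have : φ (y, r) < 0 := by nlinarith
      simp [this, h, this.ne, h.ne]
    · simp [h, e0]
    · have := mono _ _ _ hz hz' h
      rw [e0] at this
      have : 0 < φ (y, r) := by nlinarith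
      simp [this.ne', h.ne', not_lt.2 this.le, not_lt.2 h.le]

instance : (volume : Measure (SpaceTime d)).IsAddHaarMeasure :=
  inferInstanceAs ((volume : Measure (Space d)).prod (volume : Measure ℝ)).IsAddHaarMeasure

/-- Fubini and the fundamental theorem of calculus on each vertical half line. As `h` is supported
in `N`, the set `D` may be replaced by the whole subgraph of `g`. -/
theorem setIntegral_fderiv_vertical {h : SpaceTime d → ℝ} (hh : ContDiff ℝ 1 h)
    (hc : HasCompactSupport h) {N D : Set (SpaceTime d)} (hD : MeasurableSet D) (hN : tsupport h ⊆ N)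
    {g : Space d → ℝ} (hg : Measurable g) (hDN : ∀ z ∈ N, z ∈ D ↔ z.2 < g z.1) :
    ∫ z in D, fderiv ℝ h z (0, 1) = ∫ y, h (y, g y) := by
  have hI := integrable_fderiv_apply hh hc (0, 1) (μ := volume)
  have hset : MeasurableSet {z : SpaceTime d | z.2 < g z.1} :=
    measurableSet_lt measurable_snd (hg.comp measurable_fst)
  have e1 : ∫ z in D, fderiv ℝ h z (0, 1)
      = ∫ z in {z : SpaceTime d | z.2 < g z.1}, fderiv ℝ h z (0, 1) := by
    rw [← integral_indicator hD, ← integral_indicator hset]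
    congr 1
    ext z
    by_cases hz : z ∈ tsupport h
    · by_cases hz' : z ∈ D
      · rw [indicator_of_mem hz', indicator_of_mem (s := {z : SpaceTime d | z.2 < g z.1}) ((hDN z (hN hz)).1 hz')]
      · rw [indicator_of_notMem hz', indicator_of_notMem]
        exact fun h' => hz' ((hDN z (hN hz)).2 h')
    · simp [indicator, fderiv_eq_zero_of_notMem_tsupport hz]
  rw [e1, ← integral_indicator hset, Measure.volume_eq_prod, integral_prod]
  · refine integral_congr_ae (ae_of_all _ fun y => ?_)
    simp only
    have hinj : Topology.IsClosedEmbedding (fun r : ℝ => ((y, r) : SpaceTime d)) :=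
      Topology.IsClosedEmbedding.of_continuous_injective_isClosedMap (by fun_prop)
        (fun a b hab => by simpa using hab)
        (isClosedMap_prodMk_left y)
    have hcd : ContDiff ℝ 1 (fun r : ℝ => h (y, r)) := hh.comp (by fun_prop)
    have hcs : HasCompactSupport (fun r : ℝ => h (y, r)) := hc.comp_isClosedEmbedding hinj
    have e2 : (fun r => indicator {z : SpaceTime d | z.2 < g z.1} (fun z => fderiv ℝ h z (0, 1)) (y, r))
        = indicator (Iio (g y)) (deriv fun r : ℝ => h (y, r)) := by
      ext r
      have : deriv (fun r : ℝ => h (y, r)) r = fderiv ℝ h (y, r) (0, 1) := by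
        have h1 : HasDerivAt (fun r : ℝ => ((y, r) : SpaceTime d)) (0, 1) r :=
          (hasDerivAt_const r y).prodMk (hasDerivAt_id r)
        exact ((hh.differentiable (by simp) (y, r)).hasFDerivAt.comp_hasDerivAt r h1).deriv
      simp only [indicator, mem_ofPred_eq, mem_Iio, this]
    rw [e2, integral_indicator measurableSet_Iio, ← integral_Iic_eq_integral_Iio]
    exact hcs.integral_Iic_deriv_eq hcd (g y)
  · rw [← Measure.volume_eq_prod]
    exact (integrable_indicator_iff hset).2 hI.integrableOn

/-- The graph parametrization. -/
def graphMap (g : Space d → ℝ) (y : Space d) : SpaceTime d := (y, g y)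

theorem measurable_graphMap {g : Space d → ℝ} (hg : Measurable g) : Measurable (graphMap g) :=
  measurable_id.prodMk hg

theorem surfaceMeasure_apply (A : Set (SpaceTime d)) :
    surfaceMeasure d A = (Measure.euclideanHausdorffMeasure d : Measure (WithLp 2 (SpaceTime d)))
      (WithLp.ofLp ⁻¹' A) :=
  (MeasurableEquiv.toLp 2 (SpaceTime d)).symm.map_apply A

theorem euclideanHausdorffMeasure_image_le {X Y : Type*} [EMetricSpace X] [MeasurableSpace X]
    [BorelSpace X] [EMetricSpace Y] [MeasurableSpace Y] [BorelSpace Y] {K : NNReal} {f : X → Y}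
    {s : Set X} (hf : LipschitzOnWith K f s) (n : ℕ) :
    (Measure.euclideanHausdorffMeasure n : Measure Y) (f '' s)
      ≤ (K : ℝ≥0∞) ^ n * (Measure.euclideanHausdorffMeasure n : Measure X) s := by
  have := hf.hausdorffMeasure_image_le (d := n) (by positivity)
  simp only [Measure.euclideanHausdorffMeasure_def, Measure.smul_apply, ENNReal.smul_def, smul_eq_mul]
  rw [ENNReal.rpow_natCast] at this
  calc _ ≤ _ := mul_le_mul_right this _
    _ = _ := by ring

/-- For the Euclidean distance the graph map of a 1-Lipschitz function is `√2`-Lipschitz; the cruder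
constant `2` gives the factor `2 ^ d`. This crude comparison replaces the area formula. -/
theorem surfaceMeasure_restrict_graph_le {g : Space d → ℝ} (hg : LipschitzWith 1 g) :
    (surfaceMeasure d).restrict (range (graphMap g)) ≤ (2 : ℝ≥0∞) ^ d • volume.map (graphMap g) := by
  refine Measure.le_iff.2 fun B hB => ?_
  rw [Measure.restrict_apply hB, surfaceMeasure_apply, Measure.smul_apply,
    Measure.map_apply (measurable_graphMap hg.continuous.measurable) hB]
  have hlip : LipschitzWith 2 (fun y => WithLp.toLp 2 (graphMap g y)) := by
    refine LipschitzWith.of_dist_le_mul fun y y' => ?_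
    rw [WithLp.prod_dist_eq_of_L2]
    have := hg.dist_le_mul y y'
    simp only [NNReal.coe_one, one_mul] at this
    simp only [graphMap, NNReal.coe_ofNat]
    refine Real.sqrt_le_iff.2 ⟨by positivity, ?_⟩
    change dist y y' ^ 2 + dist (g y) (g y') ^ 2 ≤ _
    nlinarith [dist_nonneg (x := y) (y := y'), dist_nonneg (x := g y) (y := g y')]
  have := euclideanHausdorffMeasure_image_le (hlip.lipschitzOnWith (s := graphMap g ⁻¹' B)) d
  rw [EuclideanSpace.euclideanHausdorffMeasure_eq_volume] at this
  refine (measure_mono ?_).trans (this.trans (by simp))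
  rintro z ⟨hz, y, hy⟩
  refine ⟨y, ?_, ?_⟩
  · simp only [mem_preimage, hy]; exact hz
  · simp only [hy]

/-- The projection of the graph to its base does not increase Euclidean distances. -/
theorem map_graphMap_le_surfaceMeasure {g : Space d → ℝ} (hg : Measurable g) :
    volume.map (graphMap g) ≤ (surfaceMeasure d).restrict (range (graphMap g)) := by
  refine Measure.le_iff.2 fun B hB => ?_
  rw [Measure.restrict_apply hB, surfaceMeasure_apply, Measure.map_apply (measurable_graphMap hg) hB]
  have hlip : LipschitzWith 1 (fun z : WithLp 2 (SpaceTime d) => z.fst) := by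
    refine LipschitzWith.of_dist_le_mul fun y y' => ?_
    rw [WithLp.prod_dist_eq_of_L2, NNReal.coe_one, one_mul]
    exact Real.le_sqrt_of_sq_le (by nlinarith [sq_nonneg (dist y.snd y'.snd)])
  have := euclideanHausdorffMeasure_image_le
    (hlip.lipschitzOnWith (s := WithLp.ofLp ⁻¹' (B ∩ range (graphMap g)))) d
  rw [EuclideanSpace.euclideanHausdorffMeasure_eq_volume] at this
  refine (measure_mono ?_).trans (this.trans (by simp))
  intro y hy
  exact ⟨WithLp.toLp 2 (graphMap g y), ⟨hy, y, rfl⟩, rfl⟩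

end Graph

/-! ### The divergence theorem near a regular boundary point. -/

section LocalGauss

open Filter Topology Metric

variable {d : ℕ}

/-- Euclidean coordinates in which a given functional is a multiple of the last coordinate. -/
theorem exists_adapted_coordinates {l : SpaceTime d →L[ℝ] ℝ} (hl : l ≠ 0) :
    ∃ (R : SpaceTime d ≃L[ℝ] SpaceTime d) (α : ℝ), 0 < α ∧ (∀ x, l (R x) = α * x.2) ∧
      MeasurePreserving R volume volume ∧ MeasurePreserving R (surfaceMeasure d) (surfaceMeasure d) ∧
      ‖(R (0, 1)).1‖ ^ 2 + (R (0, 1)).2 ^ 2 = 1 := by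
  let c := WithLp.prodContinuousLinearEquiv 2 ℝ (Space d) ℝ
  let l' : WithLp 2 (SpaceTime d) →L[ℝ] ℝ := l.comp (c : WithLp 2 (SpaceTime d) →L[ℝ] SpaceTime d)
  let n := (InnerProductSpace.toDual ℝ (WithLp 2 (SpaceTime d))).symm l'
  have hn : ∀ x, inner ℝ n x = l' x := fun x => InnerProductSpace.toDual_symm_apply
  have hn0 : n ≠ 0 := by
    intro h
    apply hl
    ext x
    · have := hn (c.symm (x, 0))
      rw [h, inner_zero_left] at this
      simpa [l'] using this.symm
    · have := hn (c.symm (0, 1))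
      rw [h, inner_zero_left] at this
      simpa [l'] using this.symm
  let v := (‖n‖⁻¹ : ℝ) • n
  have hnpos : 0 < ‖n‖ := norm_pos_iff.2 hn0
  have hv : ‖v‖ = 1 := by
    simp [v, norm_smul, hnpos.ne']
  let e : WithLp 2 (SpaceTime d) := c.symm (0, 1)
  have he : ‖e‖ = 1 := by
    rw [WithLp.prod_norm_eq_of_L2]; simp [e, c]
  -- The reflection exchanging the two unit vectors `e` and `v` is an isometry for the Euclidean
  -- norm, so it preserves Lebesgue and Hausdorff measure. The product norm is the maximum norm,
  -- which is why the argument runs in `WithLp 2`.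
  let r := (ℝ ∙ (e - v))ᗮ.reflection
  have hr : r e = v := Submodule.reflection_sub (by rw [he, hv])
  have hS : surfaceMeasure d
      = (Measure.euclideanHausdorffMeasure d : Measure (WithLp 2 (SpaceTime d))).map c := rfl
  have hcS : MeasurePreserving c (Measure.euclideanHausdorffMeasure d) (surfaceMeasure d) :=
    ⟨c.continuous.measurable, rfl⟩
  have hcS' : MeasurePreserving c.symm (surfaceMeasure d) (Measure.euclideanHausdorffMeasure d) := by
    refine ⟨c.symm.continuous.measurable, ?_⟩
    rw [hS, Measure.map_map c.symm.continuous.measurable c.continuous.measurable]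
    simp
  have hcV : MeasurePreserving c volume volume := WithLp.volume_preserving_ofLp (Space d) ℝ
  have hcV' : MeasurePreserving c.symm volume volume := WithLp.volume_preserving_toLp (Space d) ℝ
  refine ⟨c.symm.trans (r.toContinuousLinearEquiv.trans c), ‖n‖, hnpos, fun x => ?_, ?_, ?_, ?_⟩
  · change l' (r (c.symm x)) = _
    have e1 : n = ‖n‖ • r e := by rw [hr, smul_smul, mul_inv_cancel₀ hnpos.ne', one_smul]
    rw [← hn, e1, inner_smul_left, LinearIsometryEquiv.inner_map_map]
    rw [← e1]
    simp [e, c]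
  · exact hcV.comp (r.measurePreserving.comp hcV')
  · exact hcS.comp ((r.toIsometryEquiv.measurePreserving_euclideanHausdorffMeasure d).comp hcS')
  · change ‖(c (r e)).1‖ ^ 2 + (c (r e)).2 ^ 2 = 1
    rw [hr]
    have := WithLp.prod_norm_sq_eq_of_L2 v
    rw [hv] at this
    simp only [Real.norm_eq_abs, sq_abs] at this
    rw [one_pow] at this
    exact this.symm

/-- The divergence theorem near a regular point of the zero level, with a surface measure which is
comparable to the Hausdorff measure. -/
theorem exists_local_gauss {φ : SpaceTime d → ℝ} {U D : Set (SpaceTime d)} (hU : IsOpen U)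
    (hφ : ContDiffOn ℝ ∞ φ U) (hD : MeasurableSet D) (hDU : ∀ z ∈ U, z ∈ D ↔ φ z < 0)
    {z₀ : SpaceTime d} (hz₀ : z₀ ∈ U) (h0 : φ z₀ = 0) (hd : fderiv ℝ φ z₀ ≠ 0) :
    ∃ N ⊆ U, IsOpen N ∧ z₀ ∈ N ∧ ∃ v : SpaceTime d, ‖v.1‖ ^ 2 + v.2 ^ 2 = 1 ∧
      (∀ z ∈ N, 0 < fderiv ℝ φ z v) ∧ MeasurableSet ({z | φ z = 0} ∩ N) ∧
      ∃ m : Measure (SpaceTime d), IsFiniteMeasure m ∧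
        (surfaceMeasure d).restrict ({z | φ z = 0} ∩ N) ≤ (2 : ℝ≥0∞) ^ d • m ∧
        m ≤ (surfaceMeasure d).restrict ({z | φ z = 0} ∩ N) ∧
        ∀ f : SpaceTime d → ℝ, ContDiff ℝ 1 f → HasCompactSupport f → tsupport f ⊆ N → ∀ w,
          ∫ z in D, fderiv ℝ f z w = ∫ z, f z * fderiv ℝ φ z w / fderiv ℝ φ z v ∂m := by
  obtain ⟨R, α, hα, hR, hRv, hRs, hRn⟩ := exists_adapted_coordinates hd
  have hfd : ∀ x, R x ∈ U → fderiv ℝ (φ ∘ R) x = (fderiv ℝ φ (R x)).comp (R : SpaceTime d →L[ℝ] SpaceTime d) := by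
    intro x hx
    exact (((hφ.contDiffAt (hU.mem_nhds hx)).differentiableAt (by simp)).hasFDerivAt.comp x
      R.hasFDerivAt).fderiv
  have hR0 : R (R.symm z₀) = z₀ := R.apply_symm_apply z₀
  obtain ⟨δ, hδ, hball, g, hg, hpos, hgb, hgr⟩ := exists_lipschitz_graph (φ := φ ∘ R) (U := R ⁻¹' U)
    (hU.preimage R.continuous) (hφ.comp R.contDiff.contDiffOn (fun x hx => hx)) (w₀ := R.symm z₀)
    (by simpa using hz₀) (by simpa using h0) hα (fun x => by
      rw [hfd _ (by simpa using hz₀), hR0]; exact hR x)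
  have hgm : Measurable g := hg.continuous.measurable
  set w₀ := R.symm z₀ with hw₀
  set B := ball w₀ δ with hB
  set N := R.symm ⁻¹' B with hN
  have hNo : IsOpen N := isOpen_ball.preimage R.symm.continuous
  have hNU : N ⊆ U := fun z hz => by simpa using hball hz
  have hgraph : MeasurableSet (range (graphMap g)) := by
    have : range (graphMap g) = {z : SpaceTime d | z.2 = g z.1} := by
      ext z
      constructor
      · rintro ⟨y, rfl⟩; rfl
      · intro h; exact ⟨z.1, Prod.ext rfl h.symm⟩
    rw [this]
    exact measurableSet_eq_fun measurable_snd (hgm.comp measurable_fst)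
  have hΓ : {z | φ z = 0} ∩ N = R.symm ⁻¹' (range (graphMap g) ∩ B) := by
    ext z
    simp only [hN, mem_inter_iff, mem_preimage, and_congr_left_iff, mem_ofPred_eq, mem_range]
    intro hz
    have := (hgr _ hz).2
    simp only [Function.comp_apply, R.apply_symm_apply] at this
    rw [this]
    constructor
    · intro h; exact ⟨(R.symm z).1, Prod.ext rfl h.symm⟩
    · rintro ⟨y, hy⟩; rw [← hy]; rfl
  have hΓm : MeasurableSet ({z | φ z = 0} ∩ N) := by
    rw [hΓ]
    exact R.symm.continuous.measurable (hgraph.inter measurableSet_ball)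
  have hGm : Measurable (graphMap g) := measurable_graphMap hgm
  have hpre : ∀ A : Set (SpaceTime d), R ⁻¹' (A ∩ ({z | φ z = 0} ∩ N)) = R ⁻¹' A ∩ B ∩ range (graphMap g) := by
    intro A
    rw [hΓ]
    ext x
    simp only [mem_preimage, mem_inter_iff, R.symm_apply_apply]
    tauto
  -- Lebesgue measure on a ball of the tangent plane, lifted to the graph and carried back by `R`.
  -- Restricting to the ball keeps `m` finite and supports it on the zero level inside `N`.
  set m : Measure (SpaceTime d) := ((volume.restrict (ball w₀.1 δ)).map (graphMap g)).map R with hm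
  have hmA : ∀ A, MeasurableSet A → m A = volume (graphMap g ⁻¹' (R ⁻¹' A ∩ B)) := by
    intro A hA
    have hA' := R.continuous.measurable hA
    rw [hm, Measure.map_apply R.continuous.measurable hA, Measure.map_apply hGm hA',
      Measure.restrict_apply (hGm hA')]
    congr 1
    ext y
    simp only [mem_inter_iff, mem_preimage, and_congr_right_iff]
    intro _
    refine ⟨fun h => hgb y h, fun h => ?_⟩
    simp only [hB, mem_ball, graphMap, Prod.dist_eq, max_lt_iff] at h
    exact h.1
  refine ⟨N, hNU, hNo, by simp [hN, hB, hw₀, hδ], R (0, 1), hRn, fun z hz => ?_, hΓm, m, ?_, ?_, ?_, ?_⟩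
  · have := hpos _ hz
    rw [hfd _ (by simpa using hNU hz), R.apply_symm_apply] at this
    exact this
  · refine ⟨?_⟩
    rw [hmA _ MeasurableSet.univ]
    refine (measure_mono (t := ball w₀.1 δ) ?_).trans_lt measure_ball_lt_top
    intro y hy
    simp only [hB, mem_ball, graphMap, Prod.dist_eq, max_lt_iff, mem_preimage, mem_inter_iff] at hy
    exact hy.2.1
  · refine Measure.le_iff.2 fun A hA => ?_
    have hA' : MeasurableSet (R ⁻¹' A ∩ B) := (R.continuous.measurable hA).inter measurableSet_ball
    rw [Measure.restrict_apply hA, ← hRs.measure_preimage (hA.inter hΓm).nullMeasurableSet, hpre,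
      ← Measure.restrict_apply hA', Measure.smul_apply, hmA A hA, ← Measure.map_apply hGm hA',
      ← Measure.smul_apply]
    exact surfaceMeasure_restrict_graph_le hg _
  · refine Measure.le_iff.2 fun A hA => ?_
    have hA' : MeasurableSet (R ⁻¹' A ∩ B) := (R.continuous.measurable hA).inter measurableSet_ball
    rw [Measure.restrict_apply hA, ← hRs.measure_preimage (hA.inter hΓm).nullMeasurableSet, hpre,
      ← Measure.restrict_apply hA', hmA A hA, ← Measure.map_apply hGm hA']
    exact map_graphMap_le_surfaceMeasure hgm _
  · intro f hf hfc hfN w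
    have hv : ∀ z ∈ N, fderiv ℝ φ z (R (0, 1)) ≠ 0 := fun z hz => by
      have := hpos _ hz
      rw [hfd _ (by simpa using hNU hz), R.apply_symm_apply] at this
      exact this.ne'
    -- The derivative along `w` is traded for one along `v = R (0, 1)`, the vertical direction of
    -- the new coordinates, which can be integrated along lines. The tangential factor is the
    -- integrand of the boundary integral.
    rw [setIntegral_fderiv_eq_setIntegral_fderiv_tangentialFactor hNo hD
      (fun z hz => hDU z (hNU hz)) (hφ.mono hNU) hf hfc hfN hv w]
    set h := tangentialFactor φ f (R (0, 1)) w with hh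
    have hhC : ContDiff ℝ 1 h := tangentialFactor_contDiff hNo (hφ.mono hNU) hf hfN hv w
    have hht : tsupport h ⊆ tsupport f := tsupport_tangentialFactor_subset φ f (R (0, 1)) w
    have hhc : HasCompactSupport h := hfc.of_isClosed_subset (isClosed_tsupport _) hht
    have hRe : MeasurableEmbedding R := R.toHomeomorph.measurableEmbedding
    rw [← hRv.setIntegral_preimage_emb hRe]
    have e1 : ∀ x, fderiv ℝ h (R x) (R (0, 1)) = fderiv ℝ (h ∘ R) x (0, 1) := by
      intro x
      rw [((hhC.differentiable (by simp) (R x)).hasFDerivAt.comp x R.hasFDerivAt).fderiv]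
      rfl
    simp only [e1]
    have hts : tsupport (h ∘ R) ⊆ B := by
      have : tsupport (h ∘ R) = R ⁻¹' tsupport h :=
        (R.toHomeomorph.preimage_closure (Function.support h)).symm
      rw [this]
      intro x hx
      have := hfN (hht hx)
      simpa [hN] using this
    rw [setIntegral_fderiv_vertical (h := h ∘ R) (N := B) (g := g) (hhC.comp R.contDiff)
      (hhc.comp_homeomorph R.toHomeomorph) (R.continuous.measurable hD) hts hgm (fun x hx => by
        rw [mem_preimage, hDU _ (hball hx)]; exact (hgr x hx).1)]
    change _ = ∫ z, h z ∂m
    rw [hm, integral_map R.continuous.measurable.aemeasurable hhC.continuous.aestronglyMeasurable]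
    change _ = ∫ x, (h ∘ R) x ∂_
    rw [integral_map hGm.aemeasurable (hhC.continuous.comp R.continuous).aestronglyMeasurable,
      setIntegral_eq_integral_of_forall_compl_eq_zero]
    · rfl
    · intro y hy
      have : (y, g y) ∉ tsupport (h ∘ R) := fun h' => hy (by
        have := hts h'
        simp only [hB, mem_ball, Prod.dist_eq, max_lt_iff] at this
        exact this.1)
      exact image_eq_zero_of_notMem_tsupport this

end LocalGauss

/-! ### Finite partitions of unity. -/

section PartitionOfUnity

open Filter Topology Metric
open scoped Manifold

variable {G : Type*} [NormedAddCommGroup G] [NormedSpace ℝ G] [FiniteDimensional ℝ G]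

/-- A finite smooth partition of unity on a compact set, subordinate to given neighbourhoods. -/
theorem exists_finite_partition {K : Set G} (hK : IsCompact K) {N : G → Set G}
    (hN : ∀ z ∈ K, IsOpen (N z) ∧ z ∈ N z) :
    ∃ (s : Finset G) (ζ : G → G → ℝ), (∀ z ∈ s, z ∈ K ∧ ContDiff ℝ ∞ (ζ z) ∧
      tsupport (ζ z) ⊆ N z ∧ ∀ x, 0 ≤ ζ z x ∧ ζ z x ≤ 1) ∧ ∀ x ∈ K, ∑ z ∈ s, ζ z x = 1 := by
  obtain ⟨s, hs, hKs⟩ := hK.elim_nhds_subcover N (fun z hz => (hN z hz).1.mem_nhds (hN z hz).2)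
  obtain ⟨f, hf⟩ := SmoothPartitionOfUnity.exists_isSubordinate 𝓘(ℝ, G) (s := K) hK.isClosed
    (fun z : s => N z) (fun z => (hN z (hs z z.2)).1) (fun x hx => by
      obtain ⟨z, hz, hx⟩ := mem_iUnion₂.1 (hKs hx)
      exact mem_iUnion.2 ⟨⟨z, hz⟩, hx⟩)
  classical
  refine ⟨s, fun z => if h : z ∈ s then f ⟨z, h⟩ else 0, fun z hz => ?_, fun x hx => ?_⟩
  · simp only [hz, dif_pos]
    exact ⟨hs z hz, contMDiff_iff_contDiff.1 (f ⟨z, hz⟩).contMDiff, hf ⟨z, hz⟩,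
      fun x => ⟨f.nonneg _ x, f.le_one _ x⟩⟩
  · have := f.sum_eq_one hx
    rw [finsum_eq_sum_of_fintype] at this
    rw [← this, ← Finset.sum_attach]
    exact Finset.sum_congr rfl fun z _ => by simp

end PartitionOfUnity

/-! ### Calculus in the open time slab. -/

section SlabCalculus

open Filter Topology Metric

variable {d : ℕ} {t₀ T : ℝ} {φ : SpaceTime d → ℝ} {xc : Space d} {tc : ℝ}

/-- The open time slab. -/
def openSlab (d : ℕ) (t₀ T : ℝ) : Set (SpaceTime d) := univ ×ˢ Ioo t₀ T

theorem isOpen_openSlab : IsOpen (openSlab d t₀ T) := isOpen_univ.prod isOpen_Ioo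

theorem spatialGradient_apply {z : SpaceTime d} (h : DifferentiableAt ℝ φ z) (i : Fin d) :
    spatialGradient φ z i = spatialPartial i φ z := by
  have h1 : HasFDerivAt (fun x : Space d => φ (x, z.2))
      ((fderiv ℝ φ z).comp (ContinuousLinearMap.inl ℝ (Space d) ℝ)) z.1 :=
    h.hasFDerivAt.comp z.1 (hasFDerivAt_prodMk_left z.1 z.2)
  have h2 : inner ℝ (spatialGradient φ z) (EuclideanSpace.single i 1) = spatialGradient φ z i := by
    rw [EuclideanSpace.inner_single_right]; simp
  rw [← h2, spatialGradient, gradient, InnerProductSpace.toDual_symm_apply, h1.fderiv]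
  rfl

theorem fderiv_prod_apply {z : SpaceTime d} (h : DifferentiableAt ℝ φ z) (w : SpaceTime d) :
    fderiv ℝ φ z w = inner ℝ (spatialGradient φ z) w.1 + w.2 * fderiv ℝ φ z (0, 1) := by
  have h1 : HasFDerivAt (fun x : Space d => φ (x, z.2))
      ((fderiv ℝ φ z).comp (ContinuousLinearMap.inl ℝ (Space d) ℝ)) z.1 :=
    h.hasFDerivAt.comp z.1 (hasFDerivAt_prodMk_left z.1 z.2)
  rw [spatialGradient, gradient, InnerProductSpace.toDual_symm_apply, h1.fderiv, ← smul_eq_mul,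
    ← map_smul]
  change _ = fderiv ℝ φ z (w.1, 0) + _
  rw [← map_add]
  congr 1
  ext <;> simp

/-- The Euclidean norm of the space-time gradient. -/
def fullGradientNorm (φ : SpaceTime d → ℝ) (z : SpaceTime d) : ℝ :=
  √(‖spatialGradient φ z‖ ^ 2 + fderiv ℝ φ z (0, 1) ^ 2)

theorem fderiv_le_fullGradientNorm {z : SpaceTime d} (h : DifferentiableAt ℝ φ z) {v : SpaceTime d}
    (hv : ‖v.1‖ ^ 2 + v.2 ^ 2 = 1) : fderiv ℝ φ z v ≤ fullGradientNorm φ z := by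
  refine Real.le_sqrt_of_sq_le ?_
  rw [fderiv_prod_apply h]
  have h1 := abs_real_inner_le_norm (spatialGradient φ z) v.1
  set a := inner ℝ (spatialGradient φ z) v.1
  set b := ‖spatialGradient φ z‖
  set c := fderiv ℝ φ z (0, 1)
  have h2 : a ^ 2 ≤ b ^ 2 * ‖v.1‖ ^ 2 := by
    rw [← mul_pow, ← sq_abs a]
    gcongr
  by_cases hv1 : ‖v.1‖ = 0
  · have ha : a = 0 := by rw [hv1] at h2; nlinarith
    rw [hv1] at hv
    rw [ha]; nlinarith [sq_nonneg b]
  · have hpos : 0 < ‖v.1‖ ^ 2 := by positivity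
    -- After multiplication by `‖v.1‖²`, and with `a² ≤ b² ‖v.1‖²`, the difference of the two sides
    -- is at least the square of `v.2 a - ‖v.1‖² c`.
    have key : ‖v.1‖ ^ 2 * (a + v.2 * c) ^ 2 ≤ ‖v.1‖ ^ 2 * (b ^ 2 + c ^ 2) := by
      have e : v.2 ^ 2 = 1 - ‖v.1‖ ^ 2 := by linarith
      have e2 : ‖v.1‖ ^ 2 * (a + v.2 * c) ^ 2 =
          ‖v.1‖ ^ 2 * a ^ 2 + 2 * (v.2 * a) * (‖v.1‖ ^ 2 * c) + ‖v.1‖ ^ 2 * v.2 ^ 2 * c ^ 2 := by ring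
      rw [e2, e]
      nlinarith [sq_nonneg (v.2 * a - ‖v.1‖ ^ 2 * c)]
    exact le_of_mul_le_mul_left key hpos

theorem fderiv_ne_zero_of_spatialGradient_ne_zero {z : SpaceTime d} (h : DifferentiableAt ℝ φ z)
    (hz : spatialGradient φ z ≠ 0) : fderiv ℝ φ z ≠ 0 := by
  intro h0
  apply hz
  ext i
  rw [spatialGradient_apply h, spatialPartial, h0]
  simp

theorem measurable_indicator_of_continuousOn {X : Type*} [TopologicalSpace X] [MeasurableSpace X]
    [BorelSpace X] {f : X → ℝ} {U : Set X} (hU : IsOpen U) (hf : ContinuousOn f U) :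
    Measurable (U.indicator f) := by
  classical
  rw [← piecewise_eq_indicator]
  exact hf.measurable_piecewise continuousOn_const hU.measurableSet

namespace IsAdmissible

variable (hφ : IsAdmissible t₀ T φ xc tc)
include hφ

theorem contDiffOn_openSlab : ContDiffOn ℝ ∞ φ (openSlab d t₀ T) :=
  hφ.smooth.mono (prod_mono subset_rfl Ioo_subset_Icc_self)

theorem contDiffAt {z : SpaceTime d} (hz : z ∈ openSlab d t₀ T) : ContDiffAt ℝ ∞ φ z :=
  hφ.contDiffOn_openSlab.contDiffAt (isOpen_openSlab.mem_nhds hz)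

theorem differentiableAt {z : SpaceTime d} (hz : z ∈ openSlab d t₀ T) : DifferentiableAt ℝ φ z :=
  (hφ.contDiffAt hz).differentiableAt (by simp)

theorem isOpen_domain : IsOpen (domain t₀ T φ) := by
  have := hφ.contDiffOn_openSlab.continuousOn.isOpen_inter_preimage isOpen_openSlab
    (isOpen_Iio (a := (0 : ℝ)))
  have e : domain t₀ T φ = openSlab d t₀ T ∩ φ ⁻¹' Iio 0 := by
    ext z
    simp [domain, openSlab]
  rwa [e]

theorem measurableSet_lateralBoundary : MeasurableSet (lateralBoundary t₀ T φ) := by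
  have h1 := hφ.contDiffOn_openSlab.continuousOn.isOpen_inter_preimage isOpen_openSlab
    (isOpen_compl_singleton (x := (0 : ℝ)))
  have : lateralBoundary t₀ T φ = openSlab d t₀ T \ (openSlab d t₀ T ∩ φ ⁻¹' {0}ᶜ) := by
    ext z
    simp [lateralBoundary, openSlab]
  rw [this]
  exact isOpen_openSlab.measurableSet.diff h1.measurableSet

theorem continuousAt_spatialPartial {z : SpaceTime d} (hz : z ∈ openSlab d t₀ T) (i : Fin d) :
    ContinuousAt (spatialPartial i φ) z :=
  (((hφ.contDiffAt hz).fderiv_right (m := 0) (by norm_cast)).continuousAt).clm_apply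
    continuousAt_const

theorem continuousAt_timePartial {z : SpaceTime d} (hz : z ∈ openSlab d t₀ T) :
    ContinuousAt (fun z => fderiv ℝ φ z (0, 1)) z :=
  (((hφ.contDiffAt hz).fderiv_right (m := 0) (by norm_cast)).continuousAt).clm_apply
    continuousAt_const

theorem continuousAt_spatialGradient {z : SpaceTime d} (hz : z ∈ openSlab d t₀ T) :
    ContinuousAt (spatialGradient φ) z := by
  have h : ContinuousAt (fun z => WithLp.toLp 2 fun i => spatialPartial i φ z) z :=
    (PiLp.continuous_toLp 2 _).continuousAt.comp
      (continuousAt_pi.2 fun i => hφ.continuousAt_spatialPartial hz i)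
  refine h.congr ?_
  filter_upwards [isOpen_openSlab.mem_nhds hz] with w hw
  ext i
  exact (spatialGradient_apply (hφ.differentiableAt hw) i).symm

theorem continuousAt_fullGradientNorm {z : SpaceTime d} (hz : z ∈ openSlab d t₀ T) :
    ContinuousAt (fullGradientNorm φ) z :=
  Real.continuous_sqrt.continuousAt.comp
    (((hφ.continuousAt_spatialGradient hz).norm.pow 2).add ((hφ.continuousAt_timePartial hz).pow 2))

theorem timeDerivative_eq {z : SpaceTime d} (hz : z ∈ openSlab d t₀ T) :
    timeDerivative t₀ T φ z = fderiv ℝ φ z (0, 1) := by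
  have h1 : HasDerivAt (fun s : ℝ => ((z.1, s) : SpaceTime d)) (0, 1) z.2 :=
    (hasDerivAt_const z.2 z.1).prodMk (hasDerivAt_id z.2)
  have h2 := (hφ.differentiableAt hz).hasFDerivAt.comp_hasDerivAt z.2 h1
  rw [timeDerivative, derivWithin_of_mem_nhds (Icc_mem_nhds hz.2.1 hz.2.2)]
  exact h2.deriv

theorem spatialGradient_ne_zero {z : SpaceTime d} (hz : z ∈ lateralBoundary t₀ T φ)
    (hzc : z ≠ (xc, tc)) : spatialGradient φ z ≠ 0 :=
  hφ.isolated z.2 (Ioo_subset_Icc_self hz.1) z.1 hz.2 hzc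

end IsAdmissible

end SlabCalculus

/-! ### The local divergence theorem at an arbitrary noncritical point of the slab. -/

section GlobalGauss

open Filter Topology Metric

variable {d : ℕ} {t₀ T : ℝ} {φ : SpaceTime d → ℝ} {xc : Space d} {tc : ℝ}

/-- Off the zero level the formula holds with `m = 0`. A neighbourhood is chosen inside or outside
the domain, so it contains no boundary, and the integral of a derivative of a compactly supported
function vanishes or is taken over a set that misses its support. There `v` is an arbitrary unit
vector, which is why its positivity is only claimed on the zero level. In this form every compact
set avoiding the critical point can be covered. -/
theorem IsAdmissible.exists_local_gauss (hφ : IsAdmissible t₀ T φ xc tc) {z₀ : SpaceTime d}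
    (hz₀ : z₀ ∈ openSlab d t₀ T) (hzc : z₀ ≠ (xc, tc)) :
    ∃ N ⊆ openSlab d t₀ T, IsOpen N ∧ z₀ ∈ N ∧ ∃ v : SpaceTime d, ‖v.1‖ ^ 2 + v.2 ^ 2 = 1 ∧
      (φ z₀ = 0 → 0 < fderiv ℝ φ z₀ v) ∧ (∀ z ∈ N, φ z = 0 → 0 < fderiv ℝ φ z v) ∧
      ∃ m : Measure (SpaceTime d), IsFiniteMeasure m ∧
        (surfaceMeasure d).restrict (lateralBoundary t₀ T φ ∩ N) ≤ (2 : ℝ≥0∞) ^ d • m ∧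
        m ≤ (surfaceMeasure d).restrict (lateralBoundary t₀ T φ ∩ N) ∧
        ∀ f : SpaceTime d → ℝ, ContDiff ℝ 1 f → HasCompactSupport f → tsupport f ⊆ N → ∀ w,
          Integrable (fun z => f z * fderiv ℝ φ z w / fderiv ℝ φ z v) m ∧
          ∫ z in domain t₀ T φ, fderiv ℝ f z w = ∫ z, f z * fderiv ℝ φ z w / fderiv ℝ φ z v ∂m := by
  have hsl : ∀ N ⊆ openSlab d t₀ T, lateralBoundary t₀ T φ ∩ N = {z | φ z = 0} ∩ N := by
    intro N hN
    ext z
    simp only [lateralBoundary, mem_inter_iff, mem_ofPred_eq, and_congr_left_iff, and_iff_right_iff_imp]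
    intro hz _
    exact (hN hz).2
  rcases lt_trichotomy (φ z₀) 0 with h | h | h
  · refine ⟨domain t₀ T φ, fun z hz => ⟨trivial, hz.1⟩, hφ.isOpen_domain, ⟨hz₀.2, h⟩, (0, 1), by simp,
      fun h' => absurd h' h.ne, fun z hz h' => absurd h' hz.2.ne, 0, inferInstance, ?_, Measure.zero_le _, ?_⟩
    · rw [(by ext z; simp only [lateralBoundary, domain, mem_inter_iff, mem_ofPred_eq,
        mem_empty_iff_false, iff_false]; rintro ⟨⟨_, h1⟩, _, h2⟩; exact h2.ne h1 :
        lateralBoundary t₀ T φ ∩ domain t₀ T φ = ∅)]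
      simp
    · intro f hf hc ht w
      refine ⟨integrable_zero_measure, ?_⟩
      rw [integral_zero_measure, setIntegral_eq_integral_of_forall_compl_eq_zero,
        integral_fderiv_apply_eq_zero hf hc]
      intro z hz
      rw [fderiv_eq_zero_of_notMem_tsupport (fun h' => hz (ht h'))]; simp
  · have hne : fderiv ℝ φ z₀ ≠ 0 := fderiv_ne_zero_of_spatialGradient_ne_zero
      (hφ.differentiableAt hz₀) (hφ.spatialGradient_ne_zero ⟨hz₀.2, h⟩ hzc)
    obtain ⟨N, hN, hNo, hzN, v, hv, hpos, -, m, hm, h1, h2, h3⟩ :=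
      EvolvingDomain.exists_local_gauss isOpen_openSlab hφ.contDiffOn_openSlab
        hφ.isOpen_domain.measurableSet (fun z hz => ⟨fun h => h.2, fun h => ⟨hz.2, h⟩⟩) hz₀ h hne
    refine ⟨N, hN, hNo, hzN, v, hv, fun _ => hpos _ hzN, fun z hz _ => hpos z hz, m, hm, ?_, ?_, ?_⟩
    · rw [hsl N hN]; exact h1
    · rw [hsl N hN]; exact h2
    · intro f hf hc ht w
      refine ⟨?_, h3 f hf hc ht w⟩
      have := tangentialFactor_contDiff hNo (hφ.contDiffOn_openSlab.mono hN) hf ht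
        (fun z hz => (hpos z hz).ne') w
      exact this.continuous.integrable_of_hasCompactSupport
        (hc.of_isClosed_subset (isClosed_tsupport _) (tsupport_tangentialFactor_subset φ f v w))
  · have ho := hφ.contDiffOn_openSlab.continuousOn.isOpen_inter_preimage isOpen_openSlab
      (isOpen_Ioi (a := (0 : ℝ)))
    refine ⟨_, inter_subset_left, ho, ⟨hz₀, h⟩, (0, 1), by simp, fun h' => absurd h' h.ne',
      fun z hz h' => absurd h' (ne_of_gt hz.2), 0, inferInstance, ?_, Measure.zero_le _, ?_⟩
    · rw [(by ext z; simp only [lateralBoundary, mem_inter_iff, mem_ofPred_eq, mem_preimage, mem_Ioi,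
        mem_empty_iff_false, iff_false]; rintro ⟨⟨_, h1⟩, _, h2⟩; exact h2.ne' h1 :
        lateralBoundary t₀ T φ ∩ (openSlab d t₀ T ∩ φ ⁻¹' Ioi 0) = ∅)]
      simp
    · intro f hf hc ht w
      refine ⟨integrable_zero_measure, ?_⟩
      rw [integral_zero_measure]
      refine setIntegral_eq_zero_of_forall_eq_zero fun z hz => ?_
      rw [fderiv_eq_zero_of_notMem_tsupport (fun h' => ?_)]
      · simp
      · exact lt_asymm hz.2 (ht h').2

end GlobalGauss

/-! ### Flux inequalities on the spatial boundary and comparison with the weighted measure. -/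

section GlobalGauss

open Filter Topology Metric

variable {d : ℕ} {t₀ T : ℝ} {φ : SpaceTime d → ℝ} {xc : Space d} {tc : ℝ}

/-- The normal flux density `∑ Xᵢ ∂ᵢφ / |Dφ|` of a spatial vector field. -/
def fluxDensity (φ : SpaceTime d → ℝ) (X : Fin d → SpaceTime d → ℝ) (z : SpaceTime d) : ℝ :=
  (∑ i, X i z * spatialPartial i φ z) / fullGradientNorm φ z

theorem IsAdmissible.measurable_fluxDensity (hφ : IsAdmissible t₀ T φ xc tc)
    {X : Fin d → SpaceTime d → ℝ} (hX : ∀ i, ContDiff ℝ 1 (X i))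
    (hXs : ∀ i, tsupport (X i) ⊆ openSlab d t₀ T) : Measurable (fluxDensity φ X) := by
  have h1 : ∀ i, Measurable ((openSlab d t₀ T).indicator (spatialPartial i φ)) := fun i =>
    measurable_indicator_of_continuousOn isOpen_openSlab fun z hz =>
      (hφ.continuousAt_spatialPartial hz i).continuousWithinAt
  have h2 : Measurable ((openSlab d t₀ T).indicator (fullGradientNorm φ)) :=
    measurable_indicator_of_continuousOn isOpen_openSlab fun z hz =>
      (hφ.continuousAt_fullGradientNorm hz).continuousWithinAt
  have : fluxDensity φ X = fun z => (∑ i, X i z * (openSlab d t₀ T).indicator (spatialPartial i φ) z)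
      / (openSlab d t₀ T).indicator (fullGradientNorm φ) z := by
    ext z
    by_cases hz : z ∈ openSlab d t₀ T
    · simp [fluxDensity, hz]
    · have : ∀ i, X i z = 0 := fun i => image_eq_zero_of_notMem_tsupport (fun h => hz (hXs i h))
      simp [fluxDensity, this]
  rw [this]
  exact (Finset.measurable_sum _ fun i _ => (hX i).continuous.measurable.mul (h1 i)).div h2

theorem spatialPartial_mul {f g : SpaceTime d → ℝ} {z : SpaceTime d} (hf : DifferentiableAt ℝ f z)
    (hg : DifferentiableAt ℝ g z) (i : Fin d) :
    spatialPartial i (fun z => f z * g z) z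
      = f z * spatialPartial i g z + spatialPartial i f z * g z := by
  rw [spatialPartial, fderiv_fun_mul hf hg]
  simp [spatialPartial]
  ring

/-- Since `v` is a unit vector, `∂_v φ ≤ |Dφ|`. Hence the flux density is at most the integrand of
the local formula, and `2 ^ d` accounts for the measure. The nonnegativity of the divergence
integral is recorded so that local bounds can be added inside `ENNReal.ofReal`. -/
theorem IsAdmissible.local_lintegral_flux_le (hφ : IsAdmissible t₀ T φ xc tc) {z₀ : SpaceTime d}
    (hz₀ : z₀ ∈ openSlab d t₀ T) (hzc : z₀ ≠ (xc, tc)) :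
    ∃ N ⊆ openSlab d t₀ T, IsOpen N ∧ z₀ ∈ N ∧ ∀ X : Fin d → SpaceTime d → ℝ,
      (∀ i, ContDiff ℝ 1 (X i)) → (∀ i, HasCompactSupport (X i)) → (∀ i, tsupport (X i) ⊆ N) →
      (∀ z ∈ lateralBoundary t₀ T φ, 0 ≤ ∑ i, X i z * spatialPartial i φ z) →
      0 ≤ ∫ z in domain t₀ T φ, ∑ i, spatialPartial i (X i) z ∧
      ∫⁻ z in lateralBoundary t₀ T φ, ENNReal.ofReal (fluxDensity φ X z) ∂(surfaceMeasure d)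
        ≤ 2 ^ d * ENNReal.ofReal (∫ z in domain t₀ T φ, ∑ i, spatialPartial i (X i) z) := by
  obtain ⟨N, hN, hNo, hzN, v, hv, -, hpos, m, hm, h1, h2, h3⟩ := hφ.exists_local_gauss hz₀ hzc
  refine ⟨N, hN, hNo, hzN, fun X hX hXc hXs hXn => ?_⟩
  have hΓ := hφ.measurableSet_lateralBoundary
  have hmem : ∀ᵐ z ∂m, z ∈ lateralBoundary t₀ T φ ∩ N :=
    (Measure.absolutelyContinuous_of_le h2) (ae_restrict_mem (hΓ.inter hNo.measurableSet))
  have e1 : ∫ z in domain t₀ T φ, ∑ i, spatialPartial i (X i) z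
      = ∫ z, (∑ i, X i z * spatialPartial i φ z) / fderiv ℝ φ z v ∂m := by
    simp only [spatialPartial]
    rw [integral_finsetSum _ fun i _ => (integrable_fderiv_apply (hX i) (hXc i) _).integrableOn]
    simp only [Finset.sum_div]
    rw [integral_finsetSum _ fun i _ => (h3 (X i) (hX i) (hXc i) (hXs i) _).1]
    exact Finset.sum_congr rfl fun i _ => (h3 (X i) (hX i) (hXc i) (hXs i) _).2
  have hint : Integrable (fun z => (∑ i, X i z * spatialPartial i φ z) / fderiv ℝ φ z v) m := by
    simp only [Finset.sum_div]
    exact integrable_finsetSum _ fun i _ => (h3 (X i) (hX i) (hXc i) (hXs i) _).1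
  have hnn : 0 ≤ᵐ[m] fun z => (∑ i, X i z * spatialPartial i φ z) / fderiv ℝ φ z v := by
    filter_upwards [hmem] with z hz
    exact div_nonneg (hXn z hz.1) (hpos z hz.2 hz.1.2).le
  refine ⟨by rw [e1]; exact integral_nonneg_of_ae hnn, ?_⟩
  rw [e1, ofReal_integral_eq_lintegral_ofReal hint hnn]
  have hzero : ∀ z ∉ N, fluxDensity φ X z = 0 := by
    intro z hz
    have : ∀ i, X i z = 0 := fun i => image_eq_zero_of_notMem_tsupport (fun h => hz (hXs i h))
    simp [fluxDensity, this]
  calc ∫⁻ z in lateralBoundary t₀ T φ, ENNReal.ofReal (fluxDensity φ X z) ∂(surfaceMeasure d)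
      = ∫⁻ z in lateralBoundary t₀ T φ ∩ N, ENNReal.ofReal (fluxDensity φ X z) ∂(surfaceMeasure d) := by
        rw [← lintegral_indicator hΓ, ← lintegral_indicator (hΓ.inter hNo.measurableSet)]
        refine lintegral_congr fun z => ?_
        by_cases hz : z ∈ N
        · by_cases hz' : z ∈ lateralBoundary t₀ T φ <;> simp [indicator, hz, hz']
        · simp [indicator, hz, hzero z hz]
    _ ≤ ∫⁻ z, ENNReal.ofReal (fluxDensity φ X z) ∂((2 : ℝ≥0∞) ^ d • m) := lintegral_mono' h1 le_rfl
    _ = 2 ^ d * ∫⁻ z, ENNReal.ofReal (fluxDensity φ X z) ∂m := by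
        rw [lintegral_smul_measure]; rfl
    _ ≤ _ := by
        refine mul_le_mul_right (lintegral_mono_ae ?_) _
        filter_upwards [hmem] with z hz
        refine ENNReal.ofReal_le_ofReal ?_
        exact div_le_div_of_nonneg_left (hXn z hz.1) (hpos z hz.2 hz.1.2)
          (fderiv_le_fullGradientNorm (hφ.differentiableAt (hN hz.2)) hv)

/-- The flux through the spatial boundary, away from the critical point, is controlled by the
integral of the divergence. -/
theorem IsAdmissible.lintegral_flux_le (hφ : IsAdmissible t₀ T φ xc tc)
    {X : Fin d → SpaceTime d → ℝ} (hX : ∀ i, ContDiff ℝ 1 (X i)) (hXc : ∀ i, HasCompactSupport (X i))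
    (hXs : ∀ i, tsupport (X i) ⊆ openSlab d t₀ T) (hXt : ∀ i, (xc, tc) ∉ tsupport (X i))
    (hXn : ∀ z ∈ lateralBoundary t₀ T φ, 0 ≤ ∑ i, X i z * spatialPartial i φ z) :
    ∫⁻ z in lateralBoundary t₀ T φ, ENNReal.ofReal (fluxDensity φ X z) ∂(surfaceMeasure d)
        ≤ 2 ^ d * ENNReal.ofReal (∫ z in domain t₀ T φ, ∑ i, spatialPartial i (X i) z) := by
  set K : Set (SpaceTime d) := ⋃ i, tsupport (X i) with hKdef
  have hK : IsCompact K := isCompact_iUnion fun i => hXc i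
  have hKi : ∀ i, tsupport (X i) ⊆ K := fun i => subset_iUnion (fun i => tsupport (X i)) i
  have hKO : ∀ z ∈ K, z ∈ openSlab d t₀ T ∧ z ≠ (xc, tc) := fun z hz => by
    obtain ⟨i, hi⟩ := mem_iUnion.1 hz
    exact ⟨hXs i hi, fun h => hXt i (h ▸ hi)⟩
  have hloc := fun z (hz : z ∈ K) => hφ.local_lintegral_flux_le (hKO z hz).1 (hKO z hz).2
  choose! N hN hNo hzN H using hloc
  obtain ⟨s, ζ, hζ, hsum⟩ := exists_finite_partition hK fun z hz => ⟨hNo z hz, hzN z hz⟩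
  let Y : SpaceTime d → Fin d → SpaceTime d → ℝ := fun p i z => ζ p z * X i z
  have hζ1 : ∀ p ∈ s, ContDiff ℝ 1 (ζ p) := fun p hp => (hζ p hp).2.1.of_le (by simp)
  have hY : ∀ p ∈ s, ∀ i, ContDiff ℝ 1 (Y p i) := fun p hp i => (hζ1 p hp).mul (hX i)
  have hYs : ∀ p i, tsupport (Y p i) ⊆ tsupport (X i) := fun p i => tsupport_mul_subset_right
  have hYc : ∀ p i, HasCompactSupport (Y p i) := fun p i => (hXc i).mul_left
  have hXsum : ∀ i z, X i z = ∑ p ∈ s, Y p i z := by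
    intro i z
    simp only [Y]
    rw [← Finset.sum_mul]
    by_cases hz : z ∈ tsupport (X i)
    · rw [hsum z (hKi i hz), one_mul]
    · rw [image_eq_zero_of_notMem_tsupport hz, mul_zero]
  have hflux : ∀ p z, ∑ i, Y p i z * spatialPartial i φ z
      = ζ p z * ∑ i, X i z * spatialPartial i φ z := by
    intro p z
    simp only [Y, Finset.mul_sum]
    exact Finset.sum_congr rfl fun i _ => by ring
  have hloc' := fun p (hp : p ∈ s) => H p (hζ p hp).1 (Y p) (hY p hp) (hYc p)
    (fun i => tsupport_mul_subset_left.trans (hζ p hp).2.2.1)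
    (fun z hz => by rw [hflux]; exact mul_nonneg ((hζ p hp).2.2.2 z).1 (hXn z hz))
  -- The gradients of the partition functions need no estimate: the pieces sum to `X`, and so do
  -- their divergences.
  have hdiv : ∫ z in domain t₀ T φ, ∑ i, spatialPartial i (X i) z
      = ∑ p ∈ s, ∫ z in domain t₀ T φ, ∑ i, spatialPartial i (Y p i) z := by
    have hint : ∀ p ∈ s, IntegrableOn (fun z => ∑ i, spatialPartial i (Y p i) z)
        (domain t₀ T φ) := fun p hp => integrable_finsetSum _ fun i _ =>
      (integrable_fderiv_apply (hY p hp i) (hYc p i) _).integrableOn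
    rw [← integral_finsetSum _ hint]
    refine integral_congr_ae (ae_of_all _ fun z => ?_)
    simp only
    rw [Finset.sum_comm]
    refine Finset.sum_congr rfl fun i _ => ?_
    have : X i = fun z => ∑ p ∈ s, Y p i z := funext (hXsum i)
    rw [this, spatialPartial,
      fderiv_fun_sum fun p hp => (hY p hp i).differentiable (by simp) z]
    simp [spatialPartial]
  have hpt : ∀ z ∈ lateralBoundary t₀ T φ, ENNReal.ofReal (fluxDensity φ X z)
      = ∑ p ∈ s, ENNReal.ofReal (fluxDensity φ (Y p) z) := by
    intro z hz
    rw [← ENNReal.ofReal_sum_of_nonneg]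
    · congr 1
      simp only [fluxDensity]
      rw [← Finset.sum_div]
      congr 1
      rw [Finset.sum_comm]
      refine Finset.sum_congr rfl fun i _ => ?_
      rw [← Finset.sum_mul, ← hXsum]
    · intro p hp
      refine div_nonneg ?_ (Real.sqrt_nonneg _)
      rw [hflux]
      exact mul_nonneg ((hζ p hp).2.2.2 z).1 (hXn z hz)
  rw [setLIntegral_congr_fun hφ.measurableSet_lateralBoundary hpt,
    lintegral_finsetSum' _ fun p hp => ((hφ.measurable_fluxDensity (hY p hp)
      (fun i => (hYs p i).trans (hXs i))).ennreal_ofReal).aemeasurable,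
    hdiv, ENNReal.ofReal_sum_of_nonneg fun p hp => (hloc' p hp).1, Finset.mul_sum]
  exact Finset.sum_le_sum fun p hp => (hloc' p hp).2

/-! ### The weight -/

open Classical in
theorem IsAdmissible.continuousAt_weight (hφ : IsAdmissible t₀ T φ xc tc) {z : SpaceTime d}
    (hz : z ∈ lateralBoundary t₀ T φ) (hzc : z ≠ (xc, tc)) :
    ContinuousAt (weight t₀ T φ xc tc) z := by
  have hz' : z ∈ openSlab d t₀ T := ⟨trivial, hz.1⟩
  have h1 : ContinuousAt (normalVelocity t₀ T φ) z := by
    have : ContinuousAt (fun z => - fderiv ℝ φ z (0, 1) / ‖spatialGradient φ z‖) z :=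
      (hφ.continuousAt_timePartial hz').neg.div (hφ.continuousAt_spatialGradient hz').norm
        (norm_ne_zero_iff.2 (hφ.spatialGradient_ne_zero hz hzc))
    refine this.congr ?_
    filter_upwards [isOpen_openSlab.mem_nhds hz'] with w hw
    rw [normalVelocity, hφ.timeDerivative_eq hw]
  have h2 : ContinuousAt (fun z : SpaceTime d =>
      if (spatialHessian φ (xc, tc)).PosDef then √|z.2 - tc| else 1) z := by
    split_ifs
    · exact (by fun_prop : Continuous fun z : SpaceTime d => √|z.2 - tc|).continuousAt
    · exact continuousAt_const
  exact h2.div (Real.continuous_sqrt.continuousAt.comp (continuousAt_const.add (h1.pow 2)))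
    (Real.sqrt_ne_zero'.2 (add_pos_of_pos_of_nonneg one_pos (sq_nonneg _)))

theorem weight_pos {z : SpaceTime d} (hz : z.2 ≠ tc) : 0 < weight t₀ T φ xc tc z := by
  refine div_pos ?_ (Real.sqrt_pos.2 (by positivity))
  split_ifs
  · exact Real.sqrt_pos.2 (abs_pos.2 (sub_ne_zero.2 hz))
  · exact one_pos

theorem weight_nonneg (z : SpaceTime d) : 0 ≤ weight t₀ T φ xc tc z := by
  refine div_nonneg ?_ (Real.sqrt_nonneg _)
  split_ifs
  · exact Real.sqrt_nonneg _
  · exact zero_le_one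

open Classical in
/-- Up to the power of `|t - tc|`, the weight is `|∇φ| / |Dφ|`. -/
theorem IsAdmissible.weight_eq (hφ : IsAdmissible t₀ T φ xc tc) {z : SpaceTime d}
    (hz : z ∈ lateralBoundary t₀ T φ) (hzc : z ≠ (xc, tc)) :
    weight t₀ T φ xc tc z = (if (spatialHessian φ (xc, tc)).PosDef then √|z.2 - tc| else 1)
        * ‖spatialGradient φ z‖ / fullGradientNorm φ z := by
  have hz' : z ∈ openSlab d t₀ T := ⟨trivial, hz.1⟩
  have hne : 0 < ‖spatialGradient φ z‖ := norm_pos_iff.2 (hφ.spatialGradient_ne_zero hz hzc)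
  rw [weight, normalVelocity, hφ.timeDerivative_eq hz', fullGradientNorm]
  set a := ‖spatialGradient φ z‖
  have e : a ^ 2 + fderiv ℝ φ z (0, 1) ^ 2 = a ^ 2 * (1 + (-fderiv ℝ φ z (0, 1) / a) ^ 2) := by
    field_simp
  rw [e, Real.sqrt_mul (by positivity), Real.sqrt_sq hne.le, mul_comm a,
    mul_div_mul_right _ _ hne.ne']

theorem IsAdmissible.aemeasurable_weight (hφ : IsAdmissible t₀ T φ xc tc) :
    AEMeasurable (weight t₀ T φ xc tc) ((surfaceMeasure d).restrict (lateralBoundary t₀ T φ)) := by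
  have hΓ := hφ.measurableSet_lateralBoundary
  have hc : MeasurableSet ({(xc, tc)} : Set (SpaceTime d)) := measurableSet_singleton _
  suffices key : AEMeasurable (weight t₀ T φ xc tc) ((surfaceMeasure d).restrict
      ((lateralBoundary t₀ T φ \ {(xc, tc)}) ∪ {(xc, tc)})) by
    exact key.mono_measure (Measure.restrict_mono
      (by rw [sdiff_union_self]; exact subset_union_left) le_rfl)
  refine aemeasurable_union_iff.2 ⟨?_, ?_⟩
  · exact ContinuousOn.aemeasurable
      (fun z hz => (hφ.continuousAt_weight hz.1 hz.2).continuousWithinAt) (hΓ.diff hc)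
  · refine (aemeasurable_const (b := weight t₀ T φ xc tc (xc, tc))).congr ?_
    filter_upwards [ae_restrict_mem hc] with z hz
    rw [mem_singleton_iff.1 hz]

theorem IsAdmissible.lintegral_weightedSurfaceMeasure (hφ : IsAdmissible t₀ T φ xc tc)
    {f : SpaceTime d → ℝ≥0∞} (hf : Measurable f) :
    ∫⁻ z, f z ∂(weightedSurfaceMeasure t₀ T φ xc tc) = ∫⁻ z in lateralBoundary t₀ T φ,
      ENNReal.ofReal (weight t₀ T φ xc tc z) * f z ∂(surfaceMeasure d) :=
  lintegral_withDensity_eq_lintegral_mul₀ hφ.aemeasurable_weight.ennreal_ofReal hf.aemeasurable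

/-- Away from the critical time the weight is locally bounded below on the boundary, and `∂_i φ` is
locally bounded by a multiple of `∂_v φ`. The unweighted boundary integral from the local divergence
theorem is then controlled by the weighted one. -/
theorem IsAdmissible.local_integral_partial_le (hφ : IsAdmissible t₀ T φ xc tc) {z₀ : SpaceTime d}
    (hz₀ : z₀ ∈ openSlab d t₀ T) (hzt : z₀.2 ≠ tc) (i : Fin d) :
    ∃ N, IsOpen N ∧ z₀ ∈ N ∧ ∃ C : NNReal, ∀ f : SpaceTime d → ℝ, ContDiff ℝ 1 f →
      HasCompactSupport f → tsupport f ⊆ N →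
      ‖∫ z in domain t₀ T φ, spatialPartial i f z‖ₑ
        ≤ C * ∫⁻ z, ‖f z‖ₑ ∂(weightedSurfaceMeasure t₀ T φ xc tc) := by
  have hzc : z₀ ≠ (xc, tc) := fun h => hzt (by rw [h])
  obtain ⟨N₀, hN, hNo, hzN, v, hv, hv0, hpos, m, hm, h1, h2, h3⟩ := hφ.exists_local_gauss hz₀ hzc
  have hΓ := hφ.measurableSet_lateralBoundary
  obtain ⟨c, hc, hbd⟩ : ∃ c : ℝ, 0 < c ∧ ∀ᶠ z in 𝓝 z₀, z ∈ lateralBoundary t₀ T φ →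
      c < weight t₀ T φ xc tc z ∧ |spatialPartial i φ z| ≤ c⁻¹ * fderiv ℝ φ z v := by
    by_cases h0 : φ z₀ = 0
    · have hzΓ : z₀ ∈ lateralBoundary t₀ T φ := ⟨hz₀.2, h0⟩
      have hw := weight_pos (t₀ := t₀) (T := T) (φ := φ) (xc := xc) hzt
      have hvp := hv0 h0
      have hcv : ContinuousAt (fun z => fderiv ℝ φ z v) z₀ :=
        (((hφ.contDiffAt hz₀).fderiv_right (m := 0) (by norm_cast)).continuousAt).clm_apply
          continuousAt_const
      set a := |spatialPartial i φ z₀| with ha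
      set b := fderiv ℝ φ z₀ v with hb
      -- Half the weight survives in a neighbourhood. The second entry gives `|∂_i φ| c ≤ (a + 1) c
      -- ≤ b / 2 < ∂_v φ` there.
      set c := min (weight t₀ T φ xc tc z₀ / 2) (b / (2 * (a + 1))) with hcdef
      have hc0 : 0 < c := lt_min (by positivity) (by positivity)
      refine ⟨c, hc0, ?_⟩
      have e1 := (hφ.continuousAt_weight hzΓ hzc).eventually_const_lt (u := c)
        ((min_le_left _ _).trans_lt (by linarith))
      have e2 : ∀ᶠ z in 𝓝 z₀, |spatialPartial i φ z| < a + 1 :=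
        (hφ.continuousAt_spatialPartial hz₀ i).abs.eventually_lt_const (by simp [ha])
      have e3 : ∀ᶠ z in 𝓝 z₀, b / 2 < fderiv ℝ φ z v := hcv.eventually_const_lt (by linarith)
      filter_upwards [e1, e2, e3] with z k1 k2 k3 _
      refine ⟨k1, ?_⟩
      rw [← div_eq_inv_mul, le_div_iff₀ hc0]
      have hcb : c ≤ b / (2 * (a + 1)) := min_le_right _ _
      calc |spatialPartial i φ z| * c ≤ (a + 1) * (b / (2 * (a + 1))) := by
            gcongr
        _ = b / 2 := by
          have : a + 1 ≠ 0 := by positivity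
          field_simp
        _ ≤ _ := k3.le
    · refine ⟨1, one_pos, ?_⟩
      have : ∀ᶠ z in 𝓝 z₀, φ z ≠ 0 := (hφ.contDiffAt hz₀).continuousAt.eventually_ne h0
      filter_upwards [this] with z hz hz'
      exact absurd hz'.2 hz
  obtain ⟨N₁, hN₁, hN₁o, hzN₁⟩ := _root_.mem_nhds_iff.1 hbd
  refine ⟨N₀ ∩ N₁, hNo.inter hN₁o, ⟨hzN, hzN₁⟩, Real.toNNReal (c⁻¹ * c⁻¹), fun f hf hfc hfN => ?_⟩
  have hfN₀ := hfN.trans inter_subset_left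
  have hmem : ∀ᵐ z ∂m, z ∈ lateralBoundary t₀ T φ ∩ N₀ :=
    (Measure.absolutelyContinuous_of_le h2) (ae_restrict_mem (hΓ.inter hNo.measurableSet))
  obtain ⟨i1, i2⟩ := h3 f hf hfc hfN₀ (EuclideanSpace.single i 1, 0)
  have hfm : Measurable fun z => ‖f z‖ₑ := hf.continuous.measurable.enorm
  have hci : 0 < c⁻¹ := inv_pos.2 hc
  have hN₁w : ∀ z ∈ lateralBoundary t₀ T φ, ‖f z‖ₑ ≤ ENNReal.ofReal c⁻¹ *
      (ENNReal.ofReal (weight t₀ T φ xc tc z) * ‖f z‖ₑ) := by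
    intro z hz
    by_cases hzt : z ∈ tsupport f
    · have := (hN₁ (hfN hzt).2 hz).1
      rw [← mul_assoc, ← ENNReal.ofReal_mul hci.le]
      refine le_mul_of_one_le_left zero_le ?_
      rw [ENNReal.one_le_ofReal, ← div_eq_inv_mul, one_le_div hc]
      exact this.le
    · simp [image_eq_zero_of_notMem_tsupport hzt]
  calc ‖∫ z in domain t₀ T φ, spatialPartial i f z‖ₑ
      = ‖∫ z, f z * spatialPartial i φ z / fderiv ℝ φ z v ∂m‖ₑ := by
        simp only [spatialPartial] at i2 ⊢; rw [i2]
    _ ≤ ∫⁻ z, ‖f z * spatialPartial i φ z / fderiv ℝ φ z v‖ₑ ∂m := enorm_integral_le_lintegral_enorm _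
    _ ≤ ∫⁻ z, ENNReal.ofReal c⁻¹ * ‖f z‖ₑ ∂m := by
        refine lintegral_mono_ae ?_
        filter_upwards [hmem] with z hz
        by_cases hzt : z ∈ tsupport f
        · have k1 := (hN₁ (hfN hzt).2 hz.1).2
          have k2 := hpos z hz.2 hz.1.2
          rw [mul_div_assoc, enorm_mul, mul_comm]
          gcongr
          rw [Real.enorm_eq_ofReal_abs, abs_div, abs_of_pos k2]
          exact ENNReal.ofReal_le_ofReal ((div_le_iff₀ k2).2 k1)
        · simp [image_eq_zero_of_notMem_tsupport hzt]
    _ = ENNReal.ofReal c⁻¹ * ∫⁻ z, ‖f z‖ₑ ∂m := lintegral_const_mul _ hfm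
    _ ≤ ENNReal.ofReal c⁻¹ * ∫⁻ z in lateralBoundary t₀ T φ, ‖f z‖ₑ ∂(surfaceMeasure d) := by
        gcongr
        exact h2.trans (Measure.restrict_mono inter_subset_left le_rfl)
    _ ≤ ENNReal.ofReal c⁻¹ * ∫⁻ z in lateralBoundary t₀ T φ, ENNReal.ofReal c⁻¹ *
          (ENNReal.ofReal (weight t₀ T φ xc tc z) * ‖f z‖ₑ) ∂(surfaceMeasure d) := by
        refine mul_le_mul_right (setLIntegral_mono_ae' hΓ (ae_of_all _ hN₁w)) _
    _ = _ := by
        rw [lintegral_const_mul' _ _ ENNReal.ofReal_ne_top,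
          ← hφ.lintegral_weightedSurfaceMeasure hfm, ← mul_assoc, ← ENNReal.ofReal_mul hci.le]
        rfl

/-- Integrals of derivatives over the domain are controlled by the weighted boundary integral. -/
theorem IsAdmissible.exists_integral_partial_mul_le (hφ : IsAdmissible t₀ T φ xc tc)
    {ψ : SpaceTime d → ℝ} (hψ : ContDiff ℝ ∞ ψ) (hψc : HasCompactSupport ψ)
    (hψs : tsupport ψ ⊆ openSlab d t₀ T) (hψt : ∀ z ∈ tsupport ψ, z.2 ≠ tc) (i : Fin d) :
    ∃ C : NNReal, ∀ v : SpaceTime d → ℝ, ContDiff ℝ 1 v →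
      ‖∫ z in domain t₀ T φ, spatialPartial i (fun z => v z * ψ z) z‖ₑ
        ≤ C * ∫⁻ z, ‖v z * ψ z‖ₑ ∂(weightedSurfaceMeasure t₀ T φ xc tc) := by
  have hloc := fun z (hz : z ∈ tsupport ψ) => hφ.local_integral_partial_le (hψs hz) (hψt z hz) i
  choose! N hNo hzN C H using hloc
  obtain ⟨s, ζ, hζ, hsum⟩ := exists_finite_partition hψc fun z hz => ⟨hNo z hz, hzN z hz⟩
  refine ⟨∑ p ∈ s, C p, fun v hv => ?_⟩
  set f : SpaceTime d → ℝ := fun z => v z * ψ z with hfdef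
  have hf : ContDiff ℝ 1 f := hv.mul (hψ.of_le (by simp))
  have hfc : HasCompactSupport f := hψc.mul_left
  have hfs : tsupport f ⊆ tsupport ψ := tsupport_mul_subset_right
  have hY : ∀ p ∈ s, ContDiff ℝ 1 fun z => ζ p z * f z := fun p hp =>
    ((hζ p hp).2.1.of_le (by simp)).mul hf
  have hYc : ∀ p, HasCompactSupport fun z => ζ p z * f z := fun p => hfc.mul_left
  have hfsum : f = fun z => ∑ p ∈ s, ζ p z * f z := by
    ext z
    rw [← Finset.sum_mul]
    by_cases hz : z ∈ tsupport f
    · rw [hsum z (hfs hz), one_mul]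
    · rw [image_eq_zero_of_notMem_tsupport hz, mul_zero]
  have e1 : ∫ z in domain t₀ T φ, spatialPartial i f z
      = ∑ p ∈ s, ∫ z in domain t₀ T φ, spatialPartial i (fun z => ζ p z * f z) z := by
    have hint : ∀ p ∈ s, IntegrableOn (fun z => spatialPartial i (fun z => ζ p z * f z) z)
        (domain t₀ T φ) := fun p hp =>
      (integrable_fderiv_apply (hY p hp) (hYc p) _).integrableOn
    rw [← integral_finsetSum _ hint]
    refine integral_congr_ae (ae_of_all _ fun z => ?_)
    simp only
    conv_lhs => rw [hfsum]
    rw [spatialPartial, fderiv_fun_sum fun p hp => (hY p hp).differentiable (by simp) z]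
    simp [spatialPartial]
  rw [e1]
  refine (enorm_sum_le _ _).trans ?_
  rw [ENNReal.ofNNReal_finsetSum, Finset.sum_mul]
  refine Finset.sum_le_sum fun p hp => ?_
  refine (H p (hζ p hp).1 _ (hY p hp) (hYc p) (tsupport_mul_subset_left.trans (hζ p hp).2.2.1)).trans ?_
  gcongr with z
  rw [enorm_mul]
  refine mul_le_of_le_one_left zero_le ?_
  rw [Real.enorm_eq_ofReal ((hζ p hp).2.2.2 z).1]
  exact ENNReal.ofReal_le_one.2 ((hζ p hp).2.2.2 z).2

end GlobalGauss

/-! ### Spatial gradient and Hessian up to the end times. -/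

section ClosedSlab

open Filter Topology Metric

variable {d : ℕ} {t₀ T : ℝ} {φ : SpaceTime d → ℝ} {xc : Space d} {tc : ℝ}

/-- The closed time slab. -/
def closedSlab (d : ℕ) (t₀ T : ℝ) : Set (SpaceTime d) := univ ×ˢ Icc t₀ T

theorem uniqueDiffOn_closedSlab (h : t₀ < T) : UniqueDiffOn ℝ (closedSlab d t₀ T) :=
  uniqueDiffOn_univ.prod (uniqueDiffOn_Icc h)

/-- The critical time may be `t₀` or `T`, where `φ` is only differentiable relative to the closed
slab. Spatial slices lie entirely in the slab, so relative derivatives restrict to genuine spatial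
ones. -/
theorem hasFDerivAt_slice {F : Type*} [NormedAddCommGroup F] [NormedSpace ℝ F]
    {f : SpaceTime d → F} {z : SpaceTime d} (hz : z ∈ closedSlab d t₀ T)
    (hf : DifferentiableWithinAt ℝ f (closedSlab d t₀ T) z) :
    HasFDerivAt (fun x => f (x, z.2)) ((fderivWithin ℝ f (closedSlab d t₀ T) z).comp
      (ContinuousLinearMap.inl ℝ (Space d) ℝ)) z.1 := by
  have h0 : HasFDerivWithinAt (fun x : Space d => ((x, z.2) : SpaceTime d))
      (ContinuousLinearMap.inl ℝ (Space d) ℝ) univ z.1 :=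
    (hasFDerivAt_prodMk_left z.1 z.2).hasFDerivWithinAt
  have hm : MapsTo (fun x : Space d => ((x, z.2) : SpaceTime d)) univ (closedSlab d t₀ T) :=
    fun x _ => ⟨trivial, hz.2⟩
  exact hasFDerivWithinAt_univ.1 (HasFDerivWithinAt.comp z.1 hf.hasFDerivWithinAt h0 hm)

theorem inner_spatialGradient (f : SpaceTime d → ℝ) (z : SpaceTime d) (e : Space d) :
    inner ℝ (spatialGradient f z) e = fderiv ℝ (fun x : Space d => f (x, z.2)) z.1 e :=
  InnerProductSpace.toDual_symm_apply

theorem spatialGradient_apply_eq (f : SpaceTime d → ℝ) (z : SpaceTime d) (i : Fin d) :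
    spatialGradient f z i
      = fderiv ℝ (fun x : Space d => f (x, z.2)) z.1 (EuclideanSpace.single i 1) := by
  rw [← inner_spatialGradient, EuclideanSpace.inner_single_right]; simp

namespace IsAdmissible

variable (hφ : IsAdmissible t₀ T φ xc tc)
include hφ

theorem contDiffOn_spatialGradient : ContDiffOn ℝ ∞ (spatialGradient φ) (closedSlab d t₀ T) := by
  rw [contDiffOn_euclidean]
  intro i
  have h1 : ContDiffOn ℝ ∞ (fun z => fderivWithin ℝ φ (closedSlab d t₀ T) z
      (EuclideanSpace.single i 1, 0)) (closedSlab d t₀ T) :=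
    (hφ.smooth.fderivWithin (uniqueDiffOn_closedSlab hφ.time_lt) (by simp)).clm_apply
      contDiffOn_const
  refine h1.congr fun z hz => ?_
  rw [spatialGradient_apply_eq,
    (hasFDerivAt_slice hz (hφ.smooth.differentiableOn (by simp) z hz)).fderiv]
  rfl

theorem critical_mem : (xc, tc) ∈ closedSlab d t₀ T := ⟨trivial, hφ.time_mem⟩

omit hφ in
/-- The Hessian as a linear map. -/
def hessianMap (t₀ T : ℝ) (φ : SpaceTime d → ℝ) (z : SpaceTime d) : Space d →L[ℝ] Space d :=
  (fderivWithin ℝ (spatialGradient φ) (closedSlab d t₀ T) z).comp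
    (ContinuousLinearMap.inl ℝ (Space d) ℝ)

theorem hasFDerivAt_spatialGradient {z : SpaceTime d} (hz : z ∈ closedSlab d t₀ T) :
    HasFDerivAt (fun x => spatialGradient φ (x, z.2)) (hessianMap t₀ T φ z) z.1 :=
  hasFDerivAt_slice hz (hφ.contDiffOn_spatialGradient.differentiableOn (by simp) z hz)

theorem hessianMap_single_apply {z : SpaceTime d} (hz : z ∈ closedSlab d t₀ T) (i j : Fin d) :
    hessianMap t₀ T φ z (EuclideanSpace.single i 1) j = spatialHessian φ z i j := by
  have h := hφ.hasFDerivAt_spatialGradient hz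
  have h2 := ((EuclideanSpace.proj (𝕜 := ℝ) j).hasFDerivAt.comp z.1 h).fderiv
  rw [spatialHessian, Matrix.of_apply]
  have e : (fun y : Space d => fderiv ℝ (fun x : Space d => φ (x, z.2)) y (EuclideanSpace.single j 1))
      = ⇑(EuclideanSpace.proj (𝕜 := ℝ) j) ∘ fun x : Space d => spatialGradient φ (x, z.2) := by
    ext y
    exact (spatialGradient_apply_eq φ (y, z.2) j).symm
  rw [e, h2]
  rfl

theorem spatialHessian_isHermitian {z : SpaceTime d} (hz : z ∈ closedSlab d t₀ T) :
    (spatialHessian φ z).IsHermitian := by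
  have hf : ContDiff ℝ ∞ fun x : Space d => φ (x, z.2) := by
    rw [← contDiffOn_univ]
    exact hφ.smooth.comp (by fun_prop) fun x _ => ⟨trivial, hz.2⟩
  have hs : IsSymmSndFDerivAt ℝ (fun x : Space d => φ (x, z.2)) z.1 :=
    hf.contDiffAt.isSymmSndFDerivAt (by simp; norm_cast)
  have hd : DifferentiableAt ℝ (fderiv ℝ fun x : Space d => φ (x, z.2)) z.1 :=
    (hf.fderiv_right (m := 1) (by norm_cast)).differentiable (by simp) _
  ext i j
  simp only [spatialHessian, Matrix.conjTranspose_apply, Matrix.of_apply, star_trivial]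
  rw [fderiv_clm_apply hd (by fun_prop), fderiv_clm_apply hd (by fun_prop)]
  simpa using hs.eq _ _

theorem hessianMap_eigenvectorBasis {z : SpaceTime d} (hz : z ∈ closedSlab d t₀ T) (k : Fin d) :
    hessianMap t₀ T φ z ((hφ.spatialHessian_isHermitian hz).eigenvectorBasis k)
      = (hφ.spatialHessian_isHermitian hz).eigenvalues k •
        (hφ.spatialHessian_isHermitian hz).eigenvectorBasis k := by
  set hH := hφ.spatialHessian_isHermitian hz
  ext j
  have h1 := congrFun (hH.mulVec_eigenvectorBasis k) j
  rw [Pi.smul_apply] at h1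
  rw [PiLp.smul_apply, ← h1, Matrix.mulVec, dotProduct]
  set b := hH.eigenvectorBasis k
  have hb : b = ∑ i, b i • EuclideanSpace.single i (1 : ℝ) := by
    conv_lhs => rw [← (EuclideanSpace.basisFun (Fin d) ℝ).sum_repr b]
    simp
  conv_lhs => rw [hb]
  rw [map_sum]
  simp only [map_smul]
  rw [WithLp.ofLp_sum, Finset.sum_apply]
  refine Finset.sum_congr rfl fun i _ => ?_
  rw [PiLp.smul_apply, hφ.hessianMap_single_apply hz, smul_eq_mul, mul_comm]
  congr 1
  -- In coordinates `hessianMap` acts by the transposed matrix; symmetry enters here.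
  have := hH.apply i j
  simpa using this.symm

end IsAdmissible

end ClosedSlab

/-! ### Splitting of a nondegenerate symmetric form. -/

section Spectral

variable {d : ℕ}

/-- A splitting of a nondegenerate quadratic form: `P` is the projection to the negative part, `k`
its rank. -/
structure IsNegativeProjection (A P : Space d →L[ℝ] Space d) (k : ℕ) (l L : ℝ) : Prop where
  pos : 0 < l
  idem : ∀ x, P (P x) = P x
  symm : ∀ x y, inner ℝ (P x) y = inner ℝ x (P y)
  le_pos : ∀ x, l * ‖x - P x‖ ^ 2 ≤ inner ℝ (A x) (x - P x)
  pos_le : ∀ x, inner ℝ (A x) (x - P x) ≤ L * ‖x - P x‖ ^ 2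
  le_neg : ∀ x, l * ‖P x‖ ^ 2 ≤ - inner ℝ (A x) (P x)
  neg_le : ∀ x, - inner ℝ (A x) (P x) ≤ L * ‖P x‖ ^ 2
  trace : ∑ i, inner ℝ (EuclideanSpace.single i 1) (P (EuclideanSpace.single i 1)) = (k : ℝ)

/-- `P` is the orthogonal projection onto the span of the eigenvectors with negative eigenvalue, so
its trace is their number. All inequalities are checked coordinatewise in the eigenbasis. The bound
`l` is the least `|e i|` (or `1` if there is none), and `L` is the sum of all `|e i|`, a crude upper
bound. -/
theorem exists_isNegativeProjection (A : Space d →L[ℝ] Space d)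
    (b : OrthonormalBasis (Fin d) ℝ (Space d)) (e : Fin d → ℝ) (he : ∀ i, e i ≠ 0)
    (hA : ∀ i, A (b i) = e i • b i) :
    ∃ (P : Space d →L[ℝ] Space d) (l L : ℝ),
      IsNegativeProjection A P (Finset.univ.filter fun i => e i < 0).card l L ∧
      ((Finset.univ.filter fun i => e i < 0).card = 0 → P = 0) := by
  set S := Finset.univ.filter fun i => e i < 0 with hS
  let P : Space d →L[ℝ] Space d := ∑ i ∈ S, (innerSL ℝ (b i)).smulRight (b i)
  have hP : ∀ x, P x = ∑ i ∈ S, inner ℝ (b i) x • b i := fun x => by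
    simp [P]
  have hPb : ∀ x i, inner ℝ (b i) (P x) = if i ∈ S then inner ℝ (b i) x else 0 := by
    intro x i
    rw [hP, inner_sum]
    simp only [inner_smul_right, b.inner_eq_ite]
    simp
  have hAb : ∀ x i, inner ℝ (b i) (A x) = e i * inner ℝ (b i) x := by
    intro x i
    conv_lhs => rw [← b.sum_repr' x]
    rw [map_sum, inner_sum]
    simp only [map_smul, hA, inner_smul_right, b.inner_eq_ite]
    simp
    ring
  have hnorm : ∀ y : Space d, ‖y‖ ^ 2 = ∑ i, inner ℝ (b i) y ^ 2 := fun y => by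
    rw [← b.sum_sq_norm_inner_right y]; simp
  have hinner : ∀ y z : Space d, inner ℝ y z = ∑ i, inner ℝ (b i) y * inner ℝ (b i) z := fun y z => by
    rw [← b.sum_inner_mul_inner y z]
    exact Finset.sum_congr rfl fun i _ => by rw [real_inner_comm]
  obtain ⟨l, hl, hle⟩ : ∃ l : ℝ, 0 < l ∧ ∀ i, l ≤ |e i| := by
    rcases isEmpty_or_nonempty (Fin d) with h | h
    · exact ⟨1, one_pos, fun i => h.elim i⟩
    · obtain ⟨i, hi⟩ := Finite.exists_min fun i => |e i|
      exact ⟨|e i|, abs_pos.2 (he i), hi⟩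
  set L := ∑ i, |e i| with hL
  have hLe : ∀ i, |e i| ≤ L := fun i =>
    Finset.single_le_sum (f := fun i => |e i|) (fun i _ => abs_nonneg _) (Finset.mem_univ i)
  have hpos : ∀ i, i ∉ S → |e i| = e i := fun i hi => abs_of_nonneg (by simpa [hS] using hi)
  have hneg : ∀ i, i ∈ S → |e i| = - e i := fun i hi => abs_of_neg (by simpa [hS] using hi)
  refine ⟨P, l, L, ⟨hl, ?_, ?_, ?_, ?_, ?_, ?_, ?_⟩, ?_⟩
  · intro x
    exact (hP (P x)).trans ((Finset.sum_congr rfl fun i hi => by rw [hPb, if_pos hi]).trans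
      (hP x).symm)
  · intro x y
    rw [hinner, hinner]
    refine Finset.sum_congr rfl fun i _ => ?_
    rw [hPb, hPb]
    split_ifs <;> simp
  · intro x
    rw [hinner, hnorm, Finset.mul_sum]
    refine Finset.sum_le_sum fun i _ => ?_
    rw [inner_sub_right, hPb, hAb]
    split_ifs with h
    · simp
    · nlinarith [hpos i h, hle i, sq_nonneg (inner ℝ (b i) x)]
  · intro x
    rw [hinner, hnorm, Finset.mul_sum]
    refine Finset.sum_le_sum fun i _ => ?_
    rw [inner_sub_right, hPb, hAb]
    split_ifs with h
    · simp
    · nlinarith [hpos i h, hLe i, sq_nonneg (inner ℝ (b i) x)]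
  · intro x
    rw [hinner, hnorm, Finset.mul_sum, ← Finset.sum_neg_distrib]
    refine Finset.sum_le_sum fun i _ => ?_
    rw [hPb, hAb]
    split_ifs with h
    · nlinarith [hneg i h, hle i, sq_nonneg (inner ℝ (b i) x)]
    · simp
  · intro x
    rw [hinner, hnorm, Finset.mul_sum, ← Finset.sum_neg_distrib]
    refine Finset.sum_le_sum fun i _ => ?_
    rw [hPb, hAb]
    split_ifs with h
    · nlinarith [hneg i h, hLe i, sq_nonneg (inner ℝ (b i) x)]
    · simp
  · simp only [hP, inner_sum, inner_smul_right]
    rw [Finset.sum_comm]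
    have : ∀ j ∈ S, ∑ i, inner ℝ (b j) (EuclideanSpace.single i 1) *
        inner ℝ (EuclideanSpace.single i 1) (b j) = 1 := by
      intro j _
      have h := (EuclideanSpace.basisFun (Fin d) ℝ).sum_inner_mul_inner (b j) (b j)
      rw [b.inner_eq_one] at h
      simpa using h
    rw [Finset.sum_congr rfl this]
    simp
  · intro h
    rw [Finset.card_eq_zero] at h
    ext x : 1
    rw [hP, h]
    simp

end Spectral

/-! ### The model vector field at a nondegenerate critical point. -/

section LocalField

open Filter Topology Metric

variable {d : ℕ}

/-- The radial scale `√(|Pξ|² + τ)`. -/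
def localScale (P : Space d →L[ℝ] Space d) (ξ : Space d) (τ : ℝ) : ℝ := √(‖P ξ‖ ^ 2 + τ)

/-- The model vector field at a nondegenerate critical point. -/
def localField (P : Space d →L[ℝ] Space d) (ξ : Space d) (τ : ℝ) : Space d :=
  (τ / localScale P ξ τ ^ 3) • (ξ - P ξ) - (d / localScale P ξ τ) • P ξ

theorem localScale_sq (P : Space d →L[ℝ] Space d) (ξ : Space d) {τ : ℝ} (hτ : 0 ≤ τ) :
    localScale P ξ τ ^ 2 = ‖P ξ‖ ^ 2 + τ := Real.sq_sqrt (by positivity)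

theorem localScale_pos (P : Space d →L[ℝ] Space d) (ξ : Space d) {τ : ℝ} (hτ : 0 < τ) :
    0 < localScale P ξ τ := Real.sqrt_pos.2 (by positivity)

namespace IsNegativeProjection

variable {A P : Space d →L[ℝ] Space d} {k : ℕ} {l L : ℝ} (hP : IsNegativeProjection A P k l L)
include hP

theorem inner_sub_eq_zero (ξ : Space d) : inner ℝ (P ξ) (ξ - P ξ) = 0 := by
  rw [inner_sub_right, ← hP.symm (P ξ) ξ, hP.idem, sub_self]

theorem norm_sq_eq (ξ : Space d) : ‖ξ‖ ^ 2 = ‖P ξ‖ ^ 2 + ‖ξ - P ξ‖ ^ 2 := by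
  have h := norm_add_sq_real (P ξ) (ξ - P ξ)
  rw [hP.inner_sub_eq_zero, add_sub_cancel] at h
  linarith

theorem inner_eq (ξ : Space d) :
    inner ℝ (A ξ) ξ = inner ℝ (A ξ) (ξ - P ξ) + inner ℝ (A ξ) (P ξ) := by
  rw [← inner_add_right, sub_add_cancel]

-- Here `f`, `g`, `s` stand for `φ`, `∇φ`, `t - tc`, with Taylor errors measured in the parabolic
-- scaling `|s| ~ ‖ξ‖²`. Put `y = ‖Pξ‖`, `w = ‖ξ - Pξ‖`, `τ = |s|`, `ρ² = y² + τ`. If `f ≤ 0`, the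
-- positive part of the form is dominated by the negative part and the time term, so `w ≤ C₁ ρ` and
-- the field is bounded. If `f = 0`, the time term is dominated by the form, so `τ ≤ C₂ (y² + w²)`.
-- This yields `⟨X, Aξ⟩ ≥ c ρ`, while `‖g‖` is at most a multiple of `ρ`.
set_option maxHeartbeats 800000 in
theorem localField_estimate (hd : 1 ≤ d) {κ : ℝ} (hκ : κ ≠ 0) :
    ∃ ε > 0, ∃ C > 0, ∀ (ξ g : Space d) (s f : ℝ), s ≠ 0 →
      |f - inner ℝ (A ξ) ξ / 2 - κ * s| ≤ ε * (‖ξ‖ ^ 2 + |s|) →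
      ‖g - A ξ‖ ≤ ε * (‖ξ‖ + √|s|) → f ≤ 0 →
      ‖localField P ξ |s|‖ ≤ C ∧ (f = 0 → ‖g‖ ≤ C * inner ℝ (localField P ξ |s|) g) := by
  have hl := hP.pos
  have hκ' : 0 < |κ| := abs_pos.2 hκ
  set L' := max L 0
  have hL' : 0 ≤ L' := le_max_right _ _
  have hLL : L ≤ L' := le_max_left _ _
  have hd' : (1 : ℝ) ≤ d := by exact_mod_cast hd
  set C₁ := √((2 * L' + 4 * |κ| + l) / l) with hC₁
  have hC₁0 : 0 ≤ C₁ := Real.sqrt_nonneg _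
  have hC₁sq : C₁ ^ 2 * l = 2 * L' + 4 * |κ| + l := by
    rw [hC₁, Real.sq_sqrt (by positivity)]; field_simp
  set C₂ := (L' + l) / |κ| with hC₂
  have hC₂0 : 0 < C₂ := by positivity
  have hC₂e : C₂ * |κ| = L' + l := by rw [hC₂]; field_simp
  set c := l * (min (1 / C₂) 1 / 2) with hc
  have hc0 : 0 < c := by positivity
  -- The bounds `l / 4` and `|κ| / 2` absorb the error in `f` in the comparisons giving `C₁` and
  -- `C₂`. The last bound keeps `⟨X, g - Aξ⟩` below half of `c ρ`, given `‖X‖ ≤ C₁ + d` and `‖ξ‖ +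
  -- √τ ≤ (C₁ + 2) ρ`.
  set ε := min (min (l / 4) (|κ| / 2)) (c / 2 / ((C₁ + d) * (C₁ + 2))) with hε
  have hε0 : 0 < ε := by positivity
  have hε1 : ε ≤ l / 4 := (min_le_left _ _).trans (min_le_left _ _)
  have hε2 : ε ≤ |κ| / 2 := (min_le_left _ _).trans (min_le_right _ _)
  have hε3 : ε * ((C₁ + d) * (C₁ + 2)) ≤ c / 2 := by
    have : ε ≤ c / 2 / ((C₁ + d) * (C₁ + 2)) := min_le_right _ _
    rwa [le_div_iff₀ (by positivity)] at this
  set C₃ := ‖A‖ * (C₁ + 2) + ε * (C₁ + 2) with hC₃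
  have hC₃0 : 0 ≤ C₃ := by positivity
  refine ⟨ε, hε0, (C₁ + d) + C₃ * (2 / c), by positivity, fun ξ g s f hs hf hg hf0 => ?_⟩
  set τ := |s| with hτ
  have hτ0 : 0 < τ := abs_pos.2 hs
  set ρ := localScale P ξ τ with hρ
  have hρ0 : 0 < ρ := localScale_pos P ξ hτ0
  have hρsq : ρ ^ 2 = ‖P ξ‖ ^ 2 + τ := localScale_sq P ξ hτ0.le
  set y := ‖P ξ‖ with hy
  set w := ‖ξ - P ξ‖ with hw
  have hy0 : 0 ≤ y := norm_nonneg _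
  have hw0 : 0 ≤ w := norm_nonneg _
  have hξ : ‖ξ‖ ^ 2 = y ^ 2 + w ^ 2 := hP.norm_sq_eq ξ
  have hq := hP.inner_eq ξ
  have hq1 := hP.le_pos ξ
  have hq2 := hP.pos_le ξ
  have hq3 := hP.le_neg ξ
  have hq4 := hP.neg_le ξ
  set q₁ := inner ℝ (A ξ) (ξ - P ξ)
  set q₂ := inner ℝ (A ξ) (P ξ)
  have hLw : L * w ^ 2 ≤ L' * w ^ 2 := by gcongr
  have hLy : L * y ^ 2 ≤ L' * y ^ 2 := by gcongr
  have hκs := abs_le.1 (show |κ * s| ≤ |κ| * τ by rw [abs_mul])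
  rw [hq, hξ] at hf
  have hf' := abs_le.1 hf
  have hεsum : ε * (y ^ 2 + w ^ 2 + τ) ≤ l / 4 * (y ^ 2 + w ^ 2 + τ) := by gcongr
  have hwρ : w ≤ C₁ * ρ := by
    refine abs_le_of_sq_le_sq' ?_ (by positivity) |>.2
    rw [mul_pow, hρsq]
    have : l * w ^ 2 ≤ l * (C₁ ^ 2 * (y ^ 2 + τ)) := by
      have e : l * (C₁ ^ 2 * (y ^ 2 + τ)) = (2 * L' + 4 * |κ| + l) * (y ^ 2 + τ) := by
        rw [← hC₁sq]; ring
      rw [e]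
      have h1 := mul_nonneg hL' hτ0.le
      have h2 := mul_nonneg hκ'.le (sq_nonneg y)
      have h3 : l * w ^ 2 ≤ L' * y ^ 2 + 2 * (|κ| * τ) + 2 * (l / 4 * (y ^ 2 + w ^ 2 + τ)) := by
        linarith only [hq1, hq4, hLy, hκs.1, hf'.1, hεsum, hf0]
      linarith only [h1, h2, h3]
    exact le_of_mul_le_mul_left this hl
  have hyρ : y ≤ ρ := abs_le_of_sq_le_sq' (by rw [hρsq]; linarith) hρ0.le |>.2
  have hτρ : √τ ≤ ρ := Real.sqrt_le_sqrt (by have := sq_nonneg ‖P ξ‖; linarith)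
  have hτρ2 : τ ≤ ρ ^ 2 := by rw [hρsq]; have := sq_nonneg y; linarith
  have hξρ : ‖ξ‖ + √τ ≤ (C₁ + 2) * ρ := by
    have : ‖ξ‖ ≤ w + y := by simpa using norm_add_le (ξ - P ξ) (P ξ)
    linarith only [this, hwρ, hyρ, hτρ]
  have hX : ‖localField P ξ τ‖ ≤ C₁ + d := by
    have e1 : ‖(τ / ρ ^ 3) • (ξ - P ξ)‖ ≤ C₁ := by
      rw [norm_smul, Real.norm_of_nonneg (by positivity), div_mul_eq_mul_div,
        div_le_iff₀ (by positivity)]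
      calc τ * ‖ξ - P ξ‖ ≤ ρ ^ 2 * (C₁ * ρ) := by gcongr
        _ = C₁ * ρ ^ 3 := by ring
    have e2 : ‖((d : ℝ) / ρ) • P ξ‖ ≤ d := by
      rw [norm_smul, Real.norm_of_nonneg (by positivity), div_mul_eq_mul_div,
        div_le_iff₀ (by positivity)]
      gcongr
    exact (norm_sub_le _ _).trans (add_le_add e1 e2)
  refine ⟨hX.trans (le_add_of_nonneg_right (by positivity)), fun hf00 => ?_⟩
  rw [hf00] at hf'
  have hτC : τ ≤ C₂ * (y ^ 2 + w ^ 2) := by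
    have hκτ : |κ| * τ = |κ * s| := by rw [abs_mul]
    have h1 : |κ * s| ≤ |q₁ + q₂| / 2 + ε * (y ^ 2 + w ^ 2 + τ) := by
      rw [abs_le]
      have h2 := abs_le.1 (le_refl |q₁ + q₂|)
      constructor <;> linarith only [h2.1, h2.2, hf'.1, hf'.2]
    have h3 : |q₁ + q₂| ≤ L' * (y ^ 2 + w ^ 2) := by
      rw [abs_le]
      have h5 := mul_nonneg hl.le (sq_nonneg w)
      have h6 := mul_nonneg hl.le (sq_nonneg y)
      have h7 := mul_nonneg hL' (sq_nonneg w)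
      have h8 := mul_nonneg hL' (sq_nonneg y)
      constructor <;> linarith only [hq1, hq2, hq3, hq4, hLw, hLy, h5, h6, h7, h8]
    have h4 : ε * τ ≤ |κ| / 2 * τ := by gcongr
    have h5 : ε * (y ^ 2 + w ^ 2) ≤ l / 4 * (y ^ 2 + w ^ 2) := by gcongr
    have h6 : |κ| * τ ≤ |κ| * (C₂ * (y ^ 2 + w ^ 2)) := by
      have e : |κ| * (C₂ * (y ^ 2 + w ^ 2)) = (L' + l) * (y ^ 2 + w ^ 2) := by rw [← hC₂e]; ring
      rw [e]
      have := mul_nonneg hl.le (by positivity : 0 ≤ y ^ 2 + w ^ 2)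
      linarith
    exact le_of_mul_le_mul_left h6 hκ'
  have hXA : c * ρ ≤ inner ℝ (localField P ξ τ) (A ξ) := by
    rw [localField, inner_sub_left, inner_smul_left, inner_smul_left,
      real_inner_comm, real_inner_comm (A ξ) (P ξ)]
    simp only [conj_trivial]
    change c * ρ ≤ τ / ρ ^ 3 * q₁ - d / ρ * q₂
    have h1 : τ / ρ ^ 3 * (l * w ^ 2) ≤ τ / ρ ^ 3 * q₁ := by gcongr
    have h2 : d / ρ * (l * y ^ 2) ≤ d / ρ * (- q₂) := by gcongr
    have h3 : 1 / ρ * (l * y ^ 2) ≤ d / ρ * (l * y ^ 2) := by gcongr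
    -- With `m = min (1 / C₂) 1` one has `τ w² + y² ρ² = τ (y² + w²) + y⁴ ≥ m (τ² + y⁴) ≥ (m / 2)
    -- ρ⁴`, which is why `c = l m / 2`.
    have h4 : c * ρ ≤ τ / ρ ^ 3 * (l * w ^ 2) + 1 / ρ * (l * y ^ 2) := by
      have e : τ / ρ ^ 3 * (l * w ^ 2) + 1 / ρ * (l * y ^ 2)
          = l * (τ * w ^ 2 + y ^ 2 * ρ ^ 2) / ρ ^ 3 := by field_simp
      rw [e, le_div_iff₀ (by positivity), hc, mul_assoc, mul_assoc]
      gcongr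
      have h5 : min (1 / C₂) 1 * τ ^ 2 ≤ τ * (y ^ 2 + w ^ 2) := by
        have : min (1 / C₂) 1 * τ ≤ y ^ 2 + w ^ 2 := by
          calc min (1 / C₂) 1 * τ ≤ 1 / C₂ * (C₂ * (y ^ 2 + w ^ 2)) := by
                gcongr; exact min_le_left _ _
            _ = _ := by field_simp
        calc _ = τ * (min (1 / C₂) 1 * τ) := by ring
          _ ≤ _ := by gcongr
      have h6 : min (1 / C₂) 1 * (y ^ 2) ^ 2 ≤ (y ^ 2) ^ 2 :=
        mul_le_of_le_one_left (by positivity) (min_le_right _ _)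
      have h7 : 0 ≤ min (1 / C₂) 1 := by positivity
      have e2 : ρ * ρ ^ 3 = (y ^ 2 + τ) ^ 2 := by rw [← hρsq]; ring
      rw [e2, hρsq]
      linarith only [h5, h6, mul_nonneg h7 (sq_nonneg (y ^ 2 - τ))]
    linarith
  have hXg : c / 2 * ρ ≤ inner ℝ (localField P ξ τ) g := by
    have e : inner ℝ (localField P ξ τ) g
        = inner ℝ (localField P ξ τ) (A ξ) + inner ℝ (localField P ξ τ) (g - A ξ) := by
      rw [← inner_add_right, add_sub_cancel]
    have h1 := (abs_le.1 (abs_real_inner_le_norm (localField P ξ τ) (g - A ξ))).1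
    have h2 : ‖localField P ξ τ‖ * ‖g - A ξ‖ ≤ (C₁ + d) * (ε * ((C₁ + 2) * ρ)) := by
      gcongr
      exact hg.trans (by gcongr)
    have h3 : (C₁ + d) * (ε * ((C₁ + 2) * ρ)) ≤ c / 2 * ρ := by
      calc _ = ε * ((C₁ + d) * (C₁ + 2)) * ρ := by ring
        _ ≤ _ := by gcongr
    linarith
  have hgρ : ‖g‖ ≤ C₃ * ρ := by
    have h1 : ‖g‖ ≤ ‖A ξ‖ + ‖g - A ξ‖ := by simpa using norm_add_le (A ξ) (g - A ξ)
    have h2 : ‖A ξ‖ ≤ ‖A‖ * ((C₁ + 2) * ρ) :=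
      (A.le_opNorm ξ).trans (by gcongr; linarith [Real.sqrt_nonneg τ])
    have h3 : ‖g - A ξ‖ ≤ ε * ((C₁ + 2) * ρ) := hg.trans (by gcongr)
    rw [hC₃]; linarith
  have hX0 : 0 ≤ inner ℝ (localField P ξ τ) g := le_trans (by positivity) hXg
  calc ‖g‖ ≤ C₃ * ρ := hgρ
    _ = C₃ * (2 / c) * (c / 2 * ρ) := by field_simp
    _ ≤ C₃ * (2 / c) * inner ℝ (localField P ξ τ) g := by gcongr
    _ ≤ _ := by
      gcongr
      exact le_add_of_nonneg_left (by positivity)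

end IsNegativeProjection

theorem contDiffAt_localField (P : Space d →L[ℝ] Space d) (xc : Space d) {tc : ℝ}
    {z : SpaceTime d} (hz : z.2 ≠ tc) :
    ContDiffAt ℝ ∞ (fun z : SpaceTime d => localField P (z.1 - xc) |z.2 - tc|) z := by
  have hτ : ContDiffAt ℝ ∞ (fun z : SpaceTime d => |z.2 - tc|) z :=
    (contDiffAt_abs (sub_ne_zero.2 hz)).comp z (contDiffAt_snd.sub contDiffAt_const)
  have h1 : ContDiffAt ℝ ∞ (fun z : SpaceTime d => z.1 - xc) z :=
    contDiffAt_fst.sub contDiffAt_const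
  have h2 : ContDiffAt ℝ ∞ (fun z : SpaceTime d => P (z.1 - xc)) z :=
    P.contDiff.contDiffAt.comp z h1
  have h3 : 0 < |z.2 - tc| := abs_pos.2 (sub_ne_zero.2 hz)
  have hρ : ContDiffAt ℝ ∞ (fun z : SpaceTime d => localScale P (z.1 - xc) |z.2 - tc|) z :=
    ((h2.norm_sq ℝ).add hτ).sqrt (by positivity)
  have hρ0 := (localScale_pos P (z.1 - xc) h3).ne'
  exact ((hτ.div (hρ.pow 3) (pow_ne_zero _ hρ0)).smul (h1.sub h2)).sub
    ((contDiffAt_const.div hρ hρ0).smul h2)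

/-- The traces of `1 - P` and `P` are `d - k` and `k`. The gradient of `ρ` is `Pξ / ρ`: it is
orthogonal to `ξ - Pξ`, so it contributes nothing through the first summand of the field, and it
gives `d ‖Pξ‖² / ρ³` through the second. -/
theorem IsNegativeProjection.sum_spatialPartial_localField {A P : Space d →L[ℝ] Space d} {k : ℕ}
    {l L : ℝ} (hP : IsNegativeProjection A P k l L) (xc : Space d) {tc : ℝ}
    {z : SpaceTime d} (hz : z.2 ≠ tc) :
    ∑ i, spatialPartial i (fun z => localField P (z.1 - xc) |z.2 - tc| i) z
      = |z.2 - tc| * (d - k) / localScale P (z.1 - xc) |z.2 - tc| ^ 3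
        - d * k / localScale P (z.1 - xc) |z.2 - tc|
        + d * ‖P (z.1 - xc)‖ ^ 2 / localScale P (z.1 - xc) |z.2 - tc| ^ 3 := by
  set ξ := z.1 - xc with hξ
  set τ := |z.2 - tc| with hτ
  have hτ0 : 0 < τ := abs_pos.2 (sub_ne_zero.2 hz)
  set ρ := localScale P ξ τ with hρ
  have hρ0 : 0 < ρ := localScale_pos P ξ hτ0
  have hPi : ∀ i, inner ℝ (P ξ) (EuclideanSpace.single i (1 : ℝ)) = P ξ i := fun i => by
    rw [EuclideanSpace.inner_single_right]; simp
  have hPii : ∀ i, inner ℝ (EuclideanSpace.single i (1 : ℝ)) (P (EuclideanSpace.single i (1 : ℝ)))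
      = P (EuclideanSpace.single i (1 : ℝ)) i := fun i => by
    rw [EuclideanSpace.inner_single_left]; simp
  have key : ∀ i, spatialPartial i (fun z => localField P (z.1 - xc) |z.2 - tc| i) z
      = τ / ρ ^ 3 * (1 - P (EuclideanSpace.single i 1) i)
        - 3 * τ / ρ ^ 5 * (P ξ i * (ξ - P ξ) i)
        - d / ρ * P (EuclideanSpace.single i 1) i + d / ρ ^ 3 * (P ξ i * P ξ i) := by
    intro i
    set e : Space d := EuclideanSpace.single i 1 with he
    have hdiff : DifferentiableAt ℝ (fun z : SpaceTime d => localField P (z.1 - xc) |z.2 - tc| i) z :=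
      (EuclideanSpace.proj (𝕜 := ℝ) i).differentiableAt.comp z
        ((contDiffAt_localField P xc hz).differentiableAt (by simp))
    have hline : HasDerivAt (fun r : ℝ => z + r • ((e, 0) : SpaceTime d)) (e, 0) 0 := by
      simpa using ((hasDerivAt_id (0 : ℝ)).smul_const ((e, 0) : SpaceTime d)).const_add z
    have hd1 : HasDerivAt (fun r : ℝ => localField P (ξ + r • e) τ i)
        (spatialPartial i (fun z => localField P (z.1 - xc) |z.2 - tc| i) z) 0 := by
      have := (hdiff.hasFDerivAt.comp_hasDerivAt_of_eq (0 : ℝ) hline (by simp))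
      refine this.congr_of_eventuallyEq (Eventually.of_forall fun r => ?_)
      have e1 : z.1 + r • e - xc = ξ + r • e := by rw [hξ]; abel
      simp [e1, hτ]
    have hξr : HasDerivAt (fun r : ℝ => ξ + r • e) e 0 := by
      simpa using ((hasDerivAt_id (0 : ℝ)).smul_const e).const_add ξ
    have hPr : HasDerivAt (fun r : ℝ => P (ξ + r • e)) (P e) 0 :=
      P.hasFDerivAt.comp_hasDerivAt _ hξr
    have hρr : HasDerivAt (fun r : ℝ => localScale P (ξ + r • e) τ) (P ξ i / ρ) 0 := by
      have h1 := hPr.norm_sq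
      have h2 := (h1.add_const τ).sqrt (by simp; positivity)
      have e1 : P ξ i / ρ = 2 * inner ℝ (P (ξ + (0 : ℝ) • e)) (P e)
          / (2 * √(‖P (ξ + (0 : ℝ) • e)‖ ^ 2 + τ)) := by
        rw [zero_smul, add_zero, ← hP.symm, hP.idem, hPi, mul_div_mul_left _ _ two_ne_zero]
        rfl
      rw [e1]
      exact h2
    have hci : HasDerivAt (fun r : ℝ => P (ξ + r • e) i) (P e i) 0 :=
      (EuclideanSpace.proj (𝕜 := ℝ) i).hasFDerivAt.comp_hasDerivAt _ hPr
    have hxi : HasDerivAt (fun r : ℝ => (ξ + r • e) i) (e i) 0 :=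
      (EuclideanSpace.proj (𝕜 := ℝ) i).hasFDerivAt.comp_hasDerivAt _ hξr
    have hρ00 : localScale P (ξ + (0 : ℝ) • e) τ ≠ 0 := by simpa using hρ0.ne'
    have h4 := ((((hasDerivAt_const (0 : ℝ) τ).div (hρr.pow 3) (pow_ne_zero _ hρ00)).mul
      (hxi.sub hci)).sub (((hasDerivAt_const (0 : ℝ) (d : ℝ)).div hρr hρ00).mul hci))
    have h5 := hd1.unique (h4.congr_of_eventuallyEq (Eventually.of_forall fun r => by
      simp [localField, mul_add]))
    rw [h5]
    have hei : e i = 1 := by simp [he]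
    simp only [zero_smul, add_zero, hei, Pi.sub_apply, ← hρ, PiLp.sub_apply, Pi.div_apply, Pi.pow_apply]
    field_simp
    ring
  rw [Finset.sum_congr rfl fun i _ => key i]
  have s1 : ∑ i, P (EuclideanSpace.single i (1 : ℝ)) i = (k : ℝ) := by
    rw [← hP.trace]; exact Finset.sum_congr rfl fun i _ => (hPii i).symm
  have s2 : ∑ i, P ξ i * (ξ - P ξ) i = 0 := by
    have h := hP.inner_sub_eq_zero ξ
    rw [PiLp.inner_apply] at h
    simpa [mul_comm] using h
  have s3 : ∑ i, P ξ i * P ξ i = ‖P ξ‖ ^ 2 := by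
    rw [← real_inner_self_eq_norm_sq, PiLp.inner_apply]
    rfl
  simp only [Finset.sum_add_distrib, Finset.sum_sub_distrib, ← Finset.mul_sum, s1, s2, s3]
  simp
  ring

end LocalField

/-! ### Taylor expansion at the critical point in parabolic scaling. -/

section Taylor

open Filter Topology Metric

variable {d : ℕ} {t₀ T : ℝ} {φ : SpaceTime d → ℝ} {xc : Space d} {tc : ℝ}

namespace IsAdmissible

variable (hφ : IsAdmissible t₀ T φ xc tc)
include hφ

theorem hasDerivWithinAt_time {z : SpaceTime d} (hz : z ∈ closedSlab d t₀ T) :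
    HasDerivWithinAt (fun s : ℝ => φ (z.1, s)) (fderivWithin ℝ φ (closedSlab d t₀ T) z (0, 1))
      (Icc t₀ T) z.2 := by
  have h0 : HasDerivWithinAt (fun s : ℝ => ((z.1, s) : SpaceTime d)) (0, 1) (Icc t₀ T) z.2 :=
    (hasDerivWithinAt_const _ _ _).prodMk (hasDerivWithinAt_id _ _)
  have hm : MapsTo (fun s : ℝ => ((z.1, s) : SpaceTime d)) (Icc t₀ T) (closedSlab d t₀ T) :=
    fun s hs => ⟨trivial, hs⟩
  exact HasFDerivWithinAt.comp_hasDerivWithinAt z.2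
    (hφ.smooth.differentiableOn (by simp) z hz).hasFDerivWithinAt h0 hm

theorem fderivWithin_time {z : SpaceTime d} (hz : z ∈ closedSlab d t₀ T) :
    fderivWithin ℝ φ (closedSlab d t₀ T) z (0, 1) = timeDerivative t₀ T φ z :=
  ((hφ.hasDerivWithinAt_time hz).derivWithin (uniqueDiffOn_Icc hφ.time_lt z.2 hz.2)).symm

theorem continuousOn_timeDerivative :
    ContinuousOn (timeDerivative t₀ T φ) (closedSlab d t₀ T) := by
  have h := ((hφ.smooth.continuousOn_fderivWithin (uniqueDiffOn_closedSlab hφ.time_lt)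
    (by simp)).clm_apply (continuousOn_const (c := ((0, 1) : SpaceTime d))))
  exact h.congr fun z hz => (hφ.fderivWithin_time hz).symm

theorem hasGradientAt_slice {z : SpaceTime d} (hz : z ∈ closedSlab d t₀ T) :
    HasGradientAt (fun x : Space d => φ (x, z.2)) (spatialGradient φ z) z.1 :=
  (hasFDerivAt_slice hz (hφ.smooth.differentiableOn (by simp) z hz)).differentiableAt.hasGradientAt

/-- With `σ = √|t - tc|`, the time increment of `∇φ` is of order `σ²`, which is small compared with
`σ`. Only the Hessian survives at first order. -/
theorem eventually_spatialGradient_sub_le {ε : ℝ} (hε : 0 < ε) :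
    ∀ᶠ z in 𝓝[closedSlab d t₀ T] (xc, tc),
      ‖spatialGradient φ z - hessianMap t₀ T φ (xc, tc) (z.1 - xc)‖
        ≤ ε * (‖z.1 - xc‖ + √|z.2 - tc|) := by
  set D := fderivWithin ℝ (spatialGradient φ) (closedSlab d t₀ T) (xc, tc) with hD
  have h1 := ((hφ.contDiffOn_spatialGradient.differentiableOn (by simp) _
    hφ.critical_mem).hasFDerivWithinAt.isLittleO.def (half_pos hε))
  have h2 : Tendsto (fun z : SpaceTime d => √|z.2 - tc|) (𝓝[closedSlab d t₀ T] (xc, tc)) (𝓝 0) := by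
    have : Continuous fun z : SpaceTime d => √|z.2 - tc| := by fun_prop
    have h := (this.continuousWithinAt (s := closedSlab d t₀ T) (x := ((xc, tc) : SpaceTime d))).tendsto
    simpa using h
  have h3 := h2.eventually_lt_const (show (0 : ℝ) < ε / 2 / (‖D (0, 1)‖ + 1) by positivity)
  have h4 := h2.eventually_lt_const (show (0 : ℝ) < 1 by positivity)
  filter_upwards [h1, h3, h4] with z hz hz3 hz4
  set σ := √|z.2 - tc| with hσ
  have hσ0 : 0 ≤ σ := Real.sqrt_nonneg _
  have hσsq : |z.2 - tc| = σ * σ := (Real.mul_self_sqrt (abs_nonneg _)).symm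
  have hσ1 : |z.2 - tc| ≤ σ := by rw [hσsq]; exact mul_le_of_le_one_left hσ0 hz4.le
  rw [hφ.critical, sub_zero, ← hD] at hz
  have e : D (z - (xc, tc)) = hessianMap t₀ T φ (xc, tc) (z.1 - xc) + (z.2 - tc) • D (0, 1) := by
    rw [hessianMap, ContinuousLinearMap.comp_apply, ← map_smul, ← hD, ← map_add]
    congr 1
    ext <;> simp
  have h5 : ‖z - (xc, tc)‖ ≤ ‖z.1 - xc‖ + σ := by
    rw [Prod.norm_def]
    refine max_le (le_add_of_nonneg_right hσ0) ?_
    exact (le_trans (by simp) hσ1).trans (le_add_of_nonneg_left (norm_nonneg _))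
  have h6 : ‖(z.2 - tc) • D (0, 1)‖ ≤ ε / 2 * σ := by
    rw [norm_smul, Real.norm_eq_abs, hσsq, mul_assoc, mul_comm]
    have : σ * ‖D (0, 1)‖ ≤ ε / 2 := by
      rw [lt_div_iff₀ (by positivity)] at hz3
      linarith
    rw [mul_comm (ε / 2)]
    calc σ * ‖D (0, 1)‖ * σ = σ * (σ * ‖D (0, 1)‖) := by ring
      _ ≤ _ := by gcongr
  calc ‖spatialGradient φ z - hessianMap t₀ T φ (xc, tc) (z.1 - xc)‖
      = ‖(spatialGradient φ z - D (z - (xc, tc))) + (z.2 - tc) • D (0, 1)‖ := by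
        rw [e]; congr 1; abel
    _ ≤ ε / 2 * (‖z.1 - xc‖ + σ) + ε / 2 * σ :=
        (norm_add_le _ _).trans (add_le_add (hz.trans (by gcongr)) h6)
    _ ≤ _ := by nlinarith [norm_nonneg (z.1 - xc)]

/-- Two mean value estimates. At `t = tc` the gradient estimate, whose time term vanishes there, is
integrated along the segment from `xc`. Then the variation of the time derivative is integrated from
`tc` to `t` at fixed `x`. -/
theorem eventually_sub_le {ε : ℝ} (hε : 0 < ε) :
    ∀ᶠ z in 𝓝[closedSlab d t₀ T] (xc, tc),
      |φ z - inner ℝ (hessianMap t₀ T φ (xc, tc) (z.1 - xc)) (z.1 - xc) / 2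
        - timeDerivative t₀ T φ (xc, tc) * (z.2 - tc)| ≤ ε * (‖z.1 - xc‖ ^ 2 + |z.2 - tc|) := by
  set A := hessianMap t₀ T φ (xc, tc)
  set κ := timeDerivative t₀ T φ (xc, tc)
  have h1 := hφ.eventually_spatialGradient_sub_le hε
  have h2 : ∀ᶠ z in 𝓝[closedSlab d t₀ T] (xc, tc), ‖timeDerivative t₀ T φ z - κ‖ ≤ ε := by
    have h := (hφ.continuousOn_timeDerivative _ hφ.critical_mem).eventually
      (closedBall_mem_nhds κ hε)
    filter_upwards [h] with z hz
    rwa [dist_eq_norm] at hz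
  obtain ⟨δ, hδ, hball⟩ := Metric.mem_nhdsWithin_iff.1 (h1.and h2)
  filter_upwards [inter_mem_nhdsWithin (closedSlab d t₀ T) (ball_mem_nhds _ hδ)] with z hz
  obtain ⟨hzs, hzb⟩ := hz
  set ξ := z.1 - xc with hξ
  have hξδ : ‖ξ‖ < δ := by
    rw [mem_ball, Prod.dist_eq, max_lt_iff, dist_eq_norm] at hzb
    exact hzb.1
  have hsδ : |z.2 - tc| < δ := by
    rw [mem_ball, Prod.dist_eq, max_lt_iff, Real.dist_eq] at hzb
    exact hzb.2
  have stepx : |φ (z.1, tc) - inner ℝ (A ξ) ξ / 2| ≤ ε * ‖ξ‖ ^ 2 := by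
    have hder : ∀ r : ℝ, HasDerivAt (fun r : ℝ => φ (xc + r • ξ, tc) - r ^ 2 * (inner ℝ (A ξ) ξ / 2))
        (inner ℝ (spatialGradient φ (xc + r • ξ, tc)) ξ - 2 * r * (inner ℝ (A ξ) ξ / 2)) r := by
      intro r
      have g1 := (hφ.hasGradientAt_slice (z := (xc + r • ξ, tc)) ⟨trivial, hφ.time_mem⟩).hasFDerivAt
      have g2 : HasDerivAt (fun r : ℝ => xc + r • ξ) ξ r := by
        simpa using ((hasDerivAt_id r).smul_const ξ).const_add xc
      have g3 := g1.comp_hasDerivAt r g2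
      have g4 := g3.sub ((hasDerivAt_pow 2 r).mul_const (inner ℝ (A ξ) ξ / 2))
      exact g4.congr_deriv (by simp)
    have hb := norm_image_sub_le_of_norm_deriv_le_segment_01' (C := ε * ‖ξ‖ ^ 2)
      (fun r _ => (hder r).hasDerivWithinAt) (fun r hr => by
        have hr1 : ‖r • ξ‖ ≤ ‖ξ‖ := by
          rw [norm_smul, Real.norm_of_nonneg hr.1]
          exact mul_le_of_le_one_left (norm_nonneg _) hr.2.le
        have hmem : ((xc + r • ξ, tc) : SpaceTime d) ∈ ball ((xc, tc) : SpaceTime d) δ ∩ closedSlab d t₀ T := by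
          refine ⟨?_, trivial, hφ.time_mem⟩
          rw [mem_ball, Prod.dist_eq, max_lt_iff]
          refine ⟨?_, by simpa using hδ⟩
          simpa [dist_eq_norm] using hr1.trans_lt hξδ
        have hg := (hball hmem).1
        simp only [add_sub_cancel_left, sub_self, abs_zero, Real.sqrt_zero, add_zero] at hg
        have e : inner ℝ (spatialGradient φ (xc + r • ξ, tc)) ξ - 2 * r * (inner ℝ (A ξ) ξ / 2)
            = inner ℝ (spatialGradient φ (xc + r • ξ, tc) - A (r • ξ)) ξ := by
          rw [inner_sub_left, map_smul, inner_smul_left]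
          simp
          ring
        rw [e]
        calc _ ≤ ‖spatialGradient φ (xc + r • ξ, tc) - A (r • ξ)‖ * ‖ξ‖ := norm_inner_le_norm _ _
          _ ≤ (ε * ‖ξ‖) * ‖ξ‖ := by gcongr; exact hg.trans (by gcongr)
          _ = _ := by ring)
    have e1 : xc + ξ = z.1 := by rw [hξ]; abel
    simpa [e1, hφ.zero_level] using hb
  have stept : |φ z - φ (z.1, tc) - κ * (z.2 - tc)| ≤ ε * |z.2 - tc| := by
    have hsub : uIcc tc z.2 ⊆ Icc t₀ T := uIcc_subset_Icc hφ.time_mem hzs.2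
    have hb := (convex_uIcc tc z.2).norm_image_sub_le_of_norm_hasDerivWithin_le (C := ε)
      (f := fun s : ℝ => φ (z.1, s) - κ * s) (f' := fun s => timeDerivative t₀ T φ (z.1, s) - κ)
      (fun s hs => by
        have g1 := hφ.hasDerivWithinAt_time (z := (z.1, s)) ⟨trivial, hsub hs⟩
        rw [hφ.fderivWithin_time ⟨trivial, hsub hs⟩] at g1
        have g2 := (g1.mono hsub).sub ((hasDerivWithinAt_id s (uIcc tc z.2)).const_mul κ)
        exact g2.congr_deriv (by simp))
      (fun s hs => by
        suffices h : ((z.1, s) : SpaceTime d) ∈ ball ((xc, tc) : SpaceTime d) δ from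
          (hball ⟨h, trivial, hsub hs⟩).2
        rw [mem_ball, Prod.dist_eq, max_lt_iff, dist_eq_norm, Real.dist_eq]
        refine ⟨hξδ, lt_of_le_of_lt ?_ hsδ⟩
        rw [abs_sub_comm s tc, abs_sub_comm z.2 tc]
        have := abs_sub_left_of_mem_uIcc hs
        rwa [abs_sub_comm s, abs_sub_comm z.2] at this)
      left_mem_uIcc right_mem_uIcc
    rw [Real.norm_eq_abs, Real.norm_eq_abs] at hb
    convert hb using 2
    change _ = φ z - κ * z.2 - (φ (z.1, tc) - κ * tc)
    ring
  have e : φ z - inner ℝ (A ξ) ξ / 2 - κ * (z.2 - tc)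
      = (φ z - φ (z.1, tc) - κ * (z.2 - tc)) + (φ (z.1, tc) - inner ℝ (A ξ) ξ / 2) := by ring
  rw [e]
  refine (abs_add_le _ _).trans ?_
  linarith

end IsAdmissible

end Taylor

/-! ### The weighted field near the critical point, and boundedness of the closed domain. -/

section Field

open Filter Topology Metric

variable {d : ℕ} {t₀ T : ℝ} {φ : SpaceTime d → ℝ} {xc : Space d} {tc : ℝ}

open Classical in
/-- The power of `|t - tc|` in the weight. -/
def timeWeight (φ : SpaceTime d → ℝ) (xc : Space d) (tc : ℝ) (z : SpaceTime d) : ℝ :=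
  if (spatialHessian φ (xc, tc)).PosDef then √|z.2 - tc| else 1

theorem timeWeight_nonneg (z : SpaceTime d) : 0 ≤ timeWeight φ xc tc z := by
  unfold timeWeight; split_ifs <;> positivity

theorem timeWeight_le {z : SpaceTime d} {B : ℝ} (hB : 1 ≤ B) (h : |z.2 - tc| ≤ B) :
    timeWeight φ xc tc z ≤ B := by
  unfold timeWeight
  split_ifs
  · rw [Real.sqrt_le_left (by positivity)]
    nlinarith
  · exact hB

theorem contDiffAt_timeWeight {z : SpaceTime d} (hz : z.2 ≠ tc) :
    ContDiffAt ℝ ∞ (timeWeight φ xc tc) z := by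
  have h3 : 0 < |z.2 - tc| := abs_pos.2 (sub_ne_zero.2 hz)
  have h : ContDiffAt ℝ ∞ (fun z : SpaceTime d => |z.2 - tc|) z :=
    (contDiffAt_abs (sub_ne_zero.2 hz)).comp z (contDiffAt_snd.sub contDiffAt_const)
  unfold timeWeight
  split_ifs
  · exact h.sqrt h3.ne'
  · exact contDiffAt_const

theorem spatialPartial_eq_zero_of_time {g : SpaceTime d → ℝ} (hg : ∀ x y t, g (x, t) = g (y, t))
    {z : SpaceTime d} (hd : DifferentiableAt ℝ g z) (i : Fin d) : spatialPartial i g z = 0 := by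
  have hline : HasDerivAt (fun r : ℝ => z + r • ((EuclideanSpace.single i 1, 0) : SpaceTime d))
      (EuclideanSpace.single i 1, 0) 0 := by
    simpa using ((hasDerivAt_id (0 : ℝ)).smul_const
      ((EuclideanSpace.single i 1, 0) : SpaceTime d)).const_add z
  have h1 := hd.hasFDerivAt.comp_hasDerivAt_of_eq (0 : ℝ) hline (by simp)
  refine h1.unique ((hasDerivAt_const (0 : ℝ) (g z)).congr_of_eventuallyEq
    (Eventually.of_forall fun r => ?_))
  have : z + r • ((EuclideanSpace.single i 1, 0) : SpaceTime d)
      = (z.1 + r • EuclideanSpace.single i 1, z.2) := by ext <;> simp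
  simp only [Function.comp_apply, this]
  exact hg _ _ _

theorem spatialPartial_timeWeight {z : SpaceTime d} (hz : z.2 ≠ tc) (i : Fin d) :
    spatialPartial i (timeWeight φ xc tc) z = 0 :=
  spatialPartial_eq_zero_of_time (fun _ _ _ => rfl)
    ((contDiffAt_timeWeight hz).differentiableAt (by simp)) i

namespace IsAdmissible

variable (hφ : IsAdmissible t₀ T φ xc tc)
include hφ

theorem exists_hessian_splitting : ∃ (P : Space d →L[ℝ] Space d) (k : ℕ) (l L : ℝ),
    IsNegativeProjection (hessianMap t₀ T φ (xc, tc)) P k l L ∧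
      (k = 0 ↔ (spatialHessian φ (xc, tc)).PosDef) ∧ (k = 0 → P = 0) := by
  set hH := hφ.spatialHessian_isHermitian hφ.critical_mem
  have hne : ∀ i, hH.eigenvalues i ≠ 0 := fun i hi => by
    refine hφ.nondegenerate ?_
    rw [hH.det_eq_prod_eigenvalues]
    exact Finset.prod_eq_zero (Finset.mem_univ i) (by simpa using hi)
  obtain ⟨P, l, L, hP, hP0⟩ := exists_isNegativeProjection (hessianMap t₀ T φ (xc, tc))
    hH.eigenvectorBasis hH.eigenvalues hne (hφ.hessianMap_eigenvectorBasis hφ.critical_mem)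
  refine ⟨P, _, l, L, hP, ?_, hP0⟩
  rw [hH.posDef_iff_eigenvalues_pos, Finset.card_eq_zero, Finset.filter_eq_empty_iff]
  simp only [Finset.mem_univ, true_implies, not_lt]
  exact forall_congr' fun i => ⟨fun h => h.lt_of_ne (hne i).symm, le_of_lt⟩

/-- The time weight passes through the spatial divergence. For `k = 0` one has `ρ = √τ`, so the
model field has divergence `d / √τ`, and the factor `√τ` turns it into `d`. For `k ≥ 1`,
substituting `‖Pξ‖² = ρ² - τ` gives the divergence `-(k τ + d (k - 1) ρ²) / ρ³ ≤ 0`. The coefficient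
`d` of `Pξ` in the field is large enough to cancel the positive term `τ (d - k) / ρ³`, and no weight
is needed. -/
theorem exists_local_field (hd : 1 ≤ d) : ∃ (Y : SpaceTime d → Space d) (C : ℝ), 0 < C ∧
    (∀ z, z.2 ≠ tc → ContDiffAt ℝ ∞ Y z) ∧
    (∀ z, z.2 ≠ tc → ∑ i, spatialPartial i (fun z => Y z i) z ≤ C) ∧
    ∃ N ∈ 𝓝 ((xc, tc) : SpaceTime d), ∀ z ∈ N, z ∈ closedSlab d t₀ T → z.2 ≠ tc →
      (φ z ≤ 0 → ‖Y z‖ ≤ C) ∧ (φ z = 0 →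
        timeWeight φ xc tc z * ‖spatialGradient φ z‖ ≤ C * inner ℝ (Y z) (spatialGradient φ z)) := by
  obtain ⟨P, k, l, L, hP, hk, hP0⟩ := hφ.exists_hessian_splitting
  obtain ⟨ε, hε, C, hC, H⟩ := hP.localField_estimate hd hφ.time_derivative_ne
  refine ⟨fun z => timeWeight φ xc tc z • localField P (z.1 - xc) |z.2 - tc|, C + d, by positivity,
    fun z hz => (contDiffAt_timeWeight hz).smul (contDiffAt_localField P xc hz),
    fun z hz => ?_, ?_⟩
  · have hcomp : ∀ i, spatialPartial i
        (fun z => (timeWeight φ xc tc z • localField P (z.1 - xc) |z.2 - tc|) i) z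
        = timeWeight φ xc tc z * spatialPartial i (fun z => localField P (z.1 - xc) |z.2 - tc| i) z := by
      intro i
      have h := spatialPartial_mul (f := timeWeight φ xc tc)
        (g := fun z => localField P (z.1 - xc) |z.2 - tc| i) (z := z)
        ((contDiffAt_timeWeight hz).differentiableAt (by simp))
        ((EuclideanSpace.proj (𝕜 := ℝ) i).differentiableAt.comp z
          ((contDiffAt_localField P xc hz).differentiableAt (by simp))) i
      rw [spatialPartial_timeWeight hz] at h
      simpa using h
    rw [Finset.sum_congr rfl fun i _ => hcomp i, ← Finset.mul_sum,
      hP.sum_spatialPartial_localField xc hz]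
    have hτ0 : 0 < |z.2 - tc| := abs_pos.2 (sub_ne_zero.2 hz)
    set τ := |z.2 - tc| with hτ
    by_cases hk0 : k = 0
    · have hP00 := hP0 hk0
      have hs : localScale P (z.1 - xc) τ = √τ := by simp [localScale, hP00]
      have hw : timeWeight φ xc tc z = √τ := by rw [timeWeight, if_pos (hk.1 hk0)]
      rw [hs, hw, hk0, hP00]
      have hs0 : 0 < √τ := Real.sqrt_pos.2 hτ0
      have hsq : √τ ^ 2 = τ := Real.sq_sqrt hτ0.le
      have e : √τ * (τ * (d - ((0 : ℕ) : ℝ)) / √τ ^ 3 - d * ((0 : ℕ) : ℝ) / √τ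
          + d * ‖(0 : Space d →L[ℝ] Space d) (z.1 - xc)‖ ^ 2 / √τ ^ 3) = d := by
        simp
        nth_rewrite 2 [← hsq]
        field_simp
      rw [e]
      linarith
    · have hw : timeWeight φ xc tc z = 1 := by rw [timeWeight, if_neg (fun h => hk0 (hk.2 h))]
      rw [hw, one_mul]
      refine le_trans ?_ (by positivity : 0 ≤ C + d)
      have hρ0 := localScale_pos P (z.1 - xc) hτ0
      have hρ2 := localScale_sq P (z.1 - xc) hτ0.le
      set ρ := localScale P (z.1 - xc) τ
      have hk1 : (1 : ℝ) ≤ k := by exact_mod_cast Nat.one_le_iff_ne_zero.2 hk0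
      have e : τ * (d - k) / ρ ^ 3 - d * k / ρ + d * ‖P (z.1 - xc)‖ ^ 2 / ρ ^ 3
          = - (k * τ + d * (k - 1) * ρ ^ 2) / ρ ^ 3 := by
        rw [eq_sub_of_add_eq hρ2.symm]
        field_simp
        ring
      rw [e]
      refine div_nonpos_of_nonpos_of_nonneg ?_ (by positivity)
      have : 0 ≤ (k : ℝ) - 1 := by linarith
      have : 0 ≤ k * τ + d * ((k : ℝ) - 1) * ρ ^ 2 := by positivity
      linarith
  · have h1 := eventually_nhdsWithin_iff.1
      ((hφ.eventually_sub_le hε).and (hφ.eventually_spatialGradient_sub_le hε))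
    have h2 : ∀ᶠ z : SpaceTime d in 𝓝 (xc, tc), |z.2 - tc| < 1 := by
      have : Continuous fun z : SpaceTime d => |z.2 - tc| := by fun_prop
      exact this.continuousAt.eventually_lt_const (by simp)
    refine ⟨_, h1.and h2, fun z hz hzs hzt => ?_⟩
    obtain ⟨hz1, hz2⟩ := hz
    obtain ⟨hz3, hz4⟩ := hz1 hzs
    have hw0 := timeWeight_nonneg (φ := φ) (xc := xc) (tc := tc) z
    have hw1 := timeWeight_le (φ := φ) (xc := xc) le_rfl hz2.le
    refine ⟨fun h0 => ?_, fun h0 => ?_⟩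
    · have := (H _ _ _ _ (sub_ne_zero.2 hzt) hz3 hz4 h0).1
      rw [norm_smul, Real.norm_of_nonneg hw0]
      calc _ ≤ 1 * C := by gcongr
        _ ≤ C + d := by linarith [Nat.cast_nonneg (α := ℝ) d]
    · have := (H _ _ _ _ (sub_ne_zero.2 hzt) hz3 hz4 h0.le).2 h0
      rw [inner_smul_left, conj_trivial]
      have hX0 : 0 ≤ inner ℝ (localField P (z.1 - xc) |z.2 - tc|) (spatialGradient φ z) :=
        nonneg_of_mul_nonneg_right ((norm_nonneg _).trans this) hC
      calc _ ≤ timeWeight φ xc tc z *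
            (C * inner ℝ (localField P (z.1 - xc) |z.2 - tc|) (spatialGradient φ z)) := by gcongr
        _ = C * (timeWeight φ xc tc z *
            inner ℝ (localField P (z.1 - xc) |z.2 - tc|) (spatialGradient φ z)) := by ring
        _ ≤ _ := by gcongr; linarith [Nat.cast_nonneg (α := ℝ) d]

/-- The zero level and the closed domain stay in a compact set. -/
theorem exists_isCompact : ∃ R : ℝ, ∀ z ∈ closedSlab d t₀ T, φ z ≤ 0 → ‖z.1‖ ≤ R := by
  obtain ⟨R, hR⟩ := hφ.bounded
  refine ⟨max R ‖xc‖, fun z hz h0 => ?_⟩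
  rcases h0.lt_or_eq with h | h
  · exact (hR z.2 hz.2 z.1 h).trans (le_max_left _ _)
  by_cases hc : z = (xc, tc)
  · rw [hc]; exact le_max_right _ _
  refine le_trans ?_ (le_max_left _ _)
  have hg := hφ.isolated z.2 hz.2 z.1 h hc
  set g := spatialGradient φ z with hgdef
  have hg0 : 0 < ‖g‖ ^ 2 := by have := norm_pos_iff.2 hg; positivity
  have hline : HasDerivAt (fun r : ℝ => z.1 + r • g) g 0 := by
    simpa using ((hasDerivAt_id (0 : ℝ)).smul_const g).const_add z.1
  have hder := ((hφ.hasGradientAt_slice hz).hasFDerivAt.comp_hasDerivAt_of_eq (0 : ℝ) hline (by simp))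
  have hpos : 0 < (InnerProductSpace.toDual ℝ (Space d)) (spatialGradient φ z) g := by
    rw [InnerProductSpace.toDual_apply_apply, ← hgdef, real_inner_self_eq_norm_sq]
    exact hg0
  -- Moving against the gradient from a regular zero enters `Ω(t)`. The zero is thus a limit of
  -- points of the given ball.
  have hneg : ∀ᶠ r in 𝓝[<] (0 : ℝ), φ (z.1 + r • g, z.2) < 0 := by
    have h1 := hder.tendsto_slope_zero_left.eventually_const_lt hpos
    filter_upwards [h1, self_mem_nhdsWithin] with r hr hr0
    simp only [zero_add, Function.comp_apply, zero_smul, add_zero, Prod.mk.eta, h, sub_zero,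
      smul_eq_mul] at hr
    by_contra hcon
    push Not at hcon
    have : r⁻¹ * φ (z.1 + r • g, z.2) ≤ 0 :=
      mul_nonpos_of_nonpos_of_nonneg (inv_nonpos.2 (mem_Iio.1 hr0).le) hcon
    linarith
  have hev : ∀ᶠ r in 𝓝[<] (0 : ℝ), ‖z.1 + r • g‖ ≤ R := hneg.mono fun r hr => hR z.2 hz.2 _ hr
  have hlim : Tendsto (fun r : ℝ => ‖z.1 + r • g‖) (𝓝[<] 0) (𝓝 ‖z.1‖) := by
    have := hline.continuousAt.norm.tendsto.mono_left (nhdsWithin_le_nhds (s := Iio (0 : ℝ)))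
    simpa using this
  exact le_of_tendsto hlim hev

end IsAdmissible

end Field

/-! ### The global transversal field. -/

section GlobalField

open Filter Topology Metric

variable {d : ℕ} {t₀ T : ℝ} {φ : SpaceTime d → ℝ} {xc : Space d} {tc : ℝ}

theorem domain_subset_openSlab : domain t₀ T φ ⊆ openSlab d t₀ T := fun _ hz => ⟨trivial, hz.1⟩

theorem lateralBoundary_subset_openSlab : lateralBoundary t₀ T φ ⊆ openSlab d t₀ T :=
  fun _ hz => ⟨trivial, hz.1⟩

theorem openSlab_subset_closedSlab : openSlab d t₀ T ⊆ closedSlab d t₀ T :=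
  prod_mono subset_rfl Ioo_subset_Icc_self

theorem isCompact_closedBall_prod (R : ℝ) :
    IsCompact (closedBall (0 : Space d) R ×ˢ Icc t₀ T) :=
  (isCompact_closedBall _ _).prod isCompact_Icc

theorem abs_spatialPartial_le (f : SpaceTime d → ℝ) (z : SpaceTime d) (i : Fin d) :
    |spatialPartial i f z| ≤ ‖fderiv ℝ f z‖ := by
  have h := (fderiv ℝ f z).le_opNorm (EuclideanSpace.single i 1, 0)
  have h1 : ‖((EuclideanSpace.single i 1, 0) : SpaceTime d)‖ = 1 := by simp [Prod.norm_def]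
  rwa [h1, mul_one] at h

namespace IsAdmissible

variable (hφ : IsAdmissible t₀ T φ xc tc)
include hφ

theorem contDiffAt_spatialGradient {z : SpaceTime d} (hz : z ∈ openSlab d t₀ T) :
    ContDiffAt ℝ ∞ (spatialGradient φ) z :=
  hφ.contDiffOn_spatialGradient.contDiffAt
    (mem_of_superset (isOpen_openSlab.mem_nhds hz) openSlab_subset_closedSlab)

theorem exists_spatialGradient_bound (R : ℝ) : ∃ C : ℝ, 0 ≤ C ∧ ∀ z ∈ openSlab d t₀ T, ‖z.1‖ ≤ R →
    ‖spatialGradient φ z‖ ≤ C ∧ |∑ i, spatialPartial i (fun z => spatialGradient φ z i) z| ≤ C := by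
  have hK := isCompact_closedBall_prod (d := d) (t₀ := t₀) (T := T) R
  have hsub : closedBall (0 : Space d) R ×ˢ Icc t₀ T ⊆ closedSlab d t₀ T :=
    prod_mono (subset_univ _) subset_rfl
  obtain ⟨C₁, hC₁⟩ := hK.exists_bound_of_continuousOn (hφ.contDiffOn_spatialGradient.continuousOn.mono hsub)
  have hc : ContinuousOn (fun z => ∑ i, fderivWithin ℝ (spatialGradient φ) (closedSlab d t₀ T) z
      (EuclideanSpace.single i 1, 0) i) (closedSlab d t₀ T) := by
    refine continuousOn_finsetSum _ fun i _ => ?_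
    exact (EuclideanSpace.proj (𝕜 := ℝ) i).continuous.comp_continuousOn
      ((hφ.contDiffOn_spatialGradient.continuousOn_fderivWithin
        (uniqueDiffOn_closedSlab hφ.time_lt) (by simp)).clm_apply continuousOn_const)
  obtain ⟨C₂, hC₂⟩ := hK.exists_bound_of_continuousOn (hc.mono hsub)
  refine ⟨max (max C₁ C₂) 0, le_max_right _ _, fun z hz hzR => ?_⟩
  have hzK : z ∈ closedBall (0 : Space d) R ×ˢ Icc t₀ T :=
    ⟨by simpa using hzR, Ioo_subset_Icc_self hz.2⟩
  refine ⟨(hC₁ z hzK).trans ((le_max_left _ _).trans (le_max_left _ _)), ?_⟩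
  refine le_trans ?_ ((hC₂ z hzK).trans ((le_max_right _ _).trans (le_max_left _ _)))
  rw [Real.norm_eq_abs]
  refine le_of_eq (congrArg _ (Finset.sum_congr rfl fun i _ => ?_))
  have h1 := ((hφ.contDiffAt_spatialGradient hz).differentiableAt (by simp))
  have h2 := ((EuclideanSpace.proj (𝕜 := ℝ) i).hasFDerivAt.comp z h1.hasFDerivAt).fderiv
  rw [fderivWithin_of_mem_nhds (mem_of_superset (isOpen_openSlab.mem_nhds hz)
    openSlab_subset_closedSlab)]
  change fderiv ℝ (⇑(EuclideanSpace.proj (𝕜 := ℝ) i) ∘ spatialGradient φ) z _ = _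
  rw [h2]
  rfl

/-- Compactness of the zero level over the closed time interval. Removing the interior of `N`
removes the only zero of the gradient, and the end times are included in the hypothesis `isolated`.
-/
theorem exists_spatialGradient_lower_bound {N : Set (SpaceTime d)} (hN : N ∈ 𝓝 ((xc, tc) : SpaceTime d)) :
    ∃ c > 0, ∀ z ∈ lateralBoundary t₀ T φ, z ∉ N → c ≤ ‖spatialGradient φ z‖ := by
  obtain ⟨R, hR⟩ := hφ.exists_isCompact
  set K : Set (SpaceTime d) := ((closedBall (0 : Space d) R ×ˢ Icc t₀ T) ∩ φ ⁻¹' {0}) \ interior N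
    with hKdef
  have hsub : closedBall (0 : Space d) R ×ˢ Icc t₀ T ⊆ closedSlab d t₀ T :=
    prod_mono (subset_univ _) subset_rfl
  have hK : IsCompact K := by
    have h1 := (hφ.smooth.continuousOn.mono hsub).preimage_isClosed_of_isClosed
      (isCompact_closedBall_prod R).isClosed (isClosed_singleton (x := (0 : ℝ)))
    exact ((isCompact_closedBall_prod R).of_isClosed_subset h1 inter_subset_left).diff isOpen_interior
  have hcont : ContinuousOn (fun z => ‖spatialGradient φ z‖) K :=
    (hφ.contDiffOn_spatialGradient.continuousOn.mono fun z hz => hsub hz.1.1).norm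
  have hpos : ∀ z ∈ K, 0 < ‖spatialGradient φ z‖ := fun z hz => norm_pos_iff.2
    (hφ.isolated z.2 hz.1.1.2 z.1 hz.1.2 fun h => hz.2 (by
      rw [show z = (xc, tc) from h]; exact mem_interior_iff_mem_nhds.2 hN))
  have hmem : ∀ z ∈ lateralBoundary t₀ T φ, z ∉ N → z ∈ K := fun z hz hzN =>
    ⟨⟨⟨by simpa using hR z ⟨trivial, Ioo_subset_Icc_self hz.1⟩ hz.2.le, Ioo_subset_Icc_self hz.1⟩,
      hz.2⟩, fun h => hzN (interior_subset h)⟩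
  rcases K.eq_empty_or_nonempty with he | hne
  · exact ⟨1, one_pos, fun z hz hzN => by have := hmem z hz hzN; rw [he] at this; exact this.elim⟩
  · obtain ⟨z₀, hz₀, hmin⟩ := hK.exists_isMinOn hne hcont
    exact ⟨_, hpos z₀ hz₀, fun z hz hzN => hmin (hmem z hz hzN)⟩

/-- A bounded vector field with divergence bounded above which is transversal to the boundary. -/
theorem exists_transversal_field (hd : 1 ≤ d) : ∃ (X : SpaceTime d → Space d) (C : ℝ), 0 < C ∧
    (∀ z ∈ openSlab d t₀ T, z.2 ≠ tc → ContDiffAt ℝ ∞ X z) ∧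
    (∀ z ∈ domain t₀ T φ, z.2 ≠ tc →
      ‖X z‖ ≤ C ∧ ∑ i, spatialPartial i (fun z => X z i) z ≤ C) ∧
    (∀ z ∈ lateralBoundary t₀ T φ, z.2 ≠ tc →
      timeWeight φ xc tc z * ‖spatialGradient φ z‖ ≤ C * inner ℝ (X z) (spatialGradient φ z)) := by
  obtain ⟨Y, C₁, hC₁, hYs, hYd, N, hN, hY⟩ := hφ.exists_local_field hd
  obtain ⟨R, hR⟩ := hφ.exists_isCompact
  obtain ⟨C₂, hC₂, hgrad⟩ := hφ.exists_spatialGradient_bound R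
  obtain ⟨δ, hδ, hδN⟩ := Metric.mem_nhds_iff.1 hN
  let θ : ContDiffBump ((xc, tc) : SpaceTime d) :=
    { rIn := δ / 4, rOut := δ / 2, rIn_pos := by positivity, rIn_lt_rOut := by linarith }
  have hθN : tsupport θ ⊆ N := by
    rw [θ.tsupport_eq]
    exact (closedBall_subset_ball (by change δ / 2 < δ; linarith)).trans hδN
  have hθ1 : ContDiff ℝ ∞ θ := θ.contDiff
  have hθc : HasCompactSupport θ := θ.hasCompactSupport
  obtain ⟨c, hc, hlow⟩ := hφ.exists_spatialGradient_lower_bound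
    (closedBall_mem_nhds ((xc, tc) : SpaceTime d) θ.rIn_pos)
  obtain ⟨C₃, hC₃⟩ := (hθc.fderiv (𝕜 := ℝ)).exists_bound_of_continuous
    (hθ1.continuous_fderiv (by simp))
  have hC₃0 : 0 ≤ C₃ := (norm_nonneg _).trans (hC₃ 0)
  set B := max 1 (T - t₀) with hB
  have hw : ∀ z ∈ openSlab d t₀ T, timeWeight φ xc tc z ≤ B := fun z hz => by
    refine timeWeight_le (le_max_left _ _) ((abs_le.2 ?_).trans (le_max_right _ _))
    have h1 := hφ.time_mem
    have h2 := hz.2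
    constructor <;> linarith [h1.1, h1.2, h2.1, h2.2]
  have hB0 : 0 < B := lt_of_lt_of_le one_pos (le_max_left _ _)
  have hθz : ∀ z, θ z ≠ 0 → z ∈ N := fun z hz => hθN (subset_tsupport _ hz)
  have hθY : ∀ z ∈ openSlab d t₀ T, φ z ≤ 0 → z.2 ≠ tc → θ z * ‖Y z‖ ≤ C₁ := by
    intro z hz h0 hzt
    by_cases h : θ z = 0
    · rw [h, zero_mul]; exact hC₁.le
    · calc θ z * ‖Y z‖ ≤ 1 * C₁ := by
            gcongr
            · exact θ.le_one
            · exact (hY z (hθz z h) (openSlab_subset_closedSlab hz) hzt).1 h0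
        _ = C₁ := one_mul _
  -- On the boundary both summands have nonnegative product with `∇φ`. Where `θ = 1` the local field
  -- supplies the lower bound, with constant `C₁`; elsewhere `‖∇φ‖ ≥ c` does, with constant `B / c`,
  -- because `timeWeight ≤ B`. The remaining constants bound the field and its divergence; `d (C₃
  -- C₁)` comes from the gradient of `θ`.
  refine ⟨fun z => θ z • Y z + spatialGradient φ z,
    C₁ + B / c + (C₁ + C₂ + d * (C₃ * C₁)), by positivity, fun z hz hzt => ?_, fun z hz hzt => ?_,
    fun z hz hzt => ?_⟩
  · exact (hθ1.contDiffAt.smul (hYs z hzt)).add (hφ.contDiffAt_spatialGradient hz)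
  · have hzo := domain_subset_openSlab hz
    obtain ⟨hg1, hg2⟩ := hgrad z hzo (hR z (openSlab_subset_closedSlab hzo) hz.2.le)
    have hBc : 0 ≤ B / c := by positivity
    constructor
    · calc ‖θ z • Y z + spatialGradient φ z‖ ≤ θ z * ‖Y z‖ + ‖spatialGradient φ z‖ := by
            refine (norm_add_le _ _).trans ?_
            rw [norm_smul, Real.norm_of_nonneg θ.nonneg]
        _ ≤ C₁ + C₂ := add_le_add (hθY z hzo hz.2.le hzt) hg1
        _ ≤ _ := by
          have : 0 ≤ d * (C₃ * C₁) := by positivity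
          linarith
    · have hYd1 := (hYs z hzt).differentiableAt (by simp)
      have hYdi : ∀ i, DifferentiableAt ℝ (fun z => Y z i) z := fun i =>
        (EuclideanSpace.proj (𝕜 := ℝ) i).differentiableAt.comp z hYd1
      have hgd : ∀ i, DifferentiableAt ℝ (fun z => spatialGradient φ z i) z := fun i =>
        (EuclideanSpace.proj (𝕜 := ℝ) i).differentiableAt.comp z
          ((hφ.contDiffAt_spatialGradient hzo).differentiableAt (by simp))
      have hθd : DifferentiableAt ℝ θ z := hθ1.differentiable (by simp) z
      have hcomp : ∀ i, spatialPartial i (fun z => (θ z • Y z + spatialGradient φ z) i) z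
          = θ z * spatialPartial i (fun z => Y z i) z + spatialPartial i θ z * Y z i
            + spatialPartial i (fun z => spatialGradient φ z i) z := by
        intro i
        rw [← spatialPartial_mul hθd (hYdi i) i]
        change fderiv ℝ (fun z => (θ z * Y z i) + spatialGradient φ z i) z _ = _
        have hm : DifferentiableAt ℝ (fun z => θ z * Y z i) z := hθd.mul (hYdi i)
        rw [fderiv_fun_add hm (hgd i)]
        rfl
      rw [Finset.sum_congr rfl fun i _ => hcomp i, Finset.sum_add_distrib, Finset.sum_add_distrib,
        ← Finset.mul_sum]
      have h1 : θ z * ∑ i, spatialPartial i (fun z => Y z i) z ≤ C₁ := by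
        calc _ ≤ θ z * C₁ := by gcongr; exacts [θ.nonneg, hYd z hzt]
          _ ≤ 1 * C₁ := by gcongr; exact θ.le_one
          _ = _ := one_mul _
      have h2 : ∑ i, spatialPartial i θ z * Y z i ≤ d * (C₃ * C₁) := by
        have : ∀ i ∈ Finset.univ, spatialPartial i θ z * Y z i ≤ C₃ * C₁ := by
          intro i _
          by_cases hzN : z ∈ tsupport θ
          · refine (le_abs_self _).trans ?_
            rw [abs_mul]
            gcongr
            · exact (abs_spatialPartial_le _ _ _).trans (hC₃ z)
            · exact (PiLp.norm_apply_le (Y z) i).trans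
                ((hY z (hθN hzN) (openSlab_subset_closedSlab hzo) hzt).1 hz.2.le)
          · have : spatialPartial i θ z = 0 := by
              rw [spatialPartial, fderiv_eq_zero_of_notMem_tsupport hzN]; rfl
            rw [this, zero_mul]; positivity
        simpa using Finset.sum_le_card_nsmul _ _ _ this
      have h3 := (abs_le.1 hg2).2
      linarith
  · have hzo := lateralBoundary_subset_openSlab hz
    have hwz := hw z hzo
    have hw0 := timeWeight_nonneg (φ := φ) (xc := xc) (tc := tc) z
    rw [inner_add_left, inner_smul_left, conj_trivial, real_inner_self_eq_norm_sq]
    set g := spatialGradient φ z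
    have hYg : z ∈ N → 0 ≤ inner ℝ (Y z) g := fun h => nonneg_of_mul_nonneg_right
      ((mul_nonneg hw0 (norm_nonneg _)).trans
        ((hY z h (openSlab_subset_closedSlab hzo) hzt).2 hz.2)) hC₁
    have hθg : 0 ≤ θ z * inner ℝ (Y z) g := by
      by_cases h : θ z = 0
      · rw [h, zero_mul]
      · exact mul_nonneg θ.nonneg (hYg (hθz z h))
    have hrest : 0 ≤ C₁ + C₂ + d * (C₃ * C₁) := by positivity
    have hsum : 0 ≤ θ z * inner ℝ (Y z) g + ‖g‖ ^ 2 := by positivity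
    by_cases hzN : z ∈ closedBall ((xc, tc) : SpaceTime d) θ.rIn
    · have h1 : θ z = 1 := θ.one_of_mem_closedBall hzN
      have hzN' : z ∈ N := hθz z (by rw [h1]; exact one_ne_zero)
      have h2 := (hY z hzN' (openSlab_subset_closedSlab hzo) hzt).2 hz.2
      rw [h1, one_mul] at hsum ⊢
      have h3 := hYg hzN'
      calc _ ≤ C₁ * inner ℝ (Y z) g := h2
        _ ≤ C₁ * (inner ℝ (Y z) g + ‖g‖ ^ 2) := by gcongr; exact le_add_of_nonneg_right (by positivity)
        _ ≤ _ := by gcongr; have : 0 ≤ B / c := by positivity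
                    linarith
    · have h1 := hlow z hz hzN
      calc timeWeight φ xc tc z * ‖g‖ ≤ B * ‖g‖ := by gcongr
        _ = B / c * (c * ‖g‖) := by field_simp
        _ ≤ B / c * (θ z * inner ℝ (Y z) g + ‖g‖ ^ 2) := by
          gcongr
          rw [pow_two]
          exact (mul_le_mul_of_nonneg_right h1 (norm_nonneg _)).trans (le_add_of_nonneg_left hθg)
        _ ≤ _ := by gcongr; linarith

end IsAdmissible

end GlobalField

/-! ### The critical time slice of the boundary is a null set. -/

section TimeSlice

open Filter Topology Metric
open scoped Manifold

theorem exists_contDiff_cutoff {G : Type*} [NormedAddCommGroup G] [NormedSpace ℝ G]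
    [FiniteDimensional ℝ G] {K O : Set G} (hK : IsCompact K) (hO : IsOpen O) (hKO : K ⊆ O) :
    ∃ χ : G → ℝ, ContDiff ℝ ∞ χ ∧ HasCompactSupport χ ∧ tsupport χ ⊆ O ∧
      (∀ x, 0 ≤ χ x ∧ χ x ≤ 1) ∧ ∀ x ∈ K, χ =ᶠ[𝓝 x] fun _ => 1 := by
  obtain ⟨L, hL, hKL, hLO⟩ := exists_compact_between hK hO hKO
  obtain ⟨f, h1, h2, h3⟩ := exists_contMDiffMap_one_nhds_of_subset_interior (n := (⊤ : ℕ∞)) 𝓘(ℝ, G)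
    hK.isClosed hKL
  have hs : tsupport f ⊆ L := closure_minimal (fun x hx => by
    by_contra h; exact hx (h2 x h)) hL.isClosed
  exact ⟨f, f.contMDiff.contDiff, hL.of_isClosed_subset (isClosed_tsupport _) hs, hs.trans hLO,
    fun x => h3 x, fun x hx => h1.filter_mono (nhds_le_nhdsSet hx)⟩

variable {d : ℕ} {t₀ T : ℝ} {φ : SpaceTime d → ℝ} {xc : Space d} {tc : ℝ}

theorem surfaceMeasure_singleton (hd : 1 ≤ d) (z : SpaceTime d) : surfaceMeasure d {z} = 0 := by
  have hd' : (0 : ℝ) < d := by exact_mod_cast hd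
  have := Measure.nullSingletonClass_hausdorff (WithLp 2 (SpaceTime d)) hd'
  have hs : (WithLp.ofLp ⁻¹' {z} : Set (WithLp 2 (SpaceTime d))).Subsingleton :=
    subsingleton_singleton.preimage (WithLp.ofLp_injective 2)
  rw [surfaceMeasure_apply, Measure.euclideanHausdorffMeasure_def, Measure.smul_apply,
    hs.measure_zero, smul_zero]

theorem volume_timeSlice (t : ℝ) : volume {z : SpaceTime d | z.2 = t} = 0 := by
  have e : {z : SpaceTime d | z.2 = t} = univ ×ˢ {t} := by ext; simp
  rw [e, Measure.volume_eq_prod, Measure.prod_prod]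
  simp

theorem contDiff_of_time {h : ℝ → ℝ} {n : ℕ∞ω} (hh : ContDiff ℝ n h) :
    ContDiff ℝ n fun z : SpaceTime d => h z.2 := hh.comp contDiff_snd

theorem spatialPartial_time_mul {h : ℝ → ℝ} (hh : ContDiff ℝ 1 h) {g : SpaceTime d → ℝ}
    {z : SpaceTime d} (hg : DifferentiableAt ℝ g z) (i : Fin d) :
    spatialPartial i (fun z => h z.2 * g z) z = h z.2 * spatialPartial i g z := by
  have h1 : DifferentiableAt ℝ (fun z : SpaceTime d => h z.2) z :=
    (contDiff_of_time hh).differentiable (by simp) z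
  rw [spatialPartial_mul h1 hg i, spatialPartial_eq_zero_of_time (fun _ _ _ => rfl) h1 i]
  ring

namespace IsAdmissible

variable (hφ : IsAdmissible t₀ T φ xc tc)
include hφ

theorem fullGradientNorm_pos {z : SpaceTime d} (hz : z ∈ lateralBoundary t₀ T φ)
    (hzc : z ≠ (xc, tc)) : 0 < fullGradientNorm φ z := by
  have := norm_pos_iff.2 (hφ.spatialGradient_ne_zero hz hzc)
  exact Real.sqrt_pos.2 (by positivity)

theorem inner_spatialGradient_eq {z : SpaceTime d} (hz : z ∈ openSlab d t₀ T) (X : Space d) :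
    inner ℝ X (spatialGradient φ z) = ∑ i, X i * spatialPartial i φ z := by
  rw [PiLp.inner_apply]
  refine Finset.sum_congr rfl fun i _ => ?_
  rw [spatialGradient_apply (hφ.differentiableAt hz)]
  simp [mul_comm]

/-- The flux inequality is applied to `h_n(t) θ ∇φ` with bumps `h_n` shrinking to the critical time.
Since `h_n` depends on time only, the divergence is `h_n div(θ ∇φ)`, whose integral tends to zero.
The flux through the slice does not depend on `n`, so it vanishes; its density is positive where `θ
= 1`. -/
theorem local_surfaceMeasure_timeSlice {z₀ : SpaceTime d} (hz₀ : z₀ ∈ openSlab d t₀ T)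
    (hzc : z₀ ≠ (xc, tc)) : ∃ N ∈ 𝓝 z₀,
      surfaceMeasure d (lateralBoundary t₀ T φ ∩ {z | z.2 = tc} ∩ N) = 0 := by
  have hO : IsOpen (openSlab d t₀ T \ {(xc, tc)}) := isOpen_openSlab.sdiff isClosed_singleton
  obtain ⟨θ, hθ, hθc, hθs, hθ0, hθ1⟩ := exists_contDiff_cutoff (isCompact_singleton (x := z₀)) hO
    (singleton_subset_iff.2 ⟨hz₀, hzc⟩)
  refine ⟨_, hθ1 z₀ rfl, ?_⟩
  set Z : Fin d → SpaceTime d → ℝ := fun i z => θ z * spatialGradient φ z i with hZdef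
  have hZt : ∀ i, tsupport (Z i) ⊆ tsupport θ := fun i => tsupport_mul_subset_left
  have hZc : ∀ i, HasCompactSupport (Z i) := fun i => hθc.mul_right
  have hZ : ∀ i, ContDiff ℝ 1 (Z i) := fun i => contDiff_of_tsupport' fun z hz =>
    (hθ.contDiffAt.mul ((EuclideanSpace.proj (𝕜 := ℝ) i).contDiff.contDiffAt.comp z
      (hφ.contDiffAt_spatialGradient (hθs (hZt i hz)).1))).of_le (by simp)
  set G : SpaceTime d → ℝ := fun z => ∑ i, spatialPartial i (Z i) z with hG
  have hGint : Integrable G := integrable_finsetSum _ fun i _ =>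
    (((hZ i).continuous_fderiv (by simp)).clm_apply continuous_const).integrable_of_hasCompactSupport
      ((hZc i).fderiv_apply (𝕜 := ℝ) _)
  let h : ℕ → ContDiffBump tc := fun n =>
    { rIn := 1 / ((n : ℝ) + 1), rOut := 2 / ((n : ℝ) + 1), rIn_pos := by positivity,
      rIn_lt_rOut := by gcongr; norm_num }
  have hflux : ∀ z ∈ openSlab d t₀ T,
      ∑ i, Z i z * spatialPartial i φ z = θ z * ‖spatialGradient φ z‖ ^ 2 := fun z hz => by
    rw [← real_inner_self_eq_norm_sq, hφ.inner_spatialGradient_eq hz, Finset.mul_sum]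
    exact Finset.sum_congr rfl fun i _ => by simp only [hZdef]; ring
  have key : ∀ n, ∫⁻ z in lateralBoundary t₀ T φ ∩ {z | z.2 = tc}, ENNReal.ofReal (fluxDensity φ Z z)
      ∂(surfaceMeasure d) ≤ 2 ^ d * ENNReal.ofReal (∫ z in domain t₀ T φ, h n z.2 * G z) := by
    intro n
    have hXt : ∀ i, tsupport (fun z : SpaceTime d => h n z.2 * Z i z) ⊆ tsupport θ := fun i =>
      (tsupport_mul_subset_right (f := fun z : SpaceTime d => h n z.2) (g := Z i)).trans (hZt i)
    have hb := hφ.lintegral_flux_le (X := fun i z => h n z.2 * Z i z)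
      (fun i => (contDiff_of_time (h n).contDiff).mul (hZ i))
      (fun i => (hZc i).mul_left)
      (fun i z hz => (hθs (hXt i hz)).1) (fun i hz => (hθs (hXt i hz)).2 rfl)
      (fun z hz => by
        have e : ∑ i, h n z.2 * Z i z * spatialPartial i φ z
            = h n z.2 * ∑ i, Z i z * spatialPartial i φ z := by
          rw [Finset.mul_sum]; exact Finset.sum_congr rfl fun i _ => by ring
        rw [e, hflux z (lateralBoundary_subset_openSlab hz)]
        exact mul_nonneg (h n).nonneg (mul_nonneg (hθ0 z).1 (by positivity)))
    have e2 : ∀ z, ∑ i, spatialPartial i (fun z => h n z.2 * Z i z) z = h n z.2 * G z := fun z => by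
      rw [hG, Finset.mul_sum]
      exact Finset.sum_congr rfl fun i _ => spatialPartial_time_mul (h n).contDiff
        ((hZ i).differentiable (by simp) z) i
    simp only [e2] at hb
    refine le_trans ?_ hb
    refine le_trans (le_of_eq ?_) (lintegral_mono_set (s := lateralBoundary t₀ T φ ∩ {z | z.2 = tc}) inter_subset_left)
    refine setLIntegral_congr_fun (hφ.measurableSet_lateralBoundary.inter
      (measurable_snd (measurableSet_singleton tc))) fun z hz => ?_
    have : h n z.2 = 1 := by
      rw [show z.2 = tc from hz.2]
      exact (h n).one_of_mem_closedBall (mem_closedBall_self (h n).rIn_pos.le)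
    simp only [fluxDensity, this, one_mul]
  have hlim : Tendsto (fun n => ∫ z in domain t₀ T φ, h n z.2 * G z) atTop (𝓝 0) := by
    have := tendsto_integral_of_dominated_convergence (μ := volume.restrict (domain t₀ T φ))
      (F := fun n z => h n z.2 * G z) (f := fun _ => 0) (fun z => ‖G z‖)
      (fun n => ((contDiff_of_time ((h n).contDiff (n := 1))).continuous.aestronglyMeasurable).mul
        hGint.aestronglyMeasurable.restrict) hGint.norm.restrict
      (fun n => Eventually.of_forall fun z => by
        rw [norm_mul, Real.norm_of_nonneg (h n).nonneg]
        exact mul_le_of_le_one_left (norm_nonneg _) (h n).le_one)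
      (ae_restrict_of_ae (by
        filter_upwards [measure_eq_zero_iff_ae_notMem.1 (volume_timeSlice (d := d) tc)] with z hz
        have hz' : 0 < dist z.2 tc := dist_pos.2 hz
        refine tendsto_const_nhds.congr' ?_
        have h2 : Tendsto (fun n : ℕ => 2 / ((n : ℝ) + 1)) atTop (𝓝 0) := by
          simpa [div_eq_mul_inv] using
            (tendsto_one_div_add_atTop_nhds_zero_nat (𝕜 := ℝ)).const_mul (2 : ℝ)
        filter_upwards [h2.eventually_le_const hz'] with n hn
        rw [(h n).zero_of_le_dist hn, zero_mul]))
    simpa using this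
  have hlim2 : Tendsto (fun n => 2 ^ d * ENNReal.ofReal (∫ z in domain t₀ T φ, h n z.2 * G z))
      atTop (𝓝 0) := by
    have := ENNReal.Tendsto.const_mul (a := (2 : ℝ≥0∞) ^ d) (ENNReal.tendsto_ofReal hlim)
      (Or.inr (by simp))
    simpa using this
  have hzero := le_antisymm (ge_of_tendsto' hlim2 key) (by positivity)
  rw [lintegral_eq_zero_iff (hφ.measurable_fluxDensity hZ fun i z hz => (hθs (hZt i hz)).1).ennreal_ofReal]
    at hzero
  have hms : MeasurableSet (lateralBoundary t₀ T φ ∩ {z : SpaceTime d | z.2 = tc}) :=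
    hφ.measurableSet_lateralBoundary.inter (measurable_snd (measurableSet_singleton tc))
  rw [Filter.EventuallyEq, ae_restrict_iff' hms] at hzero
  refine measure_mono_null (fun z hz => ?_) hzero
  intro hcon
  have hz1 := hcon hz.1
  have hθz : θ z = 1 := hz.2
  have hzc' : z ≠ (xc, tc) := (hθs (subset_tsupport _ (by rw [Function.mem_support, hθz]; exact one_ne_zero))).2
  have hpos : 0 < fluxDensity φ Z z := by
    rw [fluxDensity, hflux z (lateralBoundary_subset_openSlab hz.1.1), hθz, one_mul]
    have := norm_pos_iff.2 (hφ.spatialGradient_ne_zero hz.1.1 hzc')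
    exact div_pos (by positivity) (hφ.fullGradientNorm_pos hz.1.1 hzc')
  have : ENNReal.ofReal (fluxDensity φ Z z) = 0 := hz1
  rw [ENNReal.ofReal_eq_zero] at this
  linarith

theorem surfaceMeasure_timeSlice (hd : 1 ≤ d) :
    surfaceMeasure d (lateralBoundary t₀ T φ ∩ {z | z.2 = tc}) = 0 := by
  have h1 : surfaceMeasure d ((lateralBoundary t₀ T φ ∩ {z | z.2 = tc}) \ {(xc, tc)}) = 0 := by
    refine measure_null_of_locally_null _ fun z hz => ?_
    obtain ⟨N, hN, h0⟩ := hφ.local_surfaceMeasure_timeSlice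
      (lateralBoundary_subset_openSlab hz.1.1) hz.2
    refine ⟨_, inter_mem_nhdsWithin _ hN, measure_mono_null ?_ h0⟩
    exact inter_subset_inter_left _ sdiff_subset
  refine measure_mono_null (t := ((lateralBoundary t₀ T φ ∩ {z | z.2 = tc}) \ {(xc, tc)})
    ∪ {(xc, tc)}) ?_ (measure_union_null h1 (surfaceMeasure_singleton hd _))
  rw [sdiff_union_self]
  exact subset_union_left

end IsAdmissible

end TimeSlice

/-! ### The trace inequality for smooth functions. -/

section TraceInequality

open Filter Topology Metric

variable {d : ℕ} {t₀ T : ℝ} {φ : SpaceTime d → ℝ} {xc : Space d} {tc : ℝ}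

namespace IsAdmissible

variable (hφ : IsAdmissible t₀ T φ xc tc)
include hφ

theorem exists_compact_superset : ∃ K : Set (SpaceTime d), IsCompact K ∧ domain t₀ T φ ⊆ K ∧
    lateralBoundary t₀ T φ ⊆ K := by
  obtain ⟨R, hR⟩ := hφ.exists_isCompact
  refine ⟨_, isCompact_closedBall_prod (t₀ := t₀) (T := T) R, fun z hz => ?_, fun z hz => ?_⟩
  · exact ⟨by simpa using hR z ⟨trivial, Ioo_subset_Icc_self hz.1⟩ hz.2.le, Ioo_subset_Icc_self hz.1⟩
  · exact ⟨by simpa using hR z ⟨trivial, Ioo_subset_Icc_self hz.1⟩ hz.2.le, Ioo_subset_Icc_self hz.1⟩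

theorem integrable_restrict_domain {F : Type*} [NormedAddCommGroup F] {f : SpaceTime d → F}
    (hf : Continuous f) : Integrable f (volume.restrict (domain t₀ T φ)) := by
  obtain ⟨K, hK, hKd, _⟩ := hφ.exists_compact_superset
  exact (hf.continuousOn.integrableOn_compact hK).mono_set hKd

omit hφ in
theorem continuous_spatialGradient {v : SpaceTime d → ℝ} (hv : ContDiff ℝ 1 v) :
    Continuous (spatialGradient v) := by
  have h : Continuous fun z => WithLp.toLp 2 fun i => spatialPartial i v z :=
    (PiLp.continuous_toLp 2 _).comp (continuous_pi fun i =>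
      (hv.continuous_fderiv (by simp)).clm_apply continuous_const)
  convert h using 1
  ext z i
  exact spatialGradient_apply (hv.differentiable (by simp) z) i

/-- The flux inequality is applied to `χ(t) v² X` with the transversal field `X`. The cutoff `χ`
avoids the critical and end times, where `X` need not be smooth, and is not differentiated by the
spatial divergence. Hence the constant is independent of `K`, and `K` can be exhausted afterwards.
-/
theorem lintegral_time_restrict_le (hd : 1 ≤ d) : ∃ C : ℝ, 0 < C ∧ ∀ v : SpaceTime d → ℝ,
    ContDiff ℝ ∞ v → ∀ K : Set ℝ, IsCompact K → K ⊆ Ioo t₀ T \ {tc} →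
      ∫⁻ z in lateralBoundary t₀ T φ ∩ {z | z.2 ∈ K},
        ENNReal.ofReal (weight t₀ T φ xc tc z) * ‖v z‖ₑ ^ 2 ∂(surfaceMeasure d)
        ≤ ENNReal.ofReal C * ∫⁻ z in domain t₀ T φ, (‖v z‖ₑ ^ 2 + ‖spatialGradient v z‖ₑ ^ 2) := by
  obtain ⟨X, C, hC, hXs, hXd, hXΓ⟩ := hφ.exists_transversal_field hd
  obtain ⟨K₀, hK₀, hK₀d, hK₀Γ⟩ := hφ.exists_compact_superset
  obtain ⟨η, hη, hηc, -, hη0, hη1⟩ := exists_contDiff_cutoff hK₀ isOpen_univ (subset_univ _)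
  -- `C` from transversality, `2 ^ d` from the flux inequality, `2 C` from `v² div X + 2 v X·∇v ≤ 2
  -- C (v² + |∇v|²)`.
  refine ⟨C * (2 ^ d * (2 * C)), by positivity, fun v hv K hK hKt => ?_⟩
  obtain ⟨χ, hχ, hχc, hχs, hχ0, hχ1⟩ := exists_contDiff_cutoff hK
    (isOpen_Ioo.sdiff isClosed_singleton) hKt
  -- The cutoff `η` provides compact support and equals `1` near the domain and its boundary, where
  -- `w` is just `v²`.
  set w : SpaceTime d → ℝ := fun z => η z * v z ^ 2 with hw
  have hws : ContDiff ℝ ∞ w := hη.mul (hv.pow 2)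
  have hwc : HasCompactSupport w := hηc.mul_right
  set F : Fin d → SpaceTime d → ℝ := fun i z => χ z.2 * (w z * X z i) with hF
  have hFt : ∀ i, ∀ z ∈ tsupport (F i), z ∈ openSlab d t₀ T ∧ z.2 ≠ tc := fun i z hz => by
    have h1 : tsupport (F i) ⊆ tsupport (χ ∘ (Prod.snd : SpaceTime d → ℝ)) :=
      tsupport_mul_subset_left
    have h2 := hχs (tsupport_comp_subset_preimage χ continuous_snd (h1 hz))
    exact ⟨⟨trivial, h2.1⟩, h2.2⟩
  have hXi : ∀ i, ∀ z ∈ openSlab d t₀ T, z.2 ≠ tc → ContDiffAt ℝ ∞ (fun z => X z i) z :=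
    fun i z hz hzt => (EuclideanSpace.proj (𝕜 := ℝ) i).contDiff.contDiffAt.comp z (hXs z hz hzt)
  have hFs : ∀ i, ContDiff ℝ 1 (F i) := fun i => contDiff_of_tsupport' fun z hz =>
    (((contDiff_of_time hχ).contDiffAt.mul (hws.contDiffAt.mul
      (hXi i z (hFt i z hz).1 (hFt i z hz).2)))).of_le (by simp)
  have hFc : ∀ i, HasCompactSupport (F i) := fun i => (hwc.mul_right).mul_left
  have hFφ : ∀ z ∈ openSlab d t₀ T,
      ∑ i, F i z * spatialPartial i φ z = χ z.2 * (w z * inner ℝ (X z) (spatialGradient φ z)) := by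
    intro z hz
    rw [hφ.inner_spatialGradient_eq hz, Finset.mul_sum, Finset.mul_sum]
    exact Finset.sum_congr rfl fun i _ => by simp only [hF]; ring
  have hw0 : ∀ z, 0 ≤ w z := fun z => mul_nonneg (hη0 z).1 (by positivity)
  have hXn : ∀ z ∈ lateralBoundary t₀ T φ, z.2 ≠ tc → 0 ≤ inner ℝ (X z) (spatialGradient φ z) :=
    fun z hz hzt => nonneg_of_mul_nonneg_right
      ((mul_nonneg (timeWeight_nonneg z) (norm_nonneg _)).trans (hXΓ z hz hzt)) hC
  have hχz : ∀ t, χ t ≠ 0 → t ≠ tc := fun t ht => (hχs (subset_tsupport _ ht)).2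
  have hb := hφ.lintegral_flux_le hFs hFc (fun i z hz => (hFt i z hz).1)
    (fun i hz => (hFt i _ hz).2 rfl) (fun z hz => by
      rw [hFφ z (lateralBoundary_subset_openSlab hz)]
      by_cases h : χ z.2 = 0
      · rw [h, zero_mul]
      · exact mul_nonneg (hχ0 _).1 (mul_nonneg (hw0 z) (hXn z hz (hχz _ h))))
  have hleft : ∫⁻ z in lateralBoundary t₀ T φ ∩ {z | z.2 ∈ K},
      ENNReal.ofReal (weight t₀ T φ xc tc z) * ‖v z‖ₑ ^ 2 ∂(surfaceMeasure d)
      ≤ ENNReal.ofReal C * ∫⁻ z in lateralBoundary t₀ T φ, ENNReal.ofReal (fluxDensity φ F z)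
        ∂(surfaceMeasure d) := by
    rw [← lintegral_const_mul' _ _ ENNReal.ofReal_ne_top]
    refine le_trans ?_ (lintegral_mono_set
      (s := lateralBoundary t₀ T φ ∩ {z | z.2 ∈ K}) inter_subset_left)
    refine setLIntegral_mono' (hφ.measurableSet_lateralBoundary.inter
      (measurable_snd hK.measurableSet)) fun z hz => ?_
    have hzt : z.2 ≠ tc := (hKt hz.2).2
    have hzc : z ≠ (xc, tc) := fun h => hzt (by rw [h])
    have hwz : w z = v z ^ 2 := by
      rw [hw]; simp only; rw [(hη1 z (hK₀Γ hz.1)).eq_of_nhds, one_mul]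
    have hq := hφ.fullGradientNorm_pos hz.1 hzc
    have e : ‖v z‖ₑ ^ 2 = ENNReal.ofReal (v z ^ 2) := by
      rw [← Real.enorm_eq_ofReal (sq_nonneg _), enorm_pow]
    rw [e, ← ENNReal.ofReal_mul (weight_nonneg z), ← ENNReal.ofReal_mul hC.le]
    refine ENNReal.ofReal_le_ofReal ?_
    rw [fluxDensity, hFφ z (lateralBoundary_subset_openSlab hz.1), hwz, (hχ1 _ hz.2).eq_of_nhds,
      one_mul, hφ.weight_eq hz.1 hzc, div_mul_eq_mul_div, ← mul_div_assoc]
    refine div_le_div_of_nonneg_right ?_ hq.le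
    calc _ ≤ (C * inner ℝ (X z) (spatialGradient φ z)) * v z ^ 2 :=
          mul_le_mul_of_nonneg_right (hXΓ z hz.1 hzt) (sq_nonneg _)
      _ = _ := by ring
  have hright : ENNReal.ofReal (∫ z in domain t₀ T φ, ∑ i, spatialPartial i (F i) z)
      ≤ ENNReal.ofReal (2 * C) *
        ∫⁻ z in domain t₀ T φ, (‖v z‖ₑ ^ 2 + ‖spatialGradient v z‖ₑ ^ 2) := by
    have hgc : Continuous fun z => 2 * C * (v z ^ 2 + ‖spatialGradient v z‖ ^ 2) :=
      continuous_const.mul ((hv.continuous.pow 2).add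
        ((continuous_spatialGradient (hv.of_le (by simp))).norm.pow 2))
    have hgi := hφ.integrable_restrict_domain hgc
    have hfi : Integrable (fun z => ∑ i, spatialPartial i (F i) z)
        (volume.restrict (domain t₀ T φ)) := hφ.integrable_restrict_domain
      (continuous_finsetSum _ fun i _ => ((hFs i).continuous_fderiv (by simp)).clm_apply
        continuous_const)
    have hmono : ∫ z in domain t₀ T φ, ∑ i, spatialPartial i (F i) z
        ≤ ∫ z in domain t₀ T φ, 2 * C * (v z ^ 2 + ‖spatialGradient v z‖ ^ 2) := by
      refine setIntegral_mono_on hfi hgi hφ.isOpen_domain.measurableSet fun z hz => ?_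
      have hzo := domain_subset_openSlab hz
      by_cases hzt : z.2 = tc
      · have : ∀ i, spatialPartial i (F i) z = 0 := fun i => by
          rw [spatialPartial, fderiv_eq_zero_of_notMem_tsupport fun h => (hFt i z h).2 hzt]
          rfl
        simp only [this, Finset.sum_const_zero]
        positivity
      · obtain ⟨hX1, hX2⟩ := hXd z hz hzt
        have hwev : w =ᶠ[𝓝 z] fun z => v z * v z := by
          filter_upwards [hη1 z (hK₀d hz)] with y hy
          simp only [hw]
          rw [hy, one_mul, pow_two]
        have hvd := hv.differentiable (by simp) z
        have hpw : ∀ i, spatialPartial i w z = 2 * v z * spatialPartial i v z := fun i => by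
          have := spatialPartial_mul hvd hvd i
          rw [spatialPartial, hwev.fderiv_eq]
          exact this.trans (by ring)
        have hcomp : ∀ i, spatialPartial i (F i) z
            = χ z.2 * (v z ^ 2 * spatialPartial i (fun z => X z i) z
              + 2 * v z * (X z i * spatialPartial i v z)) := fun i => by
          have hXdi := (hXi i z hzo hzt).differentiableAt (by simp)
          have hwd := hws.differentiable (by simp) z
          have h1 := spatialPartial_time_mul (h := χ) (hχ.of_le (by simp))
            (g := fun z => w z * X z i) (hwd.mul hXdi) i
          refine h1.trans ?_
          rw [spatialPartial_mul hwd hXdi i, hpw, hwev.eq_of_nhds]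
          ring
        rw [Finset.sum_congr rfl fun i _ => hcomp i, ← Finset.mul_sum, Finset.sum_add_distrib,
          ← Finset.mul_sum, ← Finset.mul_sum]
        have hin : ∑ i, X z i * spatialPartial i v z = inner ℝ (X z) (spatialGradient v z) := by
          rw [PiLp.inner_apply]
          refine Finset.sum_congr rfl fun i _ => ?_
          rw [spatialGradient_apply hvd]
          simp [mul_comm]
        rw [hin]
        have h2 : |inner ℝ (X z) (spatialGradient v z)| ≤ C * ‖spatialGradient v z‖ :=
          (abs_real_inner_le_norm _ _).trans (by gcongr)
        have h3 : v z * inner ℝ (X z) (spatialGradient v z) ≤ |v z| * (C * ‖spatialGradient v z‖) := by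
          refine (le_abs_self _).trans ?_
          rw [abs_mul]
          gcongr
        have h4 : v z ^ 2 * ∑ i, spatialPartial i (fun z => X z i) z ≤ v z ^ 2 * C := by gcongr
        have h5 : |v z| * ‖spatialGradient v z‖ * 2 ≤ v z ^ 2 + ‖spatialGradient v z‖ ^ 2 := by
          have := two_mul_le_add_sq |v z| ‖spatialGradient v z‖
          rw [sq_abs] at this
          linarith
        have h6 := mul_le_mul_of_nonneg_left h5 hC.le
        have h7 : 0 ≤ C * ‖spatialGradient v z‖ ^ 2 := by positivity
        have h8 : v z ^ 2 * ∑ i, spatialPartial i (fun z => X z i) z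
            + 2 * v z * inner ℝ (X z) (spatialGradient v z)
            ≤ 2 * C * (v z ^ 2 + ‖spatialGradient v z‖ ^ 2) := by linarith
        calc _ ≤ χ z.2 * (2 * C * (v z ^ 2 + ‖spatialGradient v z‖ ^ 2)) := by
              gcongr; exact (hχ0 _).1
          _ ≤ 1 * (2 * C * (v z ^ 2 + ‖spatialGradient v z‖ ^ 2)) := by
              gcongr; exact (hχ0 _).2
          _ = _ := one_mul _
    refine (ENNReal.ofReal_le_ofReal hmono).trans ?_
    rw [ofReal_integral_eq_lintegral_ofReal hgi (Eventually.of_forall fun z => by positivity),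
      ← lintegral_const_mul' _ _ ENNReal.ofReal_ne_top]
    refine le_of_eq (lintegral_congr fun z => ?_)
    rw [ENNReal.ofReal_mul (by positivity), ENNReal.ofReal_add (by positivity) (by positivity),
      ← Real.enorm_eq_ofReal (sq_nonneg (v z)), enorm_pow, ENNReal.ofReal_pow (norm_nonneg _),
      ofReal_norm]
  calc _ ≤ ENNReal.ofReal C * (2 ^ d * (ENNReal.ofReal (2 * C) *
        ∫⁻ z in domain t₀ T φ, (‖v z‖ₑ ^ 2 + ‖spatialGradient v z‖ₑ ^ 2))) :=
        hleft.trans (by gcongr; exact hb.trans (by gcongr))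
    _ = _ := by
      rw [ENNReal.ofReal_mul hC.le, ENNReal.ofReal_mul (by positivity : (0 : ℝ) ≤ 2 ^ d),
        ENNReal.ofReal_pow (by norm_num)]
      simp [mul_assoc]

/-- The trace inequality for smooth functions. -/
theorem exists_trace_bound (hd : 1 ≤ d) : ∃ C : ℝ, 0 < C ∧ ∀ v : SpaceTime d → ℝ,
    ContDiff ℝ ∞ v → ∫⁻ z, ‖v z‖ₑ ^ 2 ∂(weightedSurfaceMeasure t₀ T φ xc tc)
      ≤ ENNReal.ofReal C * ∫⁻ z in domain t₀ T φ, (‖v z‖ₑ ^ 2 + ‖spatialGradient v z‖ₑ ^ 2) := by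
  obtain ⟨C, hC, H⟩ := hφ.lintegral_time_restrict_le hd
  refine ⟨C, hC, fun v hv => ?_⟩
  have hO : IsOpen (Ioo t₀ T \ {tc}) := isOpen_Ioo.sdiff isClosed_singleton
  obtain ⟨F, hFc, hFs, hFU, hFm⟩ := hO.exists_iUnion_isClosed
  rw [hφ.lintegral_weightedSurfaceMeasure (hv.continuous.measurable.enorm.pow_const 2)]
  -- The compact time sets exhaust everything except the critical slice, which is null; monotone
  -- convergence then removes the time cutoff.
  have hae : lateralBoundary t₀ T φ =ᵐ[surfaceMeasure d]
      ⋃ n, lateralBoundary t₀ T φ ∩ {z | z.2 ∈ F n} := by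
    have hsub : (⋃ n, lateralBoundary t₀ T φ ∩ {z | z.2 ∈ F n}) ⊆ lateralBoundary t₀ T φ :=
      iUnion_subset fun n => inter_subset_left
    have h2 : surfaceMeasure d ((⋃ n, lateralBoundary t₀ T φ ∩ {z | z.2 ∈ F n}) \
        lateralBoundary t₀ T φ) = 0 := by rw [sdiff_eq_empty.2 hsub, measure_empty]
    refine ae_eq_set.2 ⟨measure_mono_null (fun z hz => ?_) (hφ.surfaceMeasure_timeSlice hd), h2⟩
    refine ⟨hz.1, ?_⟩
    by_contra hzt
    have hzO : z.2 ∈ ⋃ n, F n := by rw [hFU]; exact ⟨hz.1.1, hzt⟩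
    obtain ⟨n, hn⟩ := mem_iUnion.1 hzO
    exact hz.2 (mem_iUnion.2 ⟨n, hz.1, hn⟩)
  have hm : Monotone fun n => lateralBoundary t₀ T φ ∩ {z : SpaceTime d | z.2 ∈ F n} :=
    fun m n hmn => inter_subset_inter_right _ fun z hz => hFm hmn hz
  rw [setLIntegral_congr hae, setLIntegral_iUnion_of_directed _ hm.directed_le]
  exact iSup_le fun n => H v hv (F n) (isCompact_Icc.of_isClosed_subset (hFc n)
    ((hFs n).trans (sdiff_subset.trans Ioo_subset_Icc_self))) (hFs n)

end IsAdmissible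

end TraceInequality

/-! ### Functional analysis of `H`: uniqueness of the gradient, products with cutoffs. -/

section AnisotropicSpace

open Filter Topology Metric

variable {d : ℕ} {U V : Set (SpaceTime d)}

theorem IsWeakSpatialGradient.congr {u u' : SpaceTime d → ℝ} {p p' : SpaceTime d → Space d}
    (h : IsWeakSpatialGradient U u p) (hu : u =ᵐ[volume.restrict U] u')
    (hp : p =ᵐ[volume.restrict U] p') : IsWeakSpatialGradient U u' p' := by
  intro ψ hψ i
  have h1 : ∫ z in U, u' z * spatialPartial i ψ z = ∫ z in U, u z * spatialPartial i ψ z :=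
    integral_congr_ae (by filter_upwards [hu] with z hz; rw [hz])
  have h2 : ∫ z in U, p' z i * ψ z = ∫ z in U, p z i * ψ z :=
    integral_congr_ae (by filter_upwards [hp] with z hz; rw [hz])
  rw [h1, h2, h ψ hψ i]

/-- The element of `H` given by a function and its weak gradient. -/
def anisotropicSpace.mk {f : SpaceTime d → ℝ} {p : SpaceTime d → Space d}
    (hf : MemLp f 2 (volume.restrict U)) (hp : MemLp p 2 (volume.restrict U))
    (h : IsWeakSpatialGradient U f p) : anisotropicSpace U :=
  ⟨WithLp.toLp 2 (hf.toLp f, hp.toLp p), h.congr hf.coeFn_toLp.symm hp.coeFn_toLp.symm⟩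

/-- An element of `H` is determined by the underlying function. -/
theorem anisotropicSpace.ext_fst (hU : IsOpen U) {u v : anisotropicSpace U}
    (h : u.1.fst = v.1.fst) : u = v := by
  refine Subtype.ext ?_
  have hs : u.1.snd = v.1.snd := by
    refine Lp.ext ?_
    have key : ∀ i, ∀ᵐ z ∂volume, z ∈ U → u.1.snd z i - v.1.snd z i = 0 := by
      intro i
      have hml : MemLp (fun z => u.1.snd z i - v.1.snd z i) 2 (volume.restrict U) :=
        (memLp_coord u.1.snd i).sub (memLp_coord v.1.snd i)
      have hloc : LocallyIntegrableOn (fun z => u.1.snd z i - v.1.snd z i) U := by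
        refine (locallyIntegrableOn_iff hU.isLocallyClosed).2 fun K hKU hK => ?_
        have : IsFiniteMeasure (volume.restrict K) := ⟨by simpa using hK.measure_lt_top⟩
        exact (hml.mono_measure (Measure.restrict_mono hKU le_rfl)).integrable (by norm_num)
      refine hU.ae_eq_zero_of_integral_contDiff_smul_eq_zero hloc fun ψ hψ hψc hψs => ?_
      have hψt : IsTestFunction U ψ := ⟨hψ, hψc, hψs⟩
      have h1 := u.2 ψ hψt i
      have h2 := v.2 ψ hψt i
      rw [h] at h1
      have h3 : ∫ z in U, u.1.snd z i * ψ z = ∫ z in U, v.1.snd z i * ψ z := by linarith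
      have i1 : Integrable (fun z => u.1.snd z i * ψ z) (volume.restrict U) :=
        (memLp_coord u.1.snd i).integrable_mul hψt.memLp
      have i2 : Integrable (fun z => v.1.snd z i * ψ z) (volume.restrict U) :=
        (memLp_coord v.1.snd i).integrable_mul hψt.memLp
      have h4 : ∫ z in U, ψ z • (u.1.snd z i - v.1.snd z i) = 0 := by
        rw [← sub_eq_zero, ← integral_sub i1 i2] at h3
        rw [← h3]
        exact integral_congr_ae (Eventually.of_forall fun z => by simp only [smul_eq_mul]; ring)
      rw [← h4, setIntegral_eq_integral_of_forall_compl_eq_zero]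
      intro z hz
      rw [image_eq_zero_of_notMem_tsupport fun h => hz (hψs h), zero_smul]
    rw [Filter.EventuallyEq, ae_restrict_iff' hU.measurableSet]
    filter_upwards [ae_all_iff.2 key] with z hz hzU
    ext i
    exact sub_eq_zero.1 (hz i hzU)
  exact (WithLp.equiv 2 _).injective (Prod.ext h hs)

theorem Represents.unique (hU : IsOpen U) {u v : anisotropicSpace U} {f : SpaceTime d → ℝ}
    (hu : Represents u f) (hv : Represents v f) : u = v :=
  anisotropicSpace.ext_fst hU (Lp.ext (hu.trans hv.symm))

theorem anisotropicSpace.norm_le (u : anisotropicSpace U) : ‖u‖ ≤ ‖u.1.fst‖ + ‖u.1.snd‖ := by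
  rw [Submodule.coe_norm, WithLp.prod_norm_eq_of_L2]
  refine Real.sqrt_le_iff.2 ⟨by positivity, ?_⟩
  nlinarith [norm_nonneg u.1.fst, norm_nonneg u.1.snd]

theorem anisotropicSpace.norm_sq (u : anisotropicSpace U) :
    ‖u‖ ^ 2 = ‖u.1.fst‖ ^ 2 + ‖u.1.snd‖ ^ 2 := by
  rw [Submodule.coe_norm, WithLp.prod_norm_sq_eq_of_L2]

/-- A criterion for membership in a closure in terms of functions. -/
theorem anisotropicSpace.mem_closure {S : Set (anisotropicSpace U)} {u : anisotropicSpace U}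
    (h : ∀ ε : ℝ, 0 < ε → ∃ w ∈ S,
      eLpNorm (fun z => w.1.fst z - u.1.fst z) 2 (volume.restrict U) ≤ ENNReal.ofReal ε ∧
      eLpNorm (fun z => w.1.snd z - u.1.snd z) 2 (volume.restrict U) ≤ ENNReal.ofReal ε) :
    u ∈ closure S := by
  refine Metric.mem_closure_iff.2 fun ε hε => ?_
  obtain ⟨w, hw, h1, h2⟩ := h (ε / 4) (by positivity)
  refine ⟨w, hw, ?_⟩
  rw [dist_comm, dist_eq_norm]
  refine (anisotropicSpace.norm_le _).trans_lt ?_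
  have e1 : ‖(w - u).1.fst‖ ≤ ε / 4 := by
    change ‖w.1.fst - u.1.fst‖ ≤ _
    rw [Lp.norm_def]
    refine ENNReal.toReal_le_of_le_ofReal (by positivity) ?_
    rw [eLpNorm_congr_ae (Lp.coeFn_sub _ _)]
    exact h1
  have e2 : ‖(w - u).1.snd‖ ≤ ε / 4 := by
    change ‖w.1.snd - u.1.snd‖ ≤ _
    rw [Lp.norm_def]
    refine ENNReal.toReal_le_of_le_ofReal (by positivity) ?_
    rw [eLpNorm_congr_ae (Lp.coeFn_sub _ _)]
    exact h2
  linarith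

theorem IsWeakSpatialGradient.of_contDiff {v : SpaceTime d → ℝ} (hv : ContDiff ℝ 1 v) :
    IsWeakSpatialGradient U v (spatialGradient v) := by
  intro ψ hψ i
  have hvψ : ContDiff ℝ 1 fun z => v z * ψ z := hv.mul (hψ.1.of_le (by simp))
  have hvψc : HasCompactSupport fun z => v z * ψ z := hψ.2.1.mul_left
  have h0 := integral_fderiv_apply_eq_zero hvψ hvψc
    ((EuclideanSpace.single i 1, 0) : SpaceTime d) (μ := volume)
  have e : ∀ z, fderiv ℝ (fun z => v z * ψ z) z (EuclideanSpace.single i 1, 0)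
      = v z * spatialPartial i ψ z + spatialGradient v z i * ψ z := fun z => by
    rw [spatialGradient_apply (hv.differentiable (by simp) z)]
    exact spatialPartial_mul (hv.differentiable (by simp) z) (hψ.1.differentiable (by simp) z) i
  have hcs : Continuous fun z => spatialGradient v z i :=
    (EuclideanSpace.proj (𝕜 := ℝ) i).continuous.comp (IsAdmissible.continuous_spatialGradient hv)
  have i1 : Integrable (fun z => v z * spatialPartial i ψ z) :=
    (hv.continuous.mul ((hψ.1.continuous_fderiv (by simp)).clm_apply
      continuous_const)).integrable_of_hasCompactSupport ((hψ.2.1.fderiv_apply (𝕜 := ℝ) _).mul_left)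
  have i2 : Integrable (fun z => spatialGradient v z i * ψ z) :=
    (hcs.mul hψ.1.continuous).integrable_of_hasCompactSupport hψ.2.1.mul_left
  simp only [e] at h0
  rw [integral_add i1 i2] at h0
  rw [setIntegral_eq_integral_of_forall_compl_eq_zero, setIntegral_eq_integral_of_forall_compl_eq_zero]
  · linarith
  · intro z hz
    rw [image_eq_zero_of_notMem_tsupport fun h => hz (hψ.2.2 h), mul_zero]
  · intro z hz
    rw [spatialPartial, fderiv_eq_zero_of_notMem_tsupport fun h => hz (hψ.2.2 h)]
    simp

/-- `u` satisfies the integration by parts formula against `C_c^∞(V)`. -/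
def HasWeakGradientAgainst (V : Set (SpaceTime d)) (u : anisotropicSpace U) : Prop :=
  ∀ ψ : SpaceTime d → ℝ, IsTestFunction V ψ → ∀ i : Fin d,
    ∫ z in U, u.1.fst z * spatialPartial i ψ z = - ∫ z in U, u.1.snd z i * ψ z

theorem memLp_smul_of_continuous {F : Type*} [NormedAddCommGroup F] [NormedSpace ℝ F]
    {μ : Measure (SpaceTime d)} {η : SpaceTime d → ℝ} (hη : Continuous η)
    (hηc : HasCompactSupport η) {f : SpaceTime d → F} (hf : MemLp f 2 μ) :
    MemLp (fun z => η z • f z) 2 μ := by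
  obtain ⟨C, hC⟩ := hηc.exists_bound_of_continuous hη
  exact hf.of_le_mul (c := C) (hη.aestronglyMeasurable.smul hf.1)
    (Eventually.of_forall fun z => by rw [norm_smul]; gcongr; exact hC z)

/-- The gradient of the product of `u` with a smooth function. -/
def mulGradient (η : SpaceTime d → ℝ) (u : anisotropicSpace U) (z : SpaceTime d) : Space d :=
  η z • u.1.snd z + u.1.fst z • spatialGradient η z

theorem mulGradient_apply {η : SpaceTime d → ℝ} (hη : ContDiff ℝ ∞ η) (u : anisotropicSpace U)
    (z : SpaceTime d) (i : Fin d) :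
    mulGradient η u z i = η z * u.1.snd z i + u.1.fst z * spatialPartial i η z := by
  simp [mulGradient, spatialGradient_apply (hη.differentiable (by simp) z)]

theorem hasCompactSupport_spatialGradient {η : SpaceTime d → ℝ} (hη : ContDiff ℝ ∞ η)
    (hηc : HasCompactSupport η) : HasCompactSupport (spatialGradient η) := by
  refine hηc.mono' fun z hz => ?_
  by_contra h
  refine hz ?_
  ext i
  rw [spatialGradient_apply (hη.differentiable (by simp) z), spatialPartial,
    fderiv_eq_zero_of_notMem_tsupport h]
  rfl

theorem memLp_mulGradient {η : SpaceTime d → ℝ} (hη : ContDiff ℝ ∞ η)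
    (hηc : HasCompactSupport η) (u : anisotropicSpace U) :
    MemLp (mulGradient η u) 2 (volume.restrict U) := by
  refine (memLp_smul_of_continuous hη.continuous hηc (Lp.memLp u.1.snd)).add ?_
  have hgc := IsAdmissible.continuous_spatialGradient (hη.of_le (m := 1) (by simp))
  obtain ⟨C, hC⟩ := (hasCompactSupport_spatialGradient hη hηc).exists_bound_of_continuous hgc
  exact (Lp.memLp u.1.fst).of_le_mul (c := C)
    ((Lp.memLp u.1.fst).1.smul hgc.aestronglyMeasurable)
    (Eventually.of_forall fun z => by rw [norm_smul, mul_comm]; gcongr; exact hC z)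

/-- The formula for `u` is tested with `η ψ`. Only the common support has to lie in `V`, so `ψ` may
be a translated mollifying kernel. `V` may reach beyond `U`; the formula then says that the
extension of `u` by zero has no jump inside `V`. -/
theorem HasWeakGradientAgainst.mul {u : anisotropicSpace U} (hu : HasWeakGradientAgainst V u)
    {η : SpaceTime d → ℝ} (hη : ContDiff ℝ ∞ η) (hηc : HasCompactSupport η)
    {ψ : SpaceTime d → ℝ} (hψ : ContDiff ℝ ∞ ψ) (hψV : tsupport η ∩ tsupport ψ ⊆ V) (i : Fin d) :
    ∫ z in U, (η z • u.1.fst z) * spatialPartial i ψ z = - ∫ z in U, mulGradient η u z i * ψ z := by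
  have ht : IsTestFunction V fun z => η z * ψ z := ⟨hη.mul hψ, hηc.mul_right,
    (subset_inter tsupport_mul_subset_left tsupport_mul_subset_right).trans hψV⟩
  have h := hu _ ht i
  have e : ∀ z, spatialPartial i (fun z => η z * ψ z) z
      = η z * spatialPartial i ψ z + spatialPartial i η z * ψ z := fun z =>
    spatialPartial_mul (hη.differentiable (by simp) z) (hψ.differentiable (by simp) z) i
  have hpc : Continuous (spatialPartial i ψ) :=
    (hψ.continuous_fderiv (by simp)).clm_apply continuous_const
  have hηpc : Continuous (spatialPartial i η) :=
    (hη.continuous_fderiv (by simp)).clm_apply continuous_const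
  have m1 : MemLp (fun z => η z * spatialPartial i ψ z) 2 (volume.restrict U) :=
    ((hη.continuous.mul hpc).memLp_of_hasCompactSupport hηc.mul_right (μ := volume)).restrict U
  have m2 : MemLp (fun z => spatialPartial i η z * ψ z) 2 (volume.restrict U) :=
    ((hηpc.mul hψ.continuous).memLp_of_hasCompactSupport
      ((hηc.fderiv_apply (𝕜 := ℝ) _).mul_right) (μ := volume)).restrict U
  have m3 : MemLp (fun z => η z * ψ z) 2 (volume.restrict U) :=
    ((hη.continuous.mul hψ.continuous).memLp_of_hasCompactSupport hηc.mul_right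
      (μ := volume)).restrict U
  have i1 : Integrable (fun z => u.1.fst z * (η z * spatialPartial i ψ z)) (volume.restrict U) :=
    (Lp.memLp u.1.fst).integrable_mul m1
  have i2 : Integrable (fun z => u.1.fst z * (spatialPartial i η z * ψ z)) (volume.restrict U) :=
    (Lp.memLp u.1.fst).integrable_mul m2
  have i3 : Integrable (fun z => u.1.snd z i * (η z * ψ z)) (volume.restrict U) :=
    (memLp_coord u.1.snd i).integrable_mul m3
  simp only [e, mul_add] at h
  rw [integral_add i1 i2] at h
  have e1 : ∫ z in U, (η z • u.1.fst z) * spatialPartial i ψ z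
      = ∫ z in U, u.1.fst z * (η z * spatialPartial i ψ z) :=
    integral_congr_ae (Eventually.of_forall fun z => by simp only [smul_eq_mul]; ring)
  have e2 : ∫ z in U, mulGradient η u z i * ψ z = (∫ z in U, u.1.snd z i * (η z * ψ z))
      + ∫ z in U, u.1.fst z * (spatialPartial i η z * ψ z) := by
    rw [← integral_add i3 i2]
    exact integral_congr_ae (Eventually.of_forall fun z => by
      simp only [mulGradient_apply hη]; ring)
  rw [e1, e2]
  linarith

/-- The product of an element of `H` with a compactly supported smooth function. -/
def anisotropicSpace.mul {η : SpaceTime d → ℝ} (hη : ContDiff ℝ ∞ η) (hηc : HasCompactSupport η)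
    (u : anisotropicSpace U) : anisotropicSpace U :=
  anisotropicSpace.mk (memLp_smul_of_continuous hη.continuous hηc (Lp.memLp u.1.fst))
    (memLp_mulGradient hη hηc u) fun _ψ hψ i =>
      HasWeakGradientAgainst.mul (V := U) (fun ψ hψ i => u.2 ψ hψ i) hη hηc hψ.1
        (inter_subset_right.trans hψ.2.2) i

theorem anisotropicSpace.mul_fst {η : SpaceTime d → ℝ} (hη : ContDiff ℝ ∞ η)
    (hηc : HasCompactSupport η) (u : anisotropicSpace U) :
    (anisotropicSpace.mul hη hηc u).1.fst =ᵐ[volume.restrict U] fun z => η z • u.1.fst z :=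
  MemLp.coeFn_toLp (memLp_smul_of_continuous hη.continuous hηc (Lp.memLp u.1.fst))

theorem anisotropicSpace.mul_snd {η : SpaceTime d → ℝ} (hη : ContDiff ℝ ∞ η)
    (hηc : HasCompactSupport η) (u : anisotropicSpace U) :
    (anisotropicSpace.mul hη hηc u).1.snd =ᵐ[volume.restrict U] mulGradient η u :=
  MemLp.coeFn_toLp (memLp_mulGradient hη hηc u)

end AnisotropicSpace

/-! ### Small translations into the domain. -/

section Shift

open Filter Topology Metric

variable {d : ℕ} {t₀ T : ℝ} {φ : SpaceTime d → ℝ} {xc : Space d} {tc : ℝ}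

/-- A strictly decreasing direction: small translations which move the closed domain inside. -/
theorem HasStrictFDerivAt.exists_decreasing_shift {G : Type*} [NormedAddCommGroup G]
    [NormedSpace ℝ G] {f : G → ℝ} {D : G →L[ℝ] ℝ} {z₀ : G} (hf : HasStrictFDerivAt f D z₀)
    (hD : D ≠ 0) : ∃ s > 0, ∀ r > 0, ∃ (c : G) (ρ : ℝ), 0 < ρ ∧ ‖c‖ + ρ ≤ r ∧
      ∀ y ∈ ball z₀ s, ∀ u : G, ‖u - c‖ ≤ ρ → f (y + u) < f y ∧ f y < f (y - u) := by
  obtain ⟨e, he⟩ : ∃ e, D e = -1 := by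
    obtain ⟨w, hw⟩ : ∃ w, D w ≠ 0 := by
      by_contra hcon
      push Not at hcon
      exact hD (ContinuousLinearMap.ext hcon)
    exact ⟨(-(D w)⁻¹) • w, by rw [map_smul, smul_eq_mul]; field_simp⟩
  have hε : 0 < 1 / (4 * (‖e‖ + 1)) := by positivity
  have h1 := hf.isLittleO.def hε
  obtain ⟨s, hs, hball⟩ := Metric.eventually_nhds_iff.1 h1
  refine ⟨s / 2, by positivity, fun r hr => ?_⟩
  -- For `‖u - δ e‖ ≤ ρ`, the linear part gives at most `-δ + ‖D‖ ρ ≤ -3δ/4`, and the remainder of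
  -- strict differentiability is at most `δ / 4`. So `f` decreases by at least `δ / 2`.
  set δ := min r (s / 4) / (‖e‖ + 1) with hδ
  have hδ0 : 0 < δ := by positivity
  have hδe : δ * (‖e‖ + 1) = min r (s / 4) := by rw [hδ]; field_simp
  set ρ := δ / (4 * (‖D‖ + 1)) with hρ
  have hρ0 : 0 < ρ := by positivity
  have hρδ : ρ ≤ δ := div_le_self hδ0.le (by linarith [norm_nonneg D])
  have hρD : ‖D‖ * ρ ≤ δ / 4 := by
    have : (‖D‖ + 1) * ρ = δ / 4 := by rw [hρ]; field_simp
    linarith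
  have hc : ‖δ • e‖ + ρ ≤ min r (s / 4) := by
    rw [norm_smul, Real.norm_of_nonneg hδ0.le, ← hδe]; linarith
  refine ⟨δ • e, ρ, hρ0, hc.trans (min_le_left _ _), ?_⟩
  have core : ∀ a ∈ ball z₀ s, ∀ u, ‖u - δ • e‖ ≤ ρ → a + u ∈ ball z₀ s → f (a + u) < f a := by
    intro a ha u hu hau
    have hun : ‖u‖ ≤ δ * (‖e‖ + 1) := by
      have : ‖u‖ ≤ ‖δ • e‖ + ‖u - δ • e‖ := by simpa using norm_add_le (δ • e) (u - δ • e)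
      rw [hδe]; linarith
    have hDu : D u ≤ -δ + δ / 4 := by
      have e1 : D u = -δ + D (u - δ • e) := by
        rw [map_sub, map_smul, he, smul_eq_mul]; ring
      have h2 : D (u - δ • e) ≤ ‖D‖ * ρ :=
        (le_abs_self _).trans ((D.le_opNorm _).trans (by gcongr))
      linarith
    have h3 := hball (y := (a + u, a)) (by
      rw [Prod.dist_eq]; exact max_lt hau ha)
    simp only [add_sub_cancel_left] at h3
    have h4 : 1 / (4 * (‖e‖ + 1)) * ‖u‖ ≤ δ / 4 := by
      calc _ ≤ 1 / (4 * (‖e‖ + 1)) * (δ * (‖e‖ + 1)) := by gcongr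
        _ = _ := by field_simp
    have h5 := (abs_le.1 (h3.trans h4)).2
    linarith
  intro y hy u hu
  have hus : ‖u‖ < s / 2 := by
    have h6 : ‖u‖ ≤ ‖δ • e‖ + ‖u - δ • e‖ := by simpa using norm_add_le (δ • e) (u - δ • e)
    have := min_le_right r (s / 4)
    linarith
  rw [mem_ball, dist_eq_norm] at hy
  have hys : y ∈ ball z₀ s := by rw [mem_ball, dist_eq_norm]; linarith
  refine ⟨core y hys u hu ?_, ?_⟩
  · rw [mem_ball, dist_eq_norm]
    calc ‖y + u - z₀‖ = ‖(y - z₀) + u‖ := by congr 1; abel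
      _ ≤ ‖y - z₀‖ + ‖u‖ := norm_add_le _ _
      _ < s := by linarith
  · have := core (y - u) (by
      rw [mem_ball, dist_eq_norm]
      calc ‖y - u - z₀‖ = ‖(y - z₀) - u‖ := by congr 1; abel
        _ ≤ ‖y - z₀‖ + ‖u‖ := norm_sub_le _ _
        _ < s := by linarith) u hu (by rwa [sub_add_cancel])
    rwa [sub_add_cancel] at this

/-- The vectors `u` near `c` point inwards. The first implication moves supports into the domain and
serves test functions. The second says that a point reached from the domain by an inward shift is in
the domain; it serves approximation by smooth functions. At interior points `c = 0` will do. -/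
theorem IsAdmissible.exists_shift (hφ : IsAdmissible t₀ T φ xc tc) {z₀ : SpaceTime d}
    (hz₀ : z₀ ∈ openSlab d t₀ T) (hzc : z₀ ≠ (xc, tc)) (h0 : φ z₀ ≤ 0) :
    ∃ N, IsOpen N ∧ z₀ ∈ N ∧ N ⊆ openSlab d t₀ T ∧ ∀ r > 0, ∃ (c : SpaceTime d) (ρ : ℝ),
      0 < ρ ∧ ‖c‖ + ρ ≤ r ∧ ∀ y ∈ N, ∀ u, ‖u - c‖ ≤ ρ →
        (φ y ≤ 0 → y + u ∈ domain t₀ T φ) ∧ (y - u ∈ domain t₀ T φ → y ∈ domain t₀ T φ) := by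
  obtain ⟨s₁, hs₁, hslab⟩ := Metric.isOpen_iff.1 isOpen_openSlab z₀ hz₀
  rcases h0.lt_or_eq with h | h
  · obtain ⟨s, hs, hdom⟩ := Metric.isOpen_iff.1 hφ.isOpen_domain z₀ ⟨hz₀.2, h⟩
    refine ⟨ball z₀ (s / 2), isOpen_ball, mem_ball_self (by positivity),
      (ball_subset_ball (by linarith)).trans (hdom.trans domain_subset_openSlab), fun r hr => ?_⟩
    refine ⟨0, min r (s / 4), by positivity, by simp, fun y hy u hu => ⟨fun _ => hdom ?_,
      fun _ => hdom (ball_subset_ball (by linarith) hy)⟩⟩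
    rw [sub_zero] at hu
    rw [mem_ball, dist_eq_norm] at hy ⊢
    calc ‖y + u - z₀‖ = ‖(y - z₀) + u‖ := by congr 1; abel
      _ ≤ ‖y - z₀‖ + ‖u‖ := norm_add_le _ _
      _ < s := by have := min_le_right r (s / 4); linarith
  · have hstrict := (hφ.contDiffAt hz₀).hasStrictFDerivAt (by simp)
    have hD := fderiv_ne_zero_of_spatialGradient_ne_zero (hφ.differentiableAt hz₀)
      (hφ.spatialGradient_ne_zero ⟨hz₀.2, h⟩ hzc)
    obtain ⟨s, hs, hsh⟩ := HasStrictFDerivAt.exists_decreasing_shift hstrict hD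
    refine ⟨ball z₀ (min s (s₁ / 2)), isOpen_ball, mem_ball_self (by positivity),
      (ball_subset_ball ((min_le_right _ _).trans (by linarith))).trans hslab, fun r hr => ?_⟩
    obtain ⟨c, ρ, hρ, hcρ, H⟩ := hsh (min r (s₁ / 2)) (by positivity)
    refine ⟨c, ρ, hρ, hcρ.trans (min_le_left _ _), fun y hy u hu => ?_⟩
    have hun : ‖u‖ ≤ s₁ / 2 := by
      have h6 : ‖u‖ ≤ ‖c‖ + ‖u - c‖ := by simpa using norm_add_le c (u - c)
      have := min_le_right r (s₁ / 2)
      linarith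
    have hy1 := ball_subset_ball (min_le_right s (s₁ / 2)) hy
    obtain ⟨H1, H2⟩ := H y (ball_subset_ball (min_le_left s (s₁ / 2)) hy) u hu
    refine ⟨fun hy0 => ⟨(hslab ?_).2, H1.trans_le hy0⟩, fun hyu => ⟨(hslab ?_).2, H2.trans hyu.2⟩⟩
    · rw [mem_ball, dist_eq_norm] at hy1 ⊢
      calc ‖y + u - z₀‖ = ‖(y - z₀) + u‖ := by congr 1; abel
        _ ≤ ‖y - z₀‖ + ‖u‖ := norm_add_le _ _
        _ < s₁ := by linarith
    · exact ball_subset_ball (by linarith) hy1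

end Shift

/-! ### Mollification of elements of `H` with shifted kernels. -/

section Mollify

open Filter Topology Metric
open scoped Convolution

variable {d : ℕ} {U V : Set (SpaceTime d)}

/-- Convolution with a kernel. -/
def mollify {F : Type*} [NormedAddCommGroup F] [NormedSpace ℝ F] (k : SpaceTime d → ℝ)
    (f : SpaceTime d → F) (z : SpaceTime d) : F := ∫ u, k u • f (z - u)

theorem contDiff_mollify {k : SpaceTime d → ℝ} (hk : ContDiff ℝ ∞ k) (hkc : HasCompactSupport k)
    {f : SpaceTime d → ℝ} (hf : LocallyIntegrable f) : ContDiff ℝ ∞ (mollify k f) :=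
  hkc.contDiff_convolution_left (ContinuousLinearMap.lsmul ℝ ℝ) (n := (⊤ : ℕ∞)) hk hf

theorem spatialPartial_mollify {k : SpaceTime d → ℝ} (hk : ContDiff ℝ ∞ k)
    (hkc : HasCompactSupport k) {f : SpaceTime d → ℝ} (hf : LocallyIntegrable f)
    (i : Fin d) (z : SpaceTime d) :
    spatialPartial i (mollify k f) z = ∫ y, f y * spatialPartial i k (z - y) := by
  have h := (hkc.hasFDerivAt_convolution_left (ContinuousLinearMap.lsmul ℝ ℝ) (μ := volume)
    (hk.of_le (by simp)) hf z).fderiv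
  have hex := (hkc.fderiv (𝕜 := ℝ)).convolutionExists_left
    ((ContinuousLinearMap.lsmul ℝ ℝ).precompL (SpaceTime d)) (hk.continuous_fderiv (by simp)) hf z
  change fderiv ℝ (k ⋆[ContinuousLinearMap.lsmul ℝ ℝ, volume] f) z _ = _
  rw [h, convolution_def, ContinuousLinearMap.integral_apply hex,
    ← integral_sub_left_eq_self _ volume z]
  refine integral_congr_ae (Eventually.of_forall fun y => ?_)
  simp [spatialPartial, mul_comm]

theorem locallyIntegrable_of_memLp {F : Type*} [NormedAddCommGroup F]
    {f : SpaceTime d → F} (hf : MemLp f 2 volume) : LocallyIntegrable f :=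
  hf.locallyIntegrable (by norm_num)

theorem mollify_apply {k : SpaceTime d → ℝ} (hk : Continuous k) (hkc : HasCompactSupport k)
    {p : SpaceTime d → Space d} (hp : LocallyIntegrable p) (z : SpaceTime d) (i : Fin d) :
    mollify k p z i = ∫ y, k (z - y) * p y i := by
  have hex := hkc.convolutionExists_left (ContinuousLinearMap.lsmul ℝ ℝ) (μ := volume) hk hp z
  have h := (EuclideanSpace.proj (𝕜 := ℝ) i).integral_comp_comm hex
  change (EuclideanSpace.proj (𝕜 := ℝ) i) (∫ u, k u • p (z - u)) = _
  refine h.symm.trans ?_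
  rw [← integral_sub_left_eq_self _ volume z]
  refine integral_congr_ae (Eventually.of_forall fun y => ?_)
  simp

/-- Differentiation commutes with mollification where the kernel only sees `V`. -/
theorem HasWeakGradientAgainst.spatialGradient_mollify (hU : MeasurableSet U)
    {u : anisotropicSpace U} (hu : HasWeakGradientAgainst V u)
    {η : SpaceTime d → ℝ} (hη : ContDiff ℝ ∞ η) (hηc : HasCompactSupport η)
    {k : SpaceTime d → ℝ} (hk : ContDiff ℝ ∞ k) (hkc : HasCompactSupport k)
    (hf : LocallyIntegrable (U.indicator fun z => η z • u.1.fst z))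
    (hp : LocallyIntegrable (U.indicator (mulGradient η u)))
    {z : SpaceTime d} (hz : ∀ y ∈ tsupport η, z - y ∈ tsupport k → y ∈ V) :
    spatialGradient (mollify k (U.indicator fun z => η z • u.1.fst z)) z
      = mollify k (U.indicator (mulGradient η u)) z := by
  ext i
  rw [spatialGradient_apply ((contDiff_mollify hk hkc hf).differentiable (by simp) z),
    spatialPartial_mollify hk hkc hf, mollify_apply hk.continuous hkc hp]
  set ψ : SpaceTime d → ℝ := fun y => k (z - y) with hψ
  have hψs : ContDiff ℝ ∞ ψ := hk.comp (contDiff_const.sub contDiff_id)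
  have hψt : tsupport ψ ⊆ {y | z - y ∈ tsupport k} :=
    tsupport_comp_subset_preimage k (continuous_const.sub continuous_id)
  have hψp : ∀ y, spatialPartial i ψ y = - spatialPartial i k (z - y) := by
    intro y
    have h1 : HasFDerivAt (fun y : SpaceTime d => z - y) (-ContinuousLinearMap.id ℝ _) y :=
      (hasFDerivAt_id y).const_sub z
    have h2 := ((hk.differentiable (by simp) (z - y)).hasFDerivAt.comp y h1).fderiv
    change fderiv ℝ (k ∘ fun y => z - y) y _ = _
    rw [h2]
    simp [spatialPartial]
  have h := hu.mul hη hηc hψs (fun y hy => hz y hy.1 (hψt hy.2)) i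
  have e1 : ∀ y, U.indicator (fun z => η z • u.1.fst z) y * spatialPartial i k (z - y)
      = U.indicator (fun y => - ((η y • u.1.fst y) * spatialPartial i ψ y)) y := fun y => by
    by_cases hy : y ∈ U <;> simp [hy, hψp]
  have e2 : ∀ y, k (z - y) * U.indicator (mulGradient η u) y i
      = U.indicator (fun y => mulGradient η u y i * ψ y) y := fun y => by
    by_cases hy : y ∈ U <;> simp [hy, hψ, mul_comm]
  simp only [e1, e2]
  rw [integral_indicator hU, integral_indicator hU, integral_neg, h, neg_neg]

theorem stronglyMeasurable_mulGradient {η : SpaceTime d → ℝ} (hη : ContDiff ℝ ∞ η)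
    (u : anisotropicSpace U) : StronglyMeasurable (mulGradient η u) := by
  have hgc := IsAdmissible.continuous_spatialGradient (hη.of_le (m := 1) (by simp))
  have h1 : StronglyMeasurable fun z => η z • u.1.snd z :=
    hη.continuous.stronglyMeasurable.smul (Lp.stronglyMeasurable u.1.snd)
  have h2 : StronglyMeasurable fun z => u.1.fst z • spatialGradient η z :=
    (Lp.stronglyMeasurable u.1.fst).smul hgc.stronglyMeasurable
  exact h1.add h2

theorem exists_kernel (c : SpaceTime d) {ρ : ℝ} (hρ : 0 < ρ) : ∃ k : SpaceTime d → ℝ,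
    ContDiff ℝ ∞ k ∧ HasCompactSupport k ∧ tsupport k = closedBall c ρ ∧ (∀ u, 0 ≤ k u) ∧
      ∫ u, k u = 1 ∧ ∀ u, ‖c‖ + ρ ≤ ‖u‖ → k u = 0 := by
  let b : ContDiffBump c :=
    { rIn := ρ / 2, rOut := ρ, rIn_pos := by positivity, rIn_lt_rOut := by linarith }
  refine ⟨b.normed volume, b.contDiff_normed, b.hasCompactSupport_normed, b.tsupport_normed_eq,
    b.nonneg_normed, b.integral_normed, fun u hur => ?_⟩
  by_contra hne
  have h1 : u ∈ Function.support (b.normed volume) := hne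
  rw [b.support_normed_eq, mem_ball, dist_eq_norm] at h1
  have h2 : ‖u‖ ≤ ‖c‖ + ‖u - c‖ := by simpa using norm_add_le c (u - c)
  have h3 : b.rOut = ρ := rfl
  linarith

theorem tsupport_mollify_subset {k f : SpaceTime d → ℝ} {c : SpaceTime d} {ρ : ℝ}
    (hk : tsupport k = closedBall c ρ) {K : Set (SpaceTime d)} (hK : IsCompact K)
    (hf : Function.support f ⊆ K) :
    HasCompactSupport (mollify k f) ∧ ∀ z ∈ tsupport (mollify k f), ∃ y ∈ K, ‖z - y - c‖ ≤ ρ := by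
  have hKc : IsCompact ((fun q : SpaceTime d × SpaceTime d => q.1 + q.2) '' (K ×ˢ closedBall c ρ)) :=
    (hK.prod (isCompact_closedBall c ρ)).image (by fun_prop)
  have hsupp : Function.support (mollify k f) ⊆
      (fun q : SpaceTime d × SpaceTime d => q.1 + q.2) '' (K ×ˢ closedBall c ρ) := by
    intro z hz
    by_contra hcon
    refine hz (integral_eq_zero_of_ae (Eventually.of_forall fun w => ?_))
    by_contra hne
    obtain ⟨h1, h2⟩ := smul_ne_zero_iff.1 hne
    exact hcon ⟨(z - w, w), ⟨hf h2, hk ▸ subset_tsupport _ h1⟩, by simp⟩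
  have htsupp := closure_minimal hsupp hKc.isClosed
  refine ⟨hKc.of_isClosed_subset (isClosed_tsupport _) htsupp, fun z hz => ?_⟩
  obtain ⟨q, hq, rfl⟩ := htsupp hz
  refine ⟨q.1, hq.1, ?_⟩
  have := hq.2
  rw [mem_closedBall, dist_eq_norm] at this
  simpa using this

/-- Local smooth approximation of an element of `H`. -/
theorem HasWeakGradientAgainst.exists_approx (hU : MeasurableSet U)
    {u : anisotropicSpace U} (hu : HasWeakGradientAgainst V u)
    {η : SpaceTime d → ℝ} (hη : ContDiff ℝ ∞ η) (hηc : HasCompactSupport η)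
    {S : SpaceTime d → ℝ → Prop} (hS : ∀ r > 0, ∃ c ρ, 0 < ρ ∧ ‖c‖ + ρ ≤ r ∧ S c ρ)
    (hSV : ∀ c ρ, S c ρ → ∀ z ∈ U, ∀ y ∈ tsupport η, ‖z - y - c‖ ≤ ρ → y ∈ V)
    {ε : ℝ≥0∞} (hε : 0 < ε) :
    ∃ (v : SpaceTime d → ℝ) (c : SpaceTime d) (ρ : ℝ), S c ρ ∧ ContDiff ℝ ∞ v ∧
      HasCompactSupport v ∧ (∀ z ∈ tsupport v, ∃ y ∈ tsupport η ∩ closure U, ‖z - y - c‖ ≤ ρ) ∧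
      eLpNorm (fun z => v z - η z • u.1.fst z) 2 (volume.restrict U) ≤ ε ∧
      eLpNorm (fun z => spatialGradient v z - mulGradient η u z) 2 (volume.restrict U) ≤ ε := by
  have hfm : StronglyMeasurable (U.indicator fun z => η z • u.1.fst z) :=
    (hη.continuous.stronglyMeasurable.smul (Lp.stronglyMeasurable u.1.fst)).indicator hU
  have hpm : StronglyMeasurable (U.indicator (mulGradient η u)) :=
    (stronglyMeasurable_mulGradient hη u).indicator hU
  have hf2 : MemLp (U.indicator fun z => η z • u.1.fst z) 2 volume :=
    (memLp_indicator_iff_restrict hU).2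
      (memLp_smul_of_continuous hη.continuous hηc (Lp.memLp u.1.fst))
  have hp2 : MemLp (U.indicator (mulGradient η u)) 2 volume :=
    (memLp_indicator_iff_restrict hU).2 (memLp_mulGradient hη hηc u)
  obtain ⟨r₁, hr₁, H₁⟩ := exists_eLpNorm_mollify_sub_le (μ := volume) hf2 hfm hε
  obtain ⟨r₂, hr₂, H₂⟩ := exists_eLpNorm_mollify_sub_le (μ := volume) hp2 hpm hε
  -- One kernel must serve the function and its gradient, both extended by zero outside `U`. The
  -- predicate `S` selects the admissible shifts. Through `hSV`, it ensures that at points of `U`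
  -- the kernel only sees points of `tsupport η` where integration by parts is available.
  obtain ⟨c, ρ, hρ, hcρ, hScρ⟩ := hS (min r₁ r₂) (by positivity)
  obtain ⟨k, hk, hkc, hkt, hk0, hk1, hkr⟩ := exists_kernel c hρ
  have hfl := locallyIntegrable_of_memLp hf2
  have hpl := locallyIntegrable_of_memLp hp2
  have hsupp : Function.support (U.indicator fun z => η z • u.1.fst z)
      ⊆ tsupport η ∩ closure U := by
    intro z hz
    have hzU : z ∈ U := by
      by_contra h
      exact hz (indicator_of_notMem h _)
    rw [Function.mem_support, indicator_of_mem hzU] at hz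
    exact ⟨subset_tsupport _ (smul_ne_zero_iff.1 hz).1, subset_closure hzU⟩
  obtain ⟨hvc, hvt⟩ := tsupport_mollify_subset hkt
    ((show IsCompact (tsupport η) from hηc).inter_right isClosed_closure) hsupp
  refine ⟨_, c, ρ, hScρ, contDiff_mollify hk hkc hfl, hvc, hvt, ?_, ?_⟩
  · have h1 := H₁ k hk.continuous hk0 hk1 fun u hu => hkr u ((hcρ.trans (min_le_left _ _)).trans hu)
    refine le_trans (le_of_eq ?_) ((eLpNorm_mono_measure _ (Measure.restrict_le_self (s := U))).trans h1)
    refine eLpNorm_congr_ae ?_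
    filter_upwards [ae_restrict_mem hU] with z hz
    rw [indicator_of_mem hz]
    rfl
  · have h1 := H₂ k hk.continuous hk0 hk1 fun u hu => hkr u ((hcρ.trans (min_le_right _ _)).trans hu)
    refine le_trans (le_of_eq ?_) ((eLpNorm_mono_measure _ (Measure.restrict_le_self (s := U))).trans h1)
    refine eLpNorm_congr_ae ?_
    filter_upwards [ae_restrict_mem hU] with z hz
    rw [hu.spatialGradient_mollify hU hη hηc hk hkc hfl hpl fun y hy hyk => hSV c ρ hScρ z hz y hy (by
      rw [hkt, mem_closedBall, dist_eq_norm] at hyk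
      exact hyk), indicator_of_mem hz]
    rfl

end Mollify

/-! ### Localization of membership in closed subspaces of `H`. -/

section Density

open Filter Topology Metric

theorem eLpNorm_two_sq {X F : Type*} [MeasurableSpace X] [NormedAddCommGroup F] {μ : Measure X}
    (f : X → F) : eLpNorm f 2 μ ^ 2 = ∫⁻ x, ‖f x‖ₑ ^ 2 ∂μ := by
  have h := eLpNorm_nnreal_pow_eq_lintegral (f := f) (μ := μ) (p := 2) (by norm_num)
  have e : ((2 : NNReal) : ℝ) = ((2 : ℕ) : ℝ) := by norm_num
  simp only [e, ENNReal.rpow_natCast] at h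
  exact h

variable {d : ℕ} {t₀ T : ℝ} {φ : SpaceTime d → ℝ} {xc : Space d} {tc : ℝ}

/-- Smooth time cutoffs exhausting an open bounded set of times. -/
theorem exists_timeCutoffs (t₀ T tc : ℝ) : ∃ χ : ℕ → ℝ → ℝ, (∀ n, ContDiff ℝ ∞ (χ n) ∧
    HasCompactSupport (χ n) ∧ tsupport (χ n) ⊆ Ioo t₀ T \ {tc} ∧ ∀ t, 0 ≤ χ n t ∧ χ n t ≤ 1) ∧
    ∀ t ∈ Ioo t₀ T \ {tc}, ∀ᶠ n in atTop, χ n t = 1 := by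
  have hO : IsOpen (Ioo t₀ T \ {tc}) := isOpen_Ioo.sdiff isClosed_singleton
  obtain ⟨F, hFc, hFs, hFU, hFm⟩ := hO.exists_iUnion_isClosed
  have hK : ∀ n, IsCompact (F n) := fun n => isCompact_Icc.of_isClosed_subset (hFc n)
    ((hFs n).trans (sdiff_subset.trans Ioo_subset_Icc_self))
  choose χ h1 h2 h3 h4 h5 using fun n => exists_contDiff_cutoff (hK n) hO (hFs n)
  refine ⟨χ, fun n => ⟨h1 n, h2 n, h3 n, h4 n⟩, fun t ht => ?_⟩
  rw [← hFU] at ht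
  obtain ⟨m, hm⟩ := mem_iUnion.1 ht
  filter_upwards [eventually_ge_atTop m] with n hn
  exact (h5 n t (hFm hn hm)).eq_of_nhds

theorem tendsto_eLpNorm_timeCutoff {F : Type*} [NormedAddCommGroup F] [NormedSpace ℝ F]
    {μ : Measure (SpaceTime d)} {f : SpaceTime d → F} (hf : MemLp f 2 μ) {χ : ℕ → ℝ → ℝ}
    (hχ : ∀ n, Continuous (χ n)) (h01 : ∀ n t, 0 ≤ χ n t ∧ χ n t ≤ 1)
    (hlim : ∀ᵐ z ∂μ, ∀ᶠ n in atTop, χ n z.2 = 1) :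
    Tendsto (fun n => eLpNorm (fun z => χ n z.2 • f z - f z) 2 μ) atTop (𝓝 0) := by
  have h1 : Tendsto (fun n => ∫⁻ z, ‖χ n z.2 • f z - f z‖ₑ ^ 2 ∂μ) atTop (𝓝 (∫⁻ _, 0 ∂μ)) := by
    refine tendsto_lintegral_of_dominated_convergence' (fun z => ‖f z‖ₑ ^ 2) (fun n => ?_)
      (fun n => Eventually.of_forall fun z => ?_) ?_ ?_
    · exact ((((hχ n).comp continuous_snd).aestronglyMeasurable.smul hf.1).sub hf.1).enorm.pow_const 2
    · have : ‖χ n z.2 • f z - f z‖ ≤ ‖f z‖ := by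
        have e : χ n z.2 • f z - f z = (χ n z.2 - 1) • f z := by rw [sub_smul, one_smul]
        rw [e, norm_smul]
        refine mul_le_of_le_one_left (norm_nonneg _) ?_
        rw [Real.norm_eq_abs, abs_le]
        have := h01 n z.2
        constructor <;> linarith
      exact pow_le_pow_left' (enorm_le_iff_norm_le.2 this) 2
    · rw [← eLpNorm_two_sq]
      exact ENNReal.pow_ne_top hf.2.ne
    · filter_upwards [hlim] with z hz
      refine tendsto_const_nhds.congr' ?_
      filter_upwards [hz] with n hn
      simp [hn]
  have h2 := (ENNReal.continuous_rpow_const (y := 1 / 2)).tendsto _ |>.comp h1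
  simp only [lintegral_zero] at h2
  rw [ENNReal.zero_rpow_of_pos (by norm_num)] at h2
  refine h2.congr fun n => ?_
  simp only [Function.comp_apply]
  rw [← eLpNorm_two_sq, ← ENNReal.rpow_natCast, ← ENNReal.rpow_mul]
  norm_num

theorem anisotropicSpace.mul_congr {U : Set (SpaceTime d)} (hU : IsOpen U) {η η' : SpaceTime d → ℝ}
    (hη : ContDiff ℝ ∞ η) (hηc : HasCompactSupport η) (hη' : ContDiff ℝ ∞ η')
    (hηc' : HasCompactSupport η') (u : anisotropicSpace U) (h : ∀ z ∈ U, η z = η' z) :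
    anisotropicSpace.mul hη hηc u = anisotropicSpace.mul hη' hηc' u := by
  refine anisotropicSpace.ext_fst hU (Lp.ext ?_)
  filter_upwards [anisotropicSpace.mul_fst hη hηc u, anisotropicSpace.mul_fst hη' hηc' u,
    ae_restrict_mem hU.measurableSet] with z h1 h2 hz
  rw [h1, h2, h z hz]

theorem anisotropicSpace.mul_add {U : Set (SpaceTime d)} (hU : IsOpen U) {η η' : SpaceTime d → ℝ}
    (hη : ContDiff ℝ ∞ η) (hηc : HasCompactSupport η) (hη' : ContDiff ℝ ∞ η')
    (hηc' : HasCompactSupport η') (u : anisotropicSpace U) :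
    anisotropicSpace.mul (hη.add hη') (hηc.add hηc') u
      = anisotropicSpace.mul hη hηc u + anisotropicSpace.mul hη' hηc' u := by
  refine anisotropicSpace.ext_fst hU (Lp.ext ?_)
  change _ =ᵐ[_] ((anisotropicSpace.mul hη hηc u).1.fst + (anisotropicSpace.mul hη' hηc' u).1.fst :
    Lp ℝ 2 (volume.restrict U))
  filter_upwards [anisotropicSpace.mul_fst (hη.add hη') (hηc.add hηc') u,
    anisotropicSpace.mul_fst hη hηc u, anisotropicSpace.mul_fst hη' hηc' u,
    Lp.coeFn_add (anisotropicSpace.mul hη hηc u).1.fst (anisotropicSpace.mul hη' hηc' u).1.fst]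
    with z h1 h2 h3 h4
  rw [h1, h4, Pi.add_apply, h2, h3, add_smul]

theorem anisotropicSpace.mul_mem_of_partition {U : Set (SpaceTime d)} (hU : IsOpen U)
    (S : Submodule ℝ (anisotropicSpace U)) (u : anisotropicSpace U)
    (s : Finset (SpaceTime d)) {ζ : SpaceTime d → SpaceTime d → ℝ} {η : SpaceTime d → ℝ}
    (hη : ContDiff ℝ ∞ η) (hηc : HasCompactSupport η) (hζ : ∀ w ∈ s, ContDiff ℝ ∞ (ζ w))
    (h : ∀ w (hw : w ∈ s), anisotropicSpace.mul ((hζ w hw).mul hη) hηc.mul_left u ∈ S) :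
    ∀ h1 h2, anisotropicSpace.mul (η := fun z => (∑ w ∈ s, ζ w z) * η z) h1 h2 u ∈ S := by
  classical
  induction s using Finset.induction_on with
  | empty =>
    intro h1 h2
    have e : anisotropicSpace.mul (η := fun z => (∑ w ∈ (∅ : Finset (SpaceTime d)), ζ w z) * η z)
        h1 h2 u = 0 := by
      refine anisotropicSpace.ext_fst hU (Lp.ext ?_)
      change _ =ᵐ[_] ((0 : Lp ℝ 2 (volume.restrict U)) : SpaceTime d → ℝ)
      filter_upwards [anisotropicSpace.mul_fst h1 h2 u, Lp.coeFn_zero ℝ 2 (volume.restrict U)]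
        with z h3 h4
      rw [h3, h4]
      simp
    rw [e]
    exact S.zero_mem
  | insert a s ha ih =>
    intro h1 h2
    have hs : ContDiff ℝ ∞ fun z => (∑ w ∈ s, ζ w z) * η z :=
      (ContDiff.sum fun w hw => hζ w (Finset.mem_insert_of_mem hw)).mul hη
    have hsc : HasCompactSupport fun z => (∑ w ∈ s, ζ w z) * η z := hηc.mul_left
    have ha' : ContDiff ℝ ∞ fun z => ζ a z * η z := (hζ a (Finset.mem_insert_self a s)).mul hη
    have hac : HasCompactSupport fun z => ζ a z * η z := hηc.mul_left
    have e : anisotropicSpace.mul h1 h2 u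
        = anisotropicSpace.mul ha' hac u + anisotropicSpace.mul hs hsc u := by
      rw [← anisotropicSpace.mul_add hU]
      refine anisotropicSpace.mul_congr hU _ _ _ _ u fun z _ => ?_
      rw [Finset.sum_insert ha, add_mul]
    rw [e]
    exact S.add_mem (h a (Finset.mem_insert_self a s))
      (ih (fun w hw => hζ w (Finset.mem_insert_of_mem hw))
        (fun w hw => h w (Finset.mem_insert_of_mem hw)) hs hsc)

namespace IsAdmissible

variable (hφ : IsAdmissible t₀ T φ xc tc)
include hφ

/-- The support of `χ` is compact and avoids the critical and end times, so the part of the closed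
domain over it is a compact set `K` of points where `hloc` applies. The partition sums to `1` only
on `K`, which suffices because products in `H` depend on the cutoff only inside the domain. -/
theorem mul_mem_of_local (S : Submodule ℝ (anisotropicSpace (domain t₀ T φ)))
    (u : anisotropicSpace (domain t₀ T φ))
    (hloc : ∀ z₀ ∈ openSlab d t₀ T, z₀.2 ≠ tc → φ z₀ ≤ 0 → ∃ N, IsOpen N ∧ z₀ ∈ N ∧
      ∀ (η : SpaceTime d → ℝ) (hη : ContDiff ℝ ∞ η) (hηc : HasCompactSupport η), tsupport η ⊆ N →
        anisotropicSpace.mul hη hηc u ∈ S)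
    {χ : ℝ → ℝ} (hχc : HasCompactSupport χ) (hχs : tsupport χ ⊆ Ioo t₀ T \ {tc})
    {η₀ : SpaceTime d → ℝ} (hη : ContDiff ℝ ∞ fun z : SpaceTime d => χ z.2 * η₀ z)
    (hηc : HasCompactSupport fun z : SpaceTime d => χ z.2 * η₀ z) :
    anisotropicSpace.mul hη hηc u ∈ S := by
  obtain ⟨R, hR⟩ := hφ.exists_isCompact
  set K : Set (SpaceTime d) := (closedBall 0 R ×ˢ tsupport χ) ∩ φ ⁻¹' Iic 0 with hKdef
  have hKc : IsCompact (closedBall (0 : Space d) R ×ˢ tsupport χ) :=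
    (isCompact_closedBall _ _).prod hχc
  have hKsub : closedBall (0 : Space d) R ×ˢ tsupport χ ⊆ openSlab d t₀ T :=
    prod_mono (subset_univ _) (hχs.trans sdiff_subset)
  have hK : IsCompact K := hKc.of_isClosed_subset
    ((hφ.contDiffOn_openSlab.continuousOn.mono hKsub).preimage_isClosed_of_isClosed
      hKc.isClosed isClosed_Iic) inter_subset_left
  have hloc' : ∀ z₀ ∈ K, ∃ N, (IsOpen N ∧ z₀ ∈ N) ∧
      ∀ (η : SpaceTime d → ℝ) (hη : ContDiff ℝ ∞ η) (hηc : HasCompactSupport η), tsupport η ⊆ N →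
        anisotropicSpace.mul hη hηc u ∈ S := fun z hz => by
    obtain ⟨N, h1, h2, h3⟩ := hloc z (hKsub hz.1) (hχs hz.1.2).2 hz.2
    exact ⟨N, ⟨h1, h2⟩, h3⟩
  choose! N hN H using hloc'
  obtain ⟨s, ζ, hζ, hsum⟩ := exists_finite_partition hK hN
  have hmem := anisotropicSpace.mul_mem_of_partition hφ.isOpen_domain S u s hη hηc
    (fun w hw => (hζ w hw).2.1)
    (fun w hw => H w (hζ w hw).1 _ _ _ (tsupport_mul_subset_left.trans (hζ w hw).2.2.1))
    ((ContDiff.sum fun w hw => (hζ w hw).2.1).mul hη) hηc.mul_left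
  rwa [anisotropicSpace.mul_congr hφ.isOpen_domain _ _ hη hηc u fun z hz => ?_] at hmem
  by_cases hzχ : z.2 ∈ tsupport χ
  · have hzK : z ∈ K := ⟨⟨by
      simpa using hR z (openSlab_subset_closedSlab (domain_subset_openSlab hz)) hz.2.le, hzχ⟩,
      hz.2.le⟩
    rw [hsum z hzK, one_mul]
  · rw [image_eq_zero_of_notMem_tsupport hzχ, zero_mul, mul_zero]

set_option maxHeartbeats 1000000 in
/-- Membership in a closed subspace of `H` is a local property away from the critical time. -/
theorem mem_topologicalClosure_of_local (S : Submodule ℝ (anisotropicSpace (domain t₀ T φ)))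
    (u : anisotropicSpace (domain t₀ T φ))
    (hloc : ∀ z₀ ∈ openSlab d t₀ T, z₀.2 ≠ tc → φ z₀ ≤ 0 → ∃ N, IsOpen N ∧ z₀ ∈ N ∧
      ∀ (η : SpaceTime d → ℝ) (hη : ContDiff ℝ ∞ η) (hηc : HasCompactSupport η), tsupport η ⊆ N →
        anisotropicSpace.mul hη hηc u ∈ S.topologicalClosure) :
    u ∈ S.topologicalClosure := by
  have hU := hφ.isOpen_domain
  obtain ⟨K₀, hK₀, hK₀d, -⟩ := hφ.exists_compact_superset
  obtain ⟨η₀, hη₀, hη₀c, -, -, hη₀1⟩ := exists_contDiff_cutoff hK₀ isOpen_univ (subset_univ _)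
  obtain ⟨χ, hχ, hχlim⟩ := exists_timeCutoffs t₀ T tc
  have hχη : ∀ n, ContDiff ℝ ∞ fun z : SpaceTime d => χ n z.2 * η₀ z := fun n =>
    (contDiff_of_time (hχ n).1).mul hη₀
  have hχηc : ∀ n, HasCompactSupport fun z : SpaceTime d => χ n z.2 * η₀ z := fun n =>
    hη₀c.mul_left
  have step : ∀ n, anisotropicSpace.mul (hχη n) (hχηc n) u ∈ S.topologicalClosure := fun n =>
    hφ.mul_mem_of_local S.topologicalClosure u hloc (hχ n).2.1 (hχ n).2.2.1 (hχη n) (hχηc n)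
  have hlim : ∀ᵐ z ∂(volume.restrict (domain t₀ T φ)), ∀ᶠ n in atTop, χ n z.2 = 1 := by
    filter_upwards [ae_restrict_mem hU.measurableSet,
      ae_restrict_of_ae (measure_eq_zero_iff_ae_notMem.1 (volume_timeSlice (d := d) tc))]
      with z hz hzt
    exact hχlim z.2 ⟨hz.1, hzt⟩
  have l1 := tendsto_eLpNorm_timeCutoff (Lp.memLp u.1.fst) (fun n => (hχ n).1.continuous)
    (fun n => (hχ n).2.2.2) hlim
  have l2 := tendsto_eLpNorm_timeCutoff (Lp.memLp u.1.snd) (fun n => (hχ n).1.continuous)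
    (fun n => (hχ n).2.2.2) hlim
  have hη1 : ∀ n, ∀ z ∈ domain t₀ T φ, (fun z : SpaceTime d => χ n z.2 * η₀ z) =ᶠ[𝓝 z]
      fun z => χ n z.2 := fun n z hz => by
    filter_upwards [hη₀1 z (hK₀d hz)] with y hy
    rw [hy, mul_one]
  -- Only spatial derivatives enter the norm of `H`, so steep time cutoffs create no gradient term
  -- and `χ_n u` converges to `u` by dominated convergence alone.
  have hgrad : ∀ n, ∀ z ∈ domain t₀ T φ,
      spatialGradient (fun z : SpaceTime d => χ n z.2 * η₀ z) z = 0 := fun n z hz => by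
    ext i
    rw [spatialGradient_apply ((hχη n).differentiable (by simp) z), spatialPartial,
      (hη1 n z hz).fderiv_eq]
    exact spatialPartial_eq_zero_of_time (fun _ _ _ => rfl)
      ((contDiff_of_time (hχ n).1).differentiable (by simp) z) i
  suffices hclosed : u ∈ closure (S.topologicalClosure : Set (anisotropicSpace (domain t₀ T φ))) by
    rwa [S.isClosed_topologicalClosure.closure_eq] at hclosed
  refine anisotropicSpace.mem_closure fun ε hε => ?_
  have hε' : 0 < ENNReal.ofReal ε := ENNReal.ofReal_pos.2 hε
  obtain ⟨n, hn1, hn2⟩ := ((l1.eventually_le_const hε').and (l2.eventually_le_const hε')).exists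
  refine ⟨_, step n, le_of_eq_of_le ?_ hn1, le_of_eq_of_le ?_ hn2⟩
  · refine eLpNorm_congr_ae ?_
    filter_upwards [anisotropicSpace.mul_fst (hχη n) (hχηc n) u,
      ae_restrict_mem hU.measurableSet] with z h1 hz
    rw [h1, (hη1 n z hz).eq_of_nhds]
  · refine eLpNorm_congr_ae ?_
    filter_upwards [anisotropicSpace.mul_snd (hχη n) (hχηc n) u,
      ae_restrict_mem hU.measurableSet] with z h1 hz
    rw [h1, mulGradient, hgrad n z hz, smul_zero, add_zero, (hη1 n z hz).eq_of_nhds]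

end IsAdmissible

end Density

/-! ### Density of smooth functions and of test functions. -/

section Trace

open Filter Topology Metric

variable {d : ℕ} {t₀ T : ℝ} {φ : SpaceTime d → ℝ} {xc : Space d} {tc : ℝ}

/-- The smooth functions on space-time. -/
def smoothFunctions (d : ℕ) : Submodule ℝ (SpaceTime d → ℝ) where
  carrier := {v | ContDiff ℝ ∞ v}
  zero_mem' := show ContDiff ℝ ∞ fun _ => (0 : ℝ) from contDiff_const
  add_mem' := fun {v w} (h : ContDiff ℝ ∞ v) (h' : ContDiff ℝ ∞ w) => h.add h'
  smul_mem' := fun c v (h : ContDiff ℝ ∞ v) => show ContDiff ℝ ∞ fun z => c • v z from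
    h.const_smul c

theorem smoothFunctions.contDiff (v : smoothFunctions d) : ContDiff ℝ ∞ v.1 := v.2

namespace IsAdmissible

theorem memLp_restrict_domain (hφ : IsAdmissible t₀ T φ xc tc) {F : Type*} [NormedAddCommGroup F]
    {f : SpaceTime d → F} (hf : Continuous f) : MemLp f 2 (volume.restrict (domain t₀ T φ)) := by
  have h := hφ.integrable_restrict_domain (hf.norm.pow 2)
  exact (memLp_two_iff_integrable_sq_norm
    (hφ.integrable_restrict_domain hf).aestronglyMeasurable).2 h

/-- The restriction of smooth functions to `𝒬`, as a map to `H`. -/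
def restriction (hφ : IsAdmissible t₀ T φ xc tc) :
    smoothFunctions d →ₗ[ℝ] anisotropicSpace (domain t₀ T φ) where
  toFun v := anisotropicSpace.mk (hφ.memLp_restrict_domain (smoothFunctions.contDiff v).continuous)
    (hφ.memLp_restrict_domain (continuous_spatialGradient ((smoothFunctions.contDiff v).of_le (by simp))))
    (IsWeakSpatialGradient.of_contDiff ((smoothFunctions.contDiff v).of_le (by simp)))
  map_add' _ _ := anisotropicSpace.ext_fst hφ.isOpen_domain rfl
  map_smul' _ _ := anisotropicSpace.ext_fst hφ.isOpen_domain rfl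

theorem restriction_fst (hφ : IsAdmissible t₀ T φ xc tc) (v : smoothFunctions d) :
    (hφ.restriction v).1.fst =ᵐ[volume.restrict (domain t₀ T φ)] v.1 :=
  MemLp.coeFn_toLp (hφ.memLp_restrict_domain (smoothFunctions.contDiff v).continuous)

theorem restriction_snd (hφ : IsAdmissible t₀ T φ xc tc) (v : smoothFunctions d) :
    (hφ.restriction v).1.snd =ᵐ[volume.restrict (domain t₀ T φ)] spatialGradient v.1 :=
  MemLp.coeFn_toLp (hφ.memLp_restrict_domain
    (continuous_spatialGradient ((smoothFunctions.contDiff v).of_le (by simp))))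

/-- If `v` is close to `η u`, then so is its class in `H`. -/
theorem eLpNorm_restriction_sub (hφ : IsAdmissible t₀ T φ xc tc) (v : smoothFunctions d)
    {η : SpaceTime d → ℝ} (hη : ContDiff ℝ ∞ η) (hηc : HasCompactSupport η)
    (u : anisotropicSpace (domain t₀ T φ)) :
    eLpNorm (fun z => (hφ.restriction v).1.fst z - (anisotropicSpace.mul hη hηc u).1.fst z) 2
        (volume.restrict (domain t₀ T φ)) =
      eLpNorm (fun z => v.1 z - η z • u.1.fst z) 2 (volume.restrict (domain t₀ T φ)) ∧
    eLpNorm (fun z => (hφ.restriction v).1.snd z - (anisotropicSpace.mul hη hηc u).1.snd z) 2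
        (volume.restrict (domain t₀ T φ)) =
      eLpNorm (fun z => spatialGradient v.1 z - mulGradient η u z) 2
        (volume.restrict (domain t₀ T φ)) :=
  ⟨eLpNorm_congr_ae ((hφ.restriction_fst v).sub (anisotropicSpace.mul_fst hη hηc u)),
    eLpNorm_congr_ae ((hφ.restriction_snd v).sub (anisotropicSpace.mul_snd hη hηc u))⟩

theorem mul_mem_topologicalClosure (hφ : IsAdmissible t₀ T φ xc tc)
    (S : Submodule ℝ (anisotropicSpace (domain t₀ T φ))) {η : SpaceTime d → ℝ}
    (hη : ContDiff ℝ ∞ η) (hηc : HasCompactSupport η) (u : anisotropicSpace (domain t₀ T φ))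
    (h : ∀ ε : ℝ≥0∞, 0 < ε → ∃ (v : SpaceTime d → ℝ) (hv : ContDiff ℝ ∞ v),
      hφ.restriction ⟨v, hv⟩ ∈ S ∧
      eLpNorm (fun z => v z - η z • u.1.fst z) 2 (volume.restrict (domain t₀ T φ)) ≤ ε ∧
      eLpNorm (fun z => spatialGradient v z - mulGradient η u z) 2
        (volume.restrict (domain t₀ T φ)) ≤ ε) :
    anisotropicSpace.mul hη hηc u ∈ S.topologicalClosure := by
  rw [← SetLike.mem_coe, Submodule.topologicalClosure_coe]
  refine anisotropicSpace.mem_closure fun ε hε => ?_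
  obtain ⟨v, hv, hS, h1, h2⟩ := h _ (ENNReal.ofReal_pos.2 hε)
  obtain ⟨e1, e2⟩ := hφ.eLpNorm_restriction_sub ⟨v, hv⟩ hη hηc u
  exact ⟨_, hS, e1.trans_le h1, e2.trans_le h2⟩

/-- The kernel is centred at `-c`. At points of the domain, the mollification then reads only values
of `η u` from the domain, so the weak gradient inside the domain is enough. -/
theorem exists_smooth_approx (hφ : IsAdmissible t₀ T φ xc tc) {N : Set (SpaceTime d)}
    (hN : ∀ r > 0, ∃ (c : SpaceTime d) (ρ : ℝ), 0 < ρ ∧ ‖c‖ + ρ ≤ r ∧ ∀ y ∈ N, ∀ u, ‖u - c‖ ≤ ρ →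
        (φ y ≤ 0 → y + u ∈ domain t₀ T φ) ∧ (y - u ∈ domain t₀ T φ → y ∈ domain t₀ T φ))
    (S : Submodule ℝ (anisotropicSpace (domain t₀ T φ))) (hS' : ∀ v, hφ.restriction v ∈ S)
    (u : anisotropicSpace (domain t₀ T φ)) {η : SpaceTime d → ℝ}
    (hη : ContDiff ℝ ∞ η) (hηc : HasCompactSupport η) (hηN : tsupport η ⊆ N)
    {ε : ℝ≥0∞} (hε : 0 < ε) : ∃ (v : SpaceTime d → ℝ) (hv : ContDiff ℝ ∞ v),
      hφ.restriction ⟨v, hv⟩ ∈ S ∧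
      eLpNorm (fun z => v z - η z • u.1.fst z) 2 (volume.restrict (domain t₀ T φ)) ≤ ε ∧
      eLpNorm (fun z => spatialGradient v z - mulGradient η u z) 2
        (volume.restrict (domain t₀ T φ)) ≤ ε := by
  have hu : HasWeakGradientAgainst (domain t₀ T φ) u := u.2
  have hS : ∀ r > 0, ∃ (c : SpaceTime d) (ρ : ℝ), 0 < ρ ∧ ‖c‖ + ρ ≤ r ∧
      ∀ y ∈ N, ∀ w, ‖w - -c‖ ≤ ρ → y - w ∈ domain t₀ T φ → y ∈ domain t₀ T φ := fun r hr => by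
    obtain ⟨c, ρ, hρ, hr, h⟩ := hN r hr
    refine ⟨-c, ρ, hρ, by rwa [norm_neg], fun y hy w hw => ?_⟩
    rw [neg_neg] at hw
    exact (h y hy w hw).2
  obtain ⟨v, c, ρ, -, hv, -, -, h1, h2⟩ := hu.exists_approx hφ.isOpen_domain.measurableSet hη hηc
    hS (fun c ρ h z hz y hy hzy => h y (hηN hy) (y - z)
      (by rwa [← norm_neg, show -(y - z - -c) = z - y - c by abel]) (by rwa [sub_sub_cancel])) hε
  exact ⟨v, hv, hS' _, h1, h2⟩

theorem mem_topologicalClosure_of_restriction_mem (hφ : IsAdmissible t₀ T φ xc tc)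
    (S : Submodule ℝ (anisotropicSpace (domain t₀ T φ))) (hS : ∀ v, hφ.restriction v ∈ S)
    (u : anisotropicSpace (domain t₀ T φ)) : u ∈ S.topologicalClosure := by
  refine hφ.mem_topologicalClosure_of_local S u fun z₀ hz₀ hzt h0 => ?_
  have hzc : z₀ ≠ (xc, tc) := fun h => hzt (congrArg Prod.snd h)
  exact (hφ.exists_shift hz₀ hzc h0).imp fun N hN => ⟨hN.1, hN.2.1, fun η hη hηc hηN =>
    hφ.mul_mem_topologicalClosure S hη hηc u fun ε hε =>
      hφ.exists_smooth_approx hN.2.2.2 S hS u hη hηc hηN hε⟩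

/-- The smooth functions are dense in `H`. -/
theorem denseRange_restriction (hφ : IsAdmissible t₀ T φ xc tc) : DenseRange hφ.restriction := by
  intro u
  have := hφ.mem_topologicalClosure_of_restriction_mem _ (LinearMap.mem_range_self hφ.restriction) u
  rwa [← SetLike.mem_coe, Submodule.topologicalClosure_coe, LinearMap.coe_range] at this

/-- The kernel is centred at `c` and pushes the support of the extension by zero strictly inside the
domain. In return the mollification near the boundary also sees points outside, so integration by
parts is required across the boundary, in the whole slab off the critical time. -/
theorem exists_testFunction_approx (hφ : IsAdmissible t₀ T φ xc tc) {N : Set (SpaceTime d)}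
    (hNs : N ⊆ openSlab d t₀ T)
    (hN : ∀ r > 0, ∃ (c : SpaceTime d) (ρ : ℝ), 0 < ρ ∧ ‖c‖ + ρ ≤ r ∧ ∀ y ∈ N, ∀ u, ‖u - c‖ ≤ ρ →
        (φ y ≤ 0 → y + u ∈ domain t₀ T φ) ∧ (y - u ∈ domain t₀ T φ → y ∈ domain t₀ T φ))
    (S : Submodule ℝ (anisotropicSpace (domain t₀ T φ)))
    (hS' : ∀ v : smoothFunctions d, IsTestFunction (domain t₀ T φ) v.1 → hφ.restriction v ∈ S)
    {u : anisotropicSpace (domain t₀ T φ)}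
    (hu : HasWeakGradientAgainst {z ∈ openSlab d t₀ T | z.2 ≠ tc} u) {η : SpaceTime d → ℝ}
    (hη : ContDiff ℝ ∞ η) (hηc : HasCompactSupport η) (hηN : tsupport η ⊆ N ∩ {z | z.2 ≠ tc})
    {ε : ℝ≥0∞} (hε : 0 < ε) : ∃ (v : SpaceTime d → ℝ) (hv : ContDiff ℝ ∞ v),
      hφ.restriction ⟨v, hv⟩ ∈ S ∧
      eLpNorm (fun z => v z - η z • u.1.fst z) 2 (volume.restrict (domain t₀ T φ)) ≤ ε ∧
      eLpNorm (fun z => spatialGradient v z - mulGradient η u z) 2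
        (volume.restrict (domain t₀ T φ)) ≤ ε := by
  have hS : ∀ r > 0, ∃ (c : SpaceTime d) (ρ : ℝ), 0 < ρ ∧ ‖c‖ + ρ ≤ r ∧
      ∀ y ∈ N, ∀ w, ‖w - c‖ ≤ ρ → φ y ≤ 0 → y + w ∈ domain t₀ T φ := fun r hr => by
    obtain ⟨c, ρ, hρ, hr, h⟩ := hN r hr
    exact ⟨c, ρ, hρ, hr, fun y hy w hw => (h y hy w hw).1⟩
  obtain ⟨v, c, ρ, hcρ, hv, hvc, hvs, h1, h2⟩ := hu.exists_approx
    hφ.isOpen_domain.measurableSet hη hηc hS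
    (fun c ρ h z hz y hy hzy => ⟨hNs (hηN hy).1, (hηN hy).2⟩) hε
  refine ⟨v, hv, hS' _ ⟨hv, hvc, fun z hz => ?_⟩, h1, h2⟩
  obtain ⟨y, ⟨hyη, hyU⟩, hzy⟩ := hvs z hz
  have hyN := (hηN hyη).1
  have hφy : φ y ≤ 0 := by
    have hcont : ContinuousAt φ y := (hφ.contDiffAt (hNs hyN)).continuousAt
    by_contra! hpos
    have : ∃ᶠ x in 𝓝 y, x ∈ domain t₀ T φ := mem_closure_iff_frequently.1 hyU
    obtain ⟨x, hx, hx'⟩ := (this.and_eventually (hcont.eventually (lt_mem_nhds hpos))).exists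
    exact lt_asymm hx.2 hx'
  have := hcρ y hyN (z - y) hzy hφy
  rwa [add_sub_cancel] at this

theorem mem_topologicalClosure_of_testFunction_mem (hφ : IsAdmissible t₀ T φ xc tc)
    (S : Submodule ℝ (anisotropicSpace (domain t₀ T φ)))
    (hS : ∀ v : smoothFunctions d, IsTestFunction (domain t₀ T φ) v.1 → hφ.restriction v ∈ S)
    {u : anisotropicSpace (domain t₀ T φ)}
    (hu : HasWeakGradientAgainst {z ∈ openSlab d t₀ T | z.2 ≠ tc} u) :
    u ∈ S.topologicalClosure := by
  refine hφ.mem_topologicalClosure_of_local S u fun z₀ hz₀ hzt h0 => ?_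
  have hzc : z₀ ≠ (xc, tc) := fun h => hzt (congrArg Prod.snd h)
  have ho : IsOpen {z : SpaceTime d | z.2 ≠ tc} := isOpen_ne_fun continuous_snd continuous_const
  exact (hφ.exists_shift hz₀ hzc h0).elim fun N hN => ⟨N ∩ {z | z.2 ≠ tc}, hN.1.inter ho,
    ⟨hN.2.1, hzt⟩, fun η hη hηc hηN =>
    hφ.mul_mem_topologicalClosure S hη hηc u fun ε hε =>
      hφ.exists_testFunction_approx hN.2.2.1 hN.2.2.2 S hS hu hη hηc hηN hε⟩

/-- The test functions in `U`, as a subspace of the smooth functions. -/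
def testSubmodule (U : Set (SpaceTime d)) : Submodule ℝ (smoothFunctions d) where
  carrier := {v | IsTestFunction U v.1}
  zero_mem' := show IsTestFunction U fun _ => 0 from
    ⟨contDiff_const, HasCompactSupport.zero, by simp [tsupport]⟩
  add_mem' := fun {v w} (hv : IsTestFunction U v.1) (hw : IsTestFunction U w.1) =>
    show IsTestFunction U (v.1 + w.1) from ⟨hv.1.add hw.1, hv.2.1.add hw.2.1,
      (closure_mono (Function.support_add _ _)).trans
        (closure_union.trans_subset (union_subset hv.2.2 hw.2.2))⟩
  smul_mem' := fun c v (hv : IsTestFunction U v.1) => show IsTestFunction U (c • v.1) from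
    ⟨hv.1.const_smul c, hv.2.1.smul_left (f := fun _ => c),
      (closure_mono (Function.support_const_smul_subset c _)).trans hv.2.2⟩

/-- The functions in `H` whose weak gradient has no part on the boundary can be approximated by
test functions. -/
theorem mem_closure_testFunctions (hφ : IsAdmissible t₀ T φ xc tc)
    {u : anisotropicSpace (domain t₀ T φ)}
    (hu : HasWeakGradientAgainst {z ∈ openSlab d t₀ T | z.2 ≠ tc} u) :
    u ∈ closure (testFunctions (domain t₀ T φ)) := by
  have h := hφ.mem_topologicalClosure_of_testFunction_mem
    ((testSubmodule (domain t₀ T φ)).map hφ.restriction)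
    (fun v hv => Submodule.mem_map_of_mem hv) hu
  rw [← SetLike.mem_coe, Submodule.topologicalClosure_coe] at h
  refine closure_mono ?_ h
  rintro _ ⟨v, hv, rfl⟩
  exact ⟨v.1, hv, hφ.restriction_fst v⟩

end IsAdmissible

end Trace

/-! ### The trace operator and its kernel. -/

section TraceOperator

open Filter Topology Metric

variable {d : ℕ} {t₀ T : ℝ} {φ : SpaceTime d → ℝ} {xc : Space d} {tc : ℝ}

theorem continuous_integral_mul {X : Type*} [MeasurableSpace X] {μ : Measure X} {g : X → ℝ}
    (hg : MemLp g 2 μ) : Continuous fun u : Lp ℝ 2 μ => ∫ z, u z * g z ∂μ := by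
  have h : ∀ u : Lp ℝ 2 μ, ∫ z, u z * g z ∂μ = inner ℝ (hg.toLp g) u := fun u => by
    rw [L2.inner_def]
    refine integral_congr_ae ?_
    filter_upwards [hg.coeFn_toLp] with z hz
    simp [hz]
  simp only [h]
  exact continuous_const.inner continuous_id

theorem anisotropicSpace.continuous_fst (U : Set (SpaceTime d)) :
    Continuous fun u : anisotropicSpace U => u.1.fst :=
  (WithLp.continuous_fst 2 _ _).comp continuous_subtype_val

theorem anisotropicSpace.continuous_snd (U : Set (SpaceTime d)) :
    Continuous fun u : anisotropicSpace U => u.1.snd :=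
  (WithLp.continuous_snd 2 _ _).comp continuous_subtype_val

/-- The defect in the integration by parts formula. -/
def boundaryPairing {U : Set (SpaceTime d)} (ψ : SpaceTime d → ℝ) (i : Fin d)
    (u : anisotropicSpace U) : ℝ :=
  (∫ z in U, u.1.fst z * spatialPartial i ψ z) + ∫ z in U, u.1.snd z i * ψ z

theorem IsTestFunction.memLp_restrict {V : Set (SpaceTime d)} {ψ : SpaceTime d → ℝ}
    (hψ : IsTestFunction V ψ) (U : Set (SpaceTime d)) : MemLp ψ 2 (volume.restrict U) :=
  (hψ.1.continuous.memLp_of_hasCompactSupport hψ.2.1 (μ := volume)).restrict U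

theorem IsTestFunction.memLp_partial_restrict {V : Set (SpaceTime d)} {ψ : SpaceTime d → ℝ}
    (hψ : IsTestFunction V ψ) (U : Set (SpaceTime d)) (i : Fin d) :
    MemLp (spatialPartial i ψ) 2 (volume.restrict U) :=
  IsTestFunction.memLp_partial (U := U ∪ V)
    ⟨hψ.1, hψ.2.1, hψ.2.2.trans subset_union_right⟩ i |>.mono_measure
      (Measure.restrict_mono subset_union_left le_rfl)

theorem continuous_boundaryPairing {U V : Set (SpaceTime d)} {ψ : SpaceTime d → ℝ}
    (hψ : IsTestFunction V ψ) (i : Fin d) :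
    Continuous (boundaryPairing ψ i : anisotropicSpace U → ℝ) := by
  refine ((continuous_integral_mul (hψ.memLp_partial_restrict U i)).comp
    (anisotropicSpace.continuous_fst U)).add ?_
  have h : ∀ p : Lp (Space d) 2 (volume.restrict U), ∫ z in U, p z i * ψ z
      = ∫ z in U, ((EuclideanSpace.proj (𝕜 := ℝ) i : Space d →L[ℝ] ℝ).compLpL 2 _ p) z * ψ z :=
    fun p => integral_congr_ae (by
      filter_upwards [(EuclideanSpace.proj (𝕜 := ℝ) i : Space d →L[ℝ] ℝ).coeFn_compLpL p] with z hz
      rw [hz]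
      rfl)
  simp only [h]
  exact (continuous_integral_mul (hψ.memLp_restrict U)).comp
    ((ContinuousLinearMap.continuous _).comp (anisotropicSpace.continuous_snd U))

namespace IsAdmissible

theorem boundaryPairing_restriction (hφ : IsAdmissible t₀ T φ xc tc) {ψ : SpaceTime d → ℝ}
    (hψ : ContDiff ℝ ∞ ψ) (i : Fin d) (v : smoothFunctions d) :
    boundaryPairing ψ i (hφ.restriction v)
      = ∫ z in domain t₀ T φ, spatialPartial i (fun z => v.1 z * ψ z) z := by
  have hv := smoothFunctions.contDiff v
  have hgc : Continuous fun z => spatialGradient v.1 z i :=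
    (EuclideanSpace.proj (𝕜 := ℝ) i).continuous.comp
      (continuous_spatialGradient (hv.of_le (by simp)))
  have e1 : ∫ z in domain t₀ T φ, (hφ.restriction v).1.fst z * spatialPartial i ψ z
      = ∫ z in domain t₀ T φ, v.1 z * spatialPartial i ψ z := integral_congr_ae (by
    filter_upwards [hφ.restriction_fst v] with z hz
    rw [hz])
  have e2 : ∫ z in domain t₀ T φ, (hφ.restriction v).1.snd z i * ψ z
      = ∫ z in domain t₀ T φ, spatialGradient v.1 z i * ψ z := integral_congr_ae (by
    filter_upwards [hφ.restriction_snd v] with z hz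
    rw [hz])
  have i1 : Integrable (fun z => v.1 z * spatialPartial i ψ z)
      (volume.restrict (domain t₀ T φ)) := hφ.integrable_restrict_domain (hv.continuous.mul
    ((hψ.continuous_fderiv (by simp)).clm_apply continuous_const))
  have i2 : Integrable (fun z => spatialGradient v.1 z i * ψ z)
      (volume.restrict (domain t₀ T φ)) := hφ.integrable_restrict_domain (hgc.mul hψ.continuous)
  rw [boundaryPairing, e1, e2, ← integral_add i1 i2]
  refine integral_congr_ae (Eventually.of_forall fun z => ?_)
  have := spatialPartial_mul (hv.differentiable (by simp) z) (hψ.differentiable (by simp) z) i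
  simp only [this, spatialGradient_apply (hv.differentiable (by simp) z)]

theorem eLpNorm_eq_norm_restriction_fst (hφ : IsAdmissible t₀ T φ xc tc) (v : smoothFunctions d) :
    eLpNorm v.1 2 (volume.restrict (domain t₀ T φ))
      = ENNReal.ofReal ‖(hφ.restriction v).1.fst‖ := by
  rw [← eLpNorm_congr_ae (hφ.restriction_fst v), Lp.norm_def,
    ENNReal.ofReal_toReal (Lp.eLpNorm_ne_top _)]

theorem eLpNorm_eq_norm_restriction_snd (hφ : IsAdmissible t₀ T φ xc tc) (v : smoothFunctions d) :
    eLpNorm (spatialGradient v.1) 2 (volume.restrict (domain t₀ T φ))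
      = ENNReal.ofReal ‖(hφ.restriction v).1.snd‖ := by
  rw [← eLpNorm_congr_ae (hφ.restriction_snd v), Lp.norm_def,
    ENNReal.ofReal_toReal (Lp.eLpNorm_ne_top _)]

theorem _root_.EvolvingDomain.sq_add_sq_eq_ofReal {A B : ℝ≥0∞} {a b n : ℝ} (ha : 0 ≤ a)
    (hb : 0 ≤ b) (hA : A = ENNReal.ofReal a) (hB : B = ENNReal.ofReal b)
    (hn : n ^ 2 = a ^ 2 + b ^ 2) : A ^ 2 + B ^ 2 = ENNReal.ofReal (n ^ 2) := by
  rw [hn, ENNReal.ofReal_add (sq_nonneg _) (sq_nonneg _), ENNReal.ofReal_pow ha,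
    ENNReal.ofReal_pow hb, hA, hB]

theorem lintegral_eq_norm_restriction_sq (hφ : IsAdmissible t₀ T φ xc tc)
    (v : smoothFunctions d) :
    ∫⁻ z in domain t₀ T φ, (‖v.1 z‖ₑ ^ 2 + ‖spatialGradient v.1 z‖ₑ ^ 2)
      = ENNReal.ofReal (‖hφ.restriction v‖ ^ 2) := by
  rw [lintegral_add_left
    ((smoothFunctions.contDiff v).continuous.measurable.enorm.pow_const 2), ← eLpNorm_two_sq,
    ← eLpNorm_two_sq]
  exact sq_add_sq_eq_ofReal (norm_nonneg _) (norm_nonneg _) (hφ.eLpNorm_eq_norm_restriction_fst v)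
    (hφ.eLpNorm_eq_norm_restriction_snd v) (anisotropicSpace.norm_sq _)

theorem exists_eLpNorm_le (hφ : IsAdmissible t₀ T φ xc tc) (hd : 1 ≤ d) :
    ∃ C : ℝ, 0 ≤ C ∧ ∀ v : smoothFunctions d,
      eLpNorm v.1 2 (weightedSurfaceMeasure t₀ T φ xc tc)
        ≤ ENNReal.ofReal (C * ‖hφ.restriction v‖) := by
  obtain ⟨C, hC, H⟩ := hφ.exists_trace_bound hd
  refine ⟨√C, Real.sqrt_nonneg C, fun v => ?_⟩
  have h := H v.1 (smoothFunctions.contDiff v)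
  rw [← eLpNorm_two_sq, hφ.lintegral_eq_norm_restriction_sq, ← ENNReal.ofReal_mul hC.le] at h
  have e : C * ‖hφ.restriction v‖ ^ 2 = (√C * ‖hφ.restriction v‖) ^ 2 := by
    rw [mul_pow, Real.sq_sqrt hC.le]
  rw [e, ENNReal.ofReal_pow (mul_nonneg (Real.sqrt_nonneg C) (norm_nonneg _))] at h
  exact (ENNReal.pow_le_pow_left_iff two_ne_zero).1 h

theorem memLp_weightedSurfaceMeasure (hφ : IsAdmissible t₀ T φ xc tc) (hd : 1 ≤ d)
    (v : smoothFunctions d) : MemLp v.1 2 (weightedSurfaceMeasure t₀ T φ xc tc) := by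
  obtain ⟨C, -, H⟩ := hφ.exists_eLpNorm_le hd
  exact ⟨(smoothFunctions.contDiff v).continuous.aestronglyMeasurable,
    (H v).trans_lt ENNReal.ofReal_lt_top⟩

/-- The restriction of smooth functions to the spatial boundary. -/
def boundaryRestriction (hφ : IsAdmissible t₀ T φ xc tc) (hd : 1 ≤ d) :
    smoothFunctions d →ₗ[ℝ] Lp ℝ 2 (weightedSurfaceMeasure t₀ T φ xc tc) where
  toFun v := (hφ.memLp_weightedSurfaceMeasure hd v).toLp v.1
  map_add' _ _ := rfl
  map_smul' _ _ := rfl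

theorem exists_norm_boundaryRestriction_le (hφ : IsAdmissible t₀ T φ xc tc) (hd : 1 ≤ d) :
    ∃ C : ℝ, ∀ v, ‖hφ.boundaryRestriction hd v‖ ≤ C * ‖hφ.restriction v‖ := by
  obtain ⟨C, hC, H⟩ := hφ.exists_eLpNorm_le hd
  refine ⟨C, fun v => ?_⟩
  change ‖(hφ.memLp_weightedSurfaceMeasure hd v).toLp v.1‖ ≤ _
  rw [Lp.norm_toLp]
  exact ENNReal.toReal_le_of_le_ofReal (by positivity) (H v)

/-- The trace operator. -/
def trace (hφ : IsAdmissible t₀ T φ xc tc) (hd : 1 ≤ d) :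
    anisotropicSpace (domain t₀ T φ) →L[ℝ] Lp ℝ 2 (weightedSurfaceMeasure t₀ T φ xc tc) :=
  (hφ.boundaryRestriction hd).extendOfNorm hφ.restriction

theorem trace_restriction (hφ : IsAdmissible t₀ T φ xc tc) (hd : 1 ≤ d) (v : smoothFunctions d) :
    hφ.trace hd (hφ.restriction v) = hφ.boundaryRestriction hd v :=
  LinearMap.extendOfNorm_eq hφ.denseRange_restriction (hφ.exists_norm_boundaryRestriction_le hd) v

theorem isTraceOperator_trace (hφ : IsAdmissible t₀ T φ xc tc) (hd : 1 ≤ d) :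
    IsTraceOperator t₀ T φ xc tc (hφ.trace hd) := by
  intro v hv u hu
  have : u = hφ.restriction ⟨v, hv⟩ :=
    hu.unique hφ.isOpen_domain (hφ.restriction_fst ⟨v, hv⟩)
  rw [this, hφ.trace_restriction hd]
  exact MemLp.coeFn_toLp (hφ.memLp_weightedSurfaceMeasure hd ⟨v, hv⟩)

theorem _root_.EvolvingDomain.IsTraceOperator.unique (hφ : IsAdmissible t₀ T φ xc tc)
    {τ τ' : anisotropicSpace (domain t₀ T φ) →L[ℝ]
      Lp ℝ 2 (weightedSurfaceMeasure t₀ T φ xc tc)}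
    (h : IsTraceOperator t₀ T φ xc tc τ) (h' : IsTraceOperator t₀ T φ xc tc τ') : τ = τ' := by
  refine DFunLike.coe_injective (hφ.denseRange_restriction.equalizer τ.continuous τ'.continuous
    (funext fun v => Lp.ext ?_))
  have hv := smoothFunctions.contDiff v
  exact (h v.1 hv _ (hφ.restriction_fst v)).trans (h' v.1 hv _ (hφ.restriction_fst v)).symm

/-- The boundary terms in the integration by parts formula are controlled by the trace. -/
theorem exists_boundaryPairing_le (hφ : IsAdmissible t₀ T φ xc tc) (hd : 1 ≤ d)
    {ψ : SpaceTime d → ℝ} (hψ : IsTestFunction {z ∈ openSlab d t₀ T | z.2 ≠ tc} ψ) (i : Fin d) :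
    ∃ M : ℝ, ∀ u, ‖boundaryPairing ψ i u‖ ≤ M * ‖hφ.trace hd u‖ := by
  obtain ⟨C, H⟩ := hφ.exists_integral_partial_mul_le hψ.1 hψ.2.1 (fun z hz => (hψ.2.2 hz).1)
    (fun z hz => (hψ.2.2 hz).2) i
  set P := (hφ.memLp_weightedSurfaceMeasure hd ⟨ψ, hψ.1⟩).toLp ψ with hP
  -- Both sides are continuous in `u`, so density reduces the claim to smooth `v`. There the pairing
  -- is `∫ ∂_i (v ψ)`, bounded by the weighted boundary integral of `|v ψ|`, and Cauchy–Schwarz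
  -- gives the product of the norms of `v` and `ψ` in `L²_ω`.
  refine ⟨C * ‖P‖, fun u => hφ.denseRange_restriction.induction_on u
    (isClosed_le (continuous_boundaryPairing hψ i).norm
      (continuous_const.mul (hφ.trace hd).continuous.norm)) fun v => ?_⟩
  have hv := smoothFunctions.contDiff v
  have hvm := hφ.memLp_weightedSurfaceMeasure hd v
  have hψm := hφ.memLp_weightedSurfaceMeasure hd ⟨ψ, hψ.1⟩
  rw [hφ.trace_restriction hd, hφ.boundaryPairing_restriction hψ.1]
  change _ ≤ _ * ‖hvm.toLp v.1‖
  have h1 := H v.1 (hv.of_le (by simp))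
  have h2 : ∫⁻ z, ‖v.1 z * ψ z‖ₑ ∂(weightedSurfaceMeasure t₀ T φ xc tc)
      ≤ ‖hvm.toLp v.1‖ₑ * ‖P‖ₑ := by
    have := eLpNorm_smul_le_mul_eLpNorm (p := 2) (q := 2) (r := 1) hψm.1 hvm.1
    rw [eLpNorm_one_eq_lintegral_enorm] at this
    rwa [Lp.enorm_toLp, hP, Lp.enorm_toLp]
  have h3 := h1.trans (mul_le_mul_right h2 _)
  have h4 := ENNReal.toReal_mono (by finiteness) h3
  simp only [ENNReal.toReal_mul, toReal_enorm, ENNReal.coe_toReal] at h4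
  exact h4.trans_eq (by ring)

/-- The bound by the trace kills the boundary term even for `ψ` whose support crosses `Γ_𝒬`. This is
exactly what mollification with inward shifts requires. -/
theorem hasWeakGradientAgainst_of_trace_eq_zero (hφ : IsAdmissible t₀ T φ xc tc) (hd : 1 ≤ d)
    {u : anisotropicSpace (domain t₀ T φ)} (hu : hφ.trace hd u = 0) :
    HasWeakGradientAgainst {z ∈ openSlab d t₀ T | z.2 ≠ tc} u := by
  intro ψ hψ i
  obtain ⟨M, hM⟩ := hφ.exists_boundaryPairing_le hd hψ i
  have h := hM u
  rw [hu, norm_zero, mul_zero] at h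
  exact eq_neg_of_add_eq_zero_left (norm_le_zero_iff.1 h)

theorem trace_eq_zero_of_mem_testFunctions (hφ : IsAdmissible t₀ T φ xc tc) (hd : 1 ≤ d)
    {u : anisotropicSpace (domain t₀ T φ)} (hu : u ∈ testFunctions (domain t₀ T φ)) :
    hφ.trace hd u = 0 := by
  obtain ⟨ψ, hψ, hu⟩ := hu
  refine Lp.ext ((hφ.isTraceOperator_trace hd ψ hψ.1 u hu).trans
    (EventuallyEq.trans ?_ (Lp.coeFn_zero _ _ _).symm))
  refine (withDensity_absolutelyContinuous _ _).ae_le ?_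
  filter_upwards [ae_restrict_mem hφ.measurableSet_lateralBoundary] with z hz
  exact image_eq_zero_of_notMem_tsupport fun h => (hψ.2.2 h).2.ne hz.2

theorem closure_testFunctions (hφ : IsAdmissible t₀ T φ xc tc) (hd : 1 ≤ d) :
    closure (testFunctions (domain t₀ T φ)) = {u | hφ.trace hd u = 0} :=
  Subset.antisymm
    (closure_minimal (fun _ hu => hφ.trace_eq_zero_of_mem_testFunctions hd hu)
      (isClosed_eq (hφ.trace hd).continuous continuous_const))
    fun _ hu => hφ.mem_closure_testFunctions (hφ.hasWeakGradientAgainst_of_trace_eq_zero hd hu)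

end IsAdmissible

end TraceOperator

end EvolvingDomain

end

theorem mainTheorem3 (d : ℕ) (hd : d = 2 ∨ d = 3) (t₀ T : ℝ)
    (φ : EvolvingDomain.SpaceTime d → ℝ) (xc : EvolvingDomain.Space d) (tc : ℝ)
    (hφ : EvolvingDomain.IsAdmissible t₀ T φ xc tc) :
    ∃ τ : EvolvingDomain.anisotropicSpace (EvolvingDomain.domain t₀ T φ) →L[ℝ]
        Lp ℝ 2 (EvolvingDomain.weightedSurfaceMeasure t₀ T φ xc tc),
      EvolvingDomain.IsTraceOperator t₀ T φ xc tc τ ∧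
      (∀ τ', EvolvingDomain.IsTraceOperator t₀ T φ xc tc τ' → τ' = τ) ∧
      closure (EvolvingDomain.testFunctions (EvolvingDomain.domain t₀ T φ)) = {u | τ u = 0} := by
  have hd' : 1 ≤ d := by omega
  exact ⟨hφ.trace hd', hφ.isTraceOperator_trace hd',
    fun _ h => EvolvingDomain.IsTraceOperator.unique hφ h (hφ.isTraceOperator_trace hd'),
    hφ.closure_testFunctions hd'⟩
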